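/- \textbf{Definitions.} A \emph{dendrite} is a compact, connected, locally connected, metrizable space in which any two distinct points are the endpoints of a unique arc. The \emph{order} of a point $x$ is the number of connected components of $X\setminus\{x\}$; $x$ is an \emph{endpoint} if its order is $1$ and a \emph{ramification point} if its order is at least $3$. $W_{\{3,4\}}$ denotes the Wa\.zewski dendrite: the nondegenerate dendrite (unique up to homeomorphism) in which every ramification point has order $3$ or $4$ and, for each $p\in\{3,4\}$, every arc contains a ramification point of order $p$. For a group $G$ acting on a compact space $X$ by homeomorphisms, the \emph{Ellis semigroup} $E(X,G)$ is the closure of $\{x\mapsto gx : g\in G\}$ in $X^X$ with the topology of pointwise convergence. The action is \emph{$\mathrm{tame}_1$} if $E(X,G)$ is a first countable Rosenthal compactum, that is, it is first countable and homeomorphic to a compact subspace of the space $B_1(Y,\mathbb R)$ of Baire class 1 functions on some Polish space $Y$, with the topology of pointwise convergence. \textbf{Construction of $X$.} Let $T_0,T_1$ be two copies of $[0,1]$ with countable dense sets $D_0,D_1$ such that $\frac n{n+1}\notin D_i$ for all $n\in\mathbb N=\{0,1,2,\dots\}$ and $i\in\{0,1\}$. A point of $D_i\cap\left(\frac n{n+1},\frac{n+1}{n+2}\right)$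 is coloured red if $n+i$ is even and green if $n+i$ is odd. Let $X_0$ be four copies of $T_0$ glued together at $0$. Given $X_i$, each of whose maximal free arcs $A$ is a copy of $T_0$ or $T_1$, let $X_{i+1}$ be obtained by attaching, at every coloured point $a$ of every such $A$, two copies of $T_0$ if $a$ is red and one copy of $T_1$ if $a$ is green, in each case by identifying the point $0$ of the copy with $a$; the attached sets at different points are disjoint, meet $X_i$ only at the attaching point, and form a null family (for every $\varepsilon>0$ only finitely many have diameter $>\varepsilon$). Let $f_i^{i+1}\colon X_{i+1}\to X_i$ be the identity on $X_i$ and send each attached copy to its attaching point, and let $X=\varprojlim(X_i,f_i^{i+1})$. Each copy of $T_0$ or $T_1$ used in the construction is regarded as an arc in $X$ and is called a \emph{leg}. An endpoint $x$ of $X$ is \emph{green} (respectively \emph{red}) if for every arc $\gamma\colon[0,1]\to X$ with $\gamma(1)=x$ there is $r\in[0,1)$ such that all ramification points of $X$ in $\gamma([r,1])$ have order $3$ (respectively $4$); it is \emph{alternating} if it is neither green nor red. \textbf{Theorem.} For all such $D_0,D_1$: \begin{enumerate} \item $X$ is a dendrite, and each of its ramification points has order $3$ or $4$. Moreover, on each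 leg, a copy of $T_i$, the point at position $t\in(0,1)$ has order $4$ in $X$ if and only if $t$ is a red point of $D_i$, and order $3$ in $X$ if and only if $t$ is a green point of $D_i$. \item $X$ is not homeomorphic to $W_{\{3,4\}}$. \item The action of $\mathrm{Homeo}(X)$ on $X$ is minimal, that is, every orbit is dense. \item $X$ has uncountably many alternating endpoints, and for any two distinct alternating endpoints $a,b$ the map $p_{a,b}\colon X\to X$ with $p_{a,b}(b)=b$ and $p_{a,b}(x)=a$ for $x\neq b$ is an idempotent of $E(X,\mathrm{Homeo}(X))$. \item $E(X,\mathrm{Homeo}(X))$ is not first countable, and the action of $\mathrm{Homeo}(X)$ on $X$ is not $\mathrm{tame}_1$. \end{enumerate} -/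

import Mathlib

/-! ### Arcs, dendrites, ramification points -/

/-- `A` is an arc with endpoints `x` and `y`: a homeomorphic image of `[0,1]`, with `0` sent to `x`
and `1` sent to `y`. -/
def IsArcBetween {X : Type*} [TopologicalSpace X] (A : Set X) (x y : X) : Prop :=
  ∃ γ : unitInterval → X, Topology.IsEmbedding γ ∧ γ 0 = x ∧ γ 1 = y ∧ Set.range γ = A

/-- A dendrite: a compact, connected, locally connected, metrizable space in which any two
distinct points are the endpoints of a unique arc. -/
structure IsDendrite (X : Type*) [TopologicalSpace X] : Prop where
  compact : CompactSpace X
  connected : ConnectedSpace X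
  locallyConnected : LocallyConnectedSpace X
  metrizable : TopologicalSpace.MetrizableSpace X
  uniqueArc : ∀ x y : X, x ≠ y → ∃! A : Set X, IsArcBetween A x y

/-- The order of a point `x`: the number of connected components of `X \ {x}`. -/
noncomputable def pointOrder {X : Type*} [TopologicalSpace X] (x : X) : ℕ∞ :=
  ENat.card (ConnectedComponents ↥({x}ᶜ : Set X))

def IsEndpoint {X : Type*} [TopologicalSpace X] (x : X) : Prop := pointOrder x = 1

def IsRamification {X : Type*} [TopologicalSpace X] (x : X) : Prop := 3 ≤ pointOrder x

/-- `S` meets every (nondegenerate) arc. -/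
def IsArcwiseDense {X : Type*} [TopologicalSpace X] (S : Set X) : Prop :=
  ∀ (A : Set X) (x y : X), IsArcBetween A x y → (A ∩ S).Nonempty

/-- The Ważewski dendrite `W_P`, `P ⊆ {3, 4, …, ω}` (here `ω` is `⊤`), given by its topological
characterization: a nondegenerate dendrite all of whose ramification points have order in `P`, and
in which, for each `p ∈ P`, the ramification points of order `p` are arcwise dense. -/
structure IsWazewski (P : Set ℕ∞) (X : Type*) [TopologicalSpace X] : Prop where
  dendrite : IsDendrite X
  nontrivial : Nontrivial X
  order_mem : ∀ x : X, IsRamification x → pointOrder x ∈ P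
  arcwiseDense : ∀ p ∈ P, IsArcwiseDense {x : X | IsRamification x ∧ pointOrder x = p}

/-! ### Types of endpoints (when all ramification points have order `3` or `4`) -/

def IsGreenEndpoint {X : Type*} [TopologicalSpace X] (x : X) : Prop :=
  IsEndpoint x ∧ ∀ γ : unitInterval → X, Topology.IsEmbedding γ → γ 1 = x →
    ∃ r : unitInterval, r < 1 ∧ ∀ s, r ≤ s → IsRamification (γ s) → pointOrder (γ s) = 3

def IsRedEndpoint {X : Type*} [TopologicalSpace X] (x : X) : Prop :=
  IsEndpoint x ∧ ∀ γ : unitInterval → X, Topology.IsEmbedding γ → γ 1 = x →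
    ∃ r : unitInterval, r < 1 ∧ ∀ s, r ≤ s → IsRamification (γ s) → pointOrder (γ s) = 4

def IsAlternatingEndpoint {X : Type*} [TopologicalSpace X] (x : X) : Prop :=
  IsEndpoint x ∧ ¬ IsGreenEndpoint x ∧ ¬ IsRedEndpoint x

/-! ### Dynamical systems -/

/-- The natural action of `Homeo(X)` on `X`. -/
instance homeoMulAction (X : Type*) [TopologicalSpace X] : MulAction (X ≃ₜ X) X where
  smul h x := h x
  one_smul _ := rfl
  mul_smul _ _ _ := rfl

/-- The Ellis semigroup: the closure in `X ^ X`, with the topology of pointwise convergence, of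
the set of maps `x ↦ g • x`. -/
def ellisSemigroup (G X : Type*) [Group G] [TopologicalSpace X] [MulAction G X] : Set (X → X) :=
  closure (Set.range fun (g : G) (x : X) => g • x)

/-- Baire class 1: preimages of open sets are `F_σ`. -/
def IsBaireClassOne {Y Z : Type*} [TopologicalSpace Y] [TopologicalSpace Z] (f : Y → Z) : Prop :=
  ∀ U : Set Z, IsOpen U → ∃ F : ℕ → Set Y, (∀ n, IsClosed (F n)) ∧ f ⁻¹' U = ⋃ n, F n

/-- A Rosenthal compactum: a space homeomorphic to a compact set of Baire class 1 functions on
some Polish space, with the topology of pointwise convergence. -/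
def IsRosenthalCompactum (K : Type*) [TopologicalSpace K] : Prop :=
  ∃ (Y : Type) (_ : TopologicalSpace Y) (_ : PolishSpace Y) (C : Set (Y → ℝ)),
    (∀ f ∈ C, IsBaireClassOne f) ∧ IsCompact C ∧ Nonempty (K ≃ₜ C)

/-- The action is `tame₁`: its Ellis semigroup is a first countable Rosenthal compactum. -/
def IsTameOne (G X : Type*) [Group G] [TopologicalSpace X] [MulAction G X] : Prop :=
  IsRosenthalCompactum (ellisSemigroup G X) ∧ FirstCountableTopology (ellisSemigroup G X)

open Classical in
/-- The map `p_{a,b}` fixing `b` and sending every other point to `a`. -/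
noncomputable def collapseMap {X : Type*} (a b : X) : X → X := fun x => if x = b then b else a

/-! ### The construction

`T_0` and `T_1` are copies of `[0,1]` with sets `D 0`, `D 1` of marked points. -/

namespace ColouredDendrite

/-- The point `a` of `T_i` lies in an open interval `(n/(n+1), (n+1)/(n+2))` that is red: `n` is
even if `i = 0`, and odd if `i = 1`. -/
def IsRed (i : Fin 2) (a : unitInterval) : Prop :=
  ∃ n : ℕ, (n / (n + 1) : ℝ) < a ∧ (a : ℝ) < (n + 1) / (n + 2) ∧ Even (n + (i : ℕ))

/-- The point `a` of `T_i` lies in an open interval `(n/(n+1), (n+1)/(n+2))` that is green: `n` is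
odd if `i = 0`, and even if `i = 1`. -/
def IsGreen (i : Fin 2) (a : unitInterval) : Prop :=
  ∃ n : ℕ, (n / (n + 1) : ℝ) < a ∧ (a : ℝ) < (n + 1) / (n + 2) ∧ Odd (n + (i : ℕ))

/-- Names for the copies of `T_0` and `T_1` used in the construction: the four copies of `T_0`
forming `X_0`; the two copies of `T_0` attached to a leg at a red point `a`; the copy of `T_1`
attached to a leg at a green point `a`. -/
inductive Leg : Type
  | root (j : Fin 4) : Leg
  | red (ℓ : Leg) (a : unitInterval) (k : Fin 2) : Leg
  | green (ℓ : Leg) (a : unitInterval) : Leg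

namespace Leg

/-- The leg is a copy of `T_0` or of `T_1`. -/
def kind : Leg → Fin 2
  | root _ => 0
  | red _ _ _ => 0
  | green _ _ => 1

/-- The stage of the construction at which the leg is attached. -/
def level : Leg → ℕ
  | root _ => 0
  | red ℓ _ _ => ℓ.level + 1
  | green ℓ _ => ℓ.level + 1

/-- The legs that are really used: those attached at marked points of the right colour. -/
def Valid (D : Fin 2 → Set unitInterval) : Leg → Prop
  | root _ => True
  | red ℓ a _ => ℓ.Valid D ∧ a ∈ D ℓ.kind ∧ IsRed ℓ.kind a
  | green ℓ a => ℓ.Valid D ∧ a ∈ D ℓ.kind ∧ IsGreen ℓ.kind a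

open Classical in
/-- The point at position `t ∈ [0,1]` of the leg `ℓ`, in the product `[0,1] ^ Leg`. A new leg leaves
the point at which it is attached in a new coordinate direction, so that it meets what was built
before in that point only, and legs attached at the same stage are disjoint apart from common
attaching points. In the product topology (a basic neighbourhood restricts finitely many
coordinates), distinct legs form a null family: on any given finite set of coordinates, all but
finitely many legs are constant. -/
noncomputable def point : Leg → unitInterval → (Leg → unitInterval)
  | root j, t => Function.update 0 (root j) t
  | red ℓ a k, t => Function.update (ℓ.point a) (red ℓ a k) t
  | green ℓ a, t => Function.update (ℓ.point a) (green ℓ a) t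

theorem point_eq_zero : ∀ (ℓ m : Leg) (t : unitInterval), ℓ.level < m.level → ℓ.point t m = 0
  | root j, m, t, h => by
      have : m ≠ root j := by rintro rfl; exact lt_irrefl _ h
      simp [point, this]
  | red ℓ a k, m, t, h => by
      have hm : m ≠ red ℓ a k := by rintro rfl; exact lt_irrefl _ h
      have := point_eq_zero ℓ m a (by simp only [level] at h; omega)
      simp [point, hm, this]
  | green ℓ a, m, t, h => by
      have hm : m ≠ green ℓ a := by rintro rfl; exact lt_irrefl _ h
      have := point_eq_zero ℓ m a (by simp only [level] at h; omega)
      simp [point, hm, this]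

end Leg

/-- Put to `0` all the coordinates belonging to legs attached after stage `i`. -/
noncomputable def trunc (i : ℕ) (x : Leg → unitInterval) : Leg → unitInterval :=
  fun m => if m.level ≤ i then x m else 0

/-- Truncation fixes the points of the legs attached by stage `i`. -/
theorem trunc_point_of_le {i : ℕ} {ℓ : Leg} (h : ℓ.level ≤ i) (t : unitInterval) :
    trunc i (ℓ.point t) = ℓ.point t := by
  funext m
  by_cases hm : m.level ≤ i
  · simp [trunc, hm]
  · simp [trunc, hm, ℓ.point_eq_zero m t (by omega)]

/-- Truncation sends later legs to the point of the preceding leg at which they are attached. -/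
theorem trunc_point_red {i : ℕ} {ℓ : Leg} {a : unitInterval} {k : Fin 2}
    (h : i ≤ ℓ.level) (t : unitInterval) :
    trunc i ((Leg.red ℓ a k).point t) = trunc i (ℓ.point a) := by
  funext m
  by_cases hm : m.level ≤ i
  · have : m ≠ Leg.red ℓ a k := by
      rintro rfl
      simp only [Leg.level] at hm
      omega
    simp [trunc, hm, Leg.point, this]
  · simp [trunc, hm]

theorem trunc_point_green {i : ℕ} {ℓ : Leg} {a : unitInterval}
    (h : i ≤ ℓ.level) (t : unitInterval) :
    trunc i ((Leg.green ℓ a).point t) = trunc i (ℓ.point a) := by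
  funext m
  by_cases hm : m.level ≤ i
  · have : m ≠ Leg.green ℓ a := by
      rintro rfl
      simp only [Leg.level] at hm
      omega
    simp [trunc, hm, Leg.point, this]
  · simp [trunc, hm]

/-- The space `X_i`: the union of the legs attached at the stages up to `i`. Its maximal free arcs
are the legs attached at stage `i`. So `X_0` is four copies of `T_0` glued at `0`, and `X_{i+1}` is
obtained from `X_i` by attaching, at each marked point `a` of each maximal free arc, two copies of
`T_0` if `a` is red, one copy of `T_1` if `a` is green, by the points `0`. -/
def stage (D : Fin 2 → Set unitInterval) (i : ℕ) : Set (Leg → unitInterval) :=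
  {x | ∃ ℓ : Leg, ℓ.Valid D ∧ ℓ.level ≤ i ∧ ∃ t : unitInterval, x = ℓ.point t}

theorem trunc_point_mem (D : Fin 2 → Set unitInterval) (i : ℕ) :
    ∀ (ℓ : Leg), ℓ.Valid D → ∀ t : unitInterval, trunc i (ℓ.point t) ∈ stage D i
  | .root j, h, t => ⟨.root j, h, Nat.zero_le _, t, trunc_point_of_le (Nat.zero_le _) t⟩
  | .red ℓ a k, h, t => by
      by_cases hl : (Leg.red ℓ a k).level ≤ i
      · exact ⟨_, h, hl, t, trunc_point_of_le hl t⟩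
      · rw [trunc_point_red (by simp only [Leg.level] at hl; omega)]
        exact trunc_point_mem D i ℓ h.1 a
  | .green ℓ a, h, t => by
      by_cases hl : (Leg.green ℓ a).level ≤ i
      · exact ⟨_, h, hl, t, trunc_point_of_le hl t⟩
      · rw [trunc_point_green (by simp only [Leg.level] at hl; omega)]
        exact trunc_point_mem D i ℓ h.1 a

theorem trunc_mem (D : Fin 2 → Set unitInterval) {i j : ℕ} {x : Leg → unitInterval}
    (hx : x ∈ stage D j) : trunc i x ∈ stage D i := by
  obtain ⟨ℓ, hℓ, -, t, rfl⟩ := hx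
  exact trunc_point_mem D i ℓ hℓ t

/-- The bonding map `X_{i+1} → X_i`: the identity on `X_i`, and sending each leg attached at stage
`i + 1` to the point at which it is attached. -/
noncomputable def bond (D : Fin 2 → Set unitInterval) (i : ℕ) (x : stage D (i + 1)) : stage D i :=
  ⟨trunc i x, trunc_mem D x.2⟩

/-- The dendrite `X`: the inverse limit of the spaces `X_i`. -/
abbrev Limit (D : Fin 2 → Set unitInterval) : Type :=
  {x : (i : ℕ) → stage D i // ∀ i, bond D i (x (i + 1)) = x i}

/-- The point of `X` at position `t` of the leg `ℓ`. -/
noncomputable def legPoint (D : Fin 2 → Set unitInterval) (ℓ : Leg) (hℓ : ℓ.Valid D)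
    (t : unitInterval) : Limit D :=
  ⟨fun i => ⟨trunc i (ℓ.point t), trunc_point_mem D i ℓ hℓ t⟩, fun i => by
    apply Subtype.ext
    funext m
    by_cases hm : m.level ≤ i
    · simp [bond, trunc, hm, Nat.le_succ_of_le hm]
    · simp [bond, trunc, hm]⟩

end ColouredDendrite

/-! Root `X` at the common point `⊥` of the four initial legs. In the product coordinates the
pointwise order makes `X` a compact tree: meets are coordinatewise minima, the points below a given
point form a chain, and `p` lies on the path from `x` to `y` exactly when `x ⊓ y ≤ p` and `p` is
below `x` or `y` (`OnPath`). Arcs, components of complements of points, and hence orders of points,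
become order theory (`IsTreeOrder`).

A leg attached at a red point begins red and one attached at a green point begins green, so colours
change only at the barriers `n / (n + 1)` inside the legs. Let `c p` count the changes between `⊥`
and a ramification point `p`. The number of changes along the path between two ramification points
is an additive distance, and its parity compares their colours. Every value up to the distance of
`p` and `q` is realised strictly between them, and every value whatsoever in every direction at `p`,
since each leg changes colour infinitely often. This richness makes a back-and-forth argument work
(`IsRichTree.exists_equiv`), and automorphisms of the betweenness of ramification points extend to
homeomorphisms of `X` (`exists_homeomorph`). So two pairs of ramification points with matching
colours and equal distances can be carried to each other (`exists_homeomorph_pair`).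

Alternating endpoints are the maximal points below which `c` is unbounded. For distinct ones `a`,
`b`, pick ramification points `p1` near `b` and `p2` near `a` of the same colour, and `p0` between
`p1` and `b` with `d p0 p1 = d p1 p2`, which exists by unboundedness. A homeomorphism taking `(p0,
p1)` to `(p1, p2)` keeps `b` beyond `p1` and throws everything not beyond `p1` to beyond `p2`. Such
homeomorphisms converge to `p_{a,b}` (`exists_homeomorph_collapse`, `collapseMap_mem`).

The rest is formal. Alternating endpoints are dense and uncountable, so the maps `p_{a,b}` give
minimality. The constant map `a` is a limit of the `p_{a,b}` in which each neighbourhood omits only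
finitely many `b`, which no countable base allows. Finally, `X` is not the Ważewski dendrite because
the initial part of a root leg, before the barrier `1 / 2`, has no green point. -/

section

open Set Topology

/-! ### Betweenness relations and back-and-forth -/

/-- `B x p y` says that `p` lies on the path from `x` to `y` in a tree-like structure. -/
structure IsBetweenness {P : Type*} (B : P → P → P → Prop) : Prop where
  symm : ∀ {x p y}, B x p y → B y p x
  left : ∀ x y, B x x y
  eq_of_self : ∀ {x p}, B x p x → p = x
  or_of : ∀ {x p z}, B x p z → ∀ y, B x p y ∨ B y p z
  antisymm : ∀ {x p y}, B x p y → B x y p → p = y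

namespace IsBetweenness

variable {P : Type*} {B : P → P → P → Prop} (h : IsBetweenness B)
include h

theorem right (x y : P) : B x y y := h.symm (h.left y x)

theorem trans {x p q y : P} (h1 : B x p q) (h2 : B x q y) : B x p y := by
  rcases h.or_of h1 y with h3 | h3
  · exact h3
  rcases h.or_of h2 p with h4 | h4
  · rw [h.antisymm h1 h4]; exact h2
  · rw [h.antisymm h3 (h.symm h4)]; exact h2

/-- Two points that both lie behind `p` as seen from `r` have no path through `r`. -/
theorem not_of_leaf {p r s t : P} (hs : B s p r) (ht : B t p r) (hr : r ≠ p) : ¬ B s r t := by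
  intro hb
  rcases h.or_of hb p with h1 | h1
  · exact hr (h.antisymm h1 hs)
  · exact hr (h.antisymm (h.symm h1) ht)

/-- The paths from `r` to `s` and to `t` both pass through `p`, so nothing is lost by looking from
`p` instead. A new leaf thus inherits its relations from its attaching point. -/
theorem leaf_iff {p r s t : P} (hs : B s p r) (ht : B t p r) : B r s t ↔ B p s t := by
  constructor
  · intro hb
    rcases h.or_of hb p with h1 | h1
    · rw [h.antisymm h1 (h.symm hs)]; exact h.left _ _
    · exact h1
  · intro hb
    rcases h.or_of hb r with h1 | h1
    · rw [h.antisymm (h.symm h1) (h.symm hs)]; exact h.symm ht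
    · exact h1

/-! ### Inserting a point `g` into an edge `[p, q]`. -/

section edge

variable {p q g s t : P} (hg : B p g q) (hp : g ≠ p)
include hg hp

/-- `B s p q` means that `s` hangs off the edge at its end `p`. Together with the next lemmas this
expresses the relations of an inner point `g` with such points through `p` and `q` alone. -/
theorem edge_gate (hs : B s p q) : B s p g := by
  rcases h.or_of hs g with h1 | h1
  · exact h1
  · exact absurd (h.antisymm (h.symm hg) (h.symm h1)) hp

omit hp in
theorem edge_sep (hs : B s p q) : B s g q :=
  h.symm (h.trans (h.symm hg) (h.symm hs))

theorem edge_not (hs : B s p q) (ht : B t p q) : ¬ B s g t :=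
  h.not_of_leaf (h.edge_gate hg hp hs) (h.edge_gate hg hp ht) hp

omit hp in
theorem edge_between (hq : g ≠ q) (hs : B s p q) (ht : B t q p) : B s g t := by
  rcases h.or_of (h.edge_sep hg hs) t with h1 | h1
  · exact h1
  · exact absurd (h.antisymm h1 (h.edge_gate (h.symm hg) hq ht)) hq

omit hp in
theorem edge_iff (hs : B s p q) (hsg : s ≠ g) : B g s t ↔ B q s t := by
  have h0 : ¬ B q s g := fun h1 => hsg (h.antisymm h1 (h.symm (h.edge_sep hg hs)))
  constructor
  · intro hb
    rcases h.or_of hb q with h1 | h1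
    · exact absurd (h.symm h1) h0
    · exact h1
  · intro hb
    rcases h.or_of hb g with h1 | h1
    · exact absurd h1 h0
    · exact h1

end edge

end IsBetweenness

/-- A median betweenness relation with an additive distance `d` and a colouring `k`, where `k p` is
also the number of directions at `p`; every direction at `p` and every path is rich in points of
all possible distances. -/
structure IsRichTree {P : Type*} (B : P → P → P → Prop) (d : P → P → ℕ) (k : P → ℕ) : Prop where
  between : IsBetweenness B
  median : ∀ x y z, ∃ m, B x m y ∧ B y m z ∧ B x m z
  dist_comm : ∀ x y, d x y = d y x
  dist_self : ∀ x, d x x = 0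
  dist_add : ∀ {x p y}, B x p y → d x y = d x p + d p y
  colour : ∀ {p g p' g'}, k p = k p' → d p g = d p' g' → k g = k g'
  dense : ∀ {p q}, p ≠ q → ∀ i ≤ d p q, ∃ g, g ≠ p ∧ g ≠ q ∧ B p g q ∧ d p g = i
  full : ∀ {p y}, y ≠ p → ∀ i, ∃ g, ¬ B y p g ∧ d p g = i
  directions : ∀ p, ∃ f : P → Fin (k p), (∀ x y, x ≠ p → y ≠ p → (f x = f y ↔ ¬ B x p y)) ∧
    ∀ i, ∃ x, x ≠ p ∧ f x = i

/-- A finite partial isomorphism whose domain is closed under medians. -/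
structure IsPartialIso {P : Type*} (B : P → P → P → Prop) (d : P → P → ℕ) (k : P → ℕ)
    (F : Finset (P × P)) : Prop where
  colour : ∀ u ∈ F, k u.1 = k u.2
  dist : ∀ u ∈ F, ∀ v ∈ F, d u.1 v.1 = d u.2 v.2
  iff : ∀ u ∈ F, ∀ v ∈ F, ∀ w ∈ F, (B u.1 v.1 w.1 ↔ B u.2 v.2 w.2)
  median : ∀ u ∈ F, ∀ v ∈ F, ∀ w ∈ F, ∃ m ∈ F,
    B u.1 m.1 v.1 ∧ B v.1 m.1 w.1 ∧ B u.1 m.1 w.1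

/-! ### Extending finite partial isomorphisms. -/

section BackAndForth

open Classical

/-- Triples in which the new point is repeated are trivial, so only its relations with two old
points, at an end or in the middle, need checking. -/
theorem IsPartialIso.insert_pair {P : Type*} {B : P → P → P → Prop} {d : P → P → ℕ} {k : P → ℕ}
    (h : IsRichTree B d k) {F : Finset (P × P)} (hF : IsPartialIso B d k F) {r r' : P}
    (hk : k r = k r') (hd : ∀ u ∈ F, d r u.1 = d r' u.2)
    (hne : ∀ u ∈ F, r ≠ u.1 ∧ r' ≠ u.2)
    (hmid : ∀ u ∈ F, ∀ v ∈ F, (B u.1 r v.1 ↔ B u.2 r' v.2))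
    (hend : ∀ u ∈ F, ∀ v ∈ F, (B r u.1 v.1 ↔ B r' u.2 v.2))
    (hmed : ∀ u ∈ F, ∀ v ∈ F, ∃ m ∈ insert (r, r') F,
      B r m.1 u.1 ∧ B u.1 m.1 v.1 ∧ B r m.1 v.1) :
    IsPartialIso B d k (insert (r, r') F) := by
  have hb := h.between
  have hself : ∀ u ∈ F, ¬ B r u.1 r ∧ ¬ B r' u.2 r' := fun u hu =>
    ⟨fun h1 => (hne u hu).1 (hb.eq_of_self h1).symm,
      fun h1 => (hne u hu).2 (hb.eq_of_self h1).symm⟩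
  have hsub : F ⊆ insert (r, r') F := Finset.subset_insert _ _
  have hmem : (r, r') ∈ insert (r, r') F := Finset.mem_insert_self _ _
  refine ⟨?_, ?_, ?_, ?_⟩
  · rw [Finset.forall_mem_insert]
    exact ⟨hk, hF.colour⟩
  · simp only [Finset.forall_mem_insert]
    refine ⟨⟨by simp [h.dist_self], hd⟩, fun u hu => ⟨?_, hF.dist u hu⟩⟩
    rw [h.dist_comm, hd u hu, h.dist_comm]
  · simp only [Finset.forall_mem_insert]
    refine ⟨⟨⟨by simp [hb.left], fun u hu => by simp [hb.left]⟩, fun u hu =>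
      ⟨by simp [hself u hu], hend u hu⟩⟩, fun u hu => ⟨⟨by simp [hb.right], hmid u hu⟩,
      fun v hv => ⟨?_, hF.iff u hu v hv⟩⟩⟩
    have := hend v hv u hu
    exact ⟨fun h1 => hb.symm (this.1 (hb.symm h1)), fun h1 => hb.symm (this.2 (hb.symm h1))⟩
  · intro u hu v hv w hw
    rw [Finset.mem_insert] at hu hv hw
    rcases hu with rfl | hu
    · rcases hv with rfl | hv
      · exact ⟨_, hmem, hb.left _ _, hb.left _ _, hb.left _ _⟩
      rcases hw with rfl | hw
      · exact ⟨_, hmem, hb.left _ _, hb.right _ _, hb.left _ _⟩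
      exact hmed v hv w hw
    rcases hv with rfl | hv
    · rcases hw with rfl | hw
      · exact ⟨_, hmem, hb.right _ _, hb.left _ _, hb.right _ _⟩
      obtain ⟨m, hm, h1, h2, h3⟩ := hmed u hu w hw
      exact ⟨m, hm, hb.symm h1, h3, h2⟩
    rcases hw with rfl | hw
    · obtain ⟨m, hm, h1, h2, h3⟩ := hmed u hu v hv
      exact ⟨m, hm, h2, hb.symm h3, hb.symm h1⟩
    obtain ⟨m, hm, h1⟩ := hF.median u hu v hv w hw
    exact ⟨m, hsub hm, h1⟩

variable {P : Type*} {B : P → P → P → Prop} {d : P → P → ℕ} {k : P → ℕ}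
  (h : IsRichTree B d k)
include h

/-- If no point of the domain lies in the direction of `r` at `p`, then there is a direction at the
image of `p` that contains no point of the image. -/
theorem IsRichTree.exists_free_direction {F : Finset (P × P)} (hF : IsPartialIso B d k F)
    {p : P × P} (hp : p ∈ F) {r : P} (hr : r ≠ p.1) (hleaf : ∀ u ∈ F, B u.1 p.1 r) :
    ∃ y, y ≠ p.2 ∧ ∀ u ∈ F, B u.2 p.2 y := by
  have hb := h.between
  obtain ⟨f, hf, -⟩ := h.directions p.1
  obtain ⟨f', hf', hs'⟩ := h.directions p.2
  have hne : ∀ u ∈ F, u.2 ≠ p.2 → u.1 ≠ p.1 := fun u hu h1 h2 => h1 (hb.eq_of_self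
    ((hF.iff p hp u hu p hp).1 (by rw [h2]; exact hb.left _ _)))
  have hfree : ∃ i, ∀ u ∈ F, u.2 ≠ p.2 → f' u.2 ≠ i := by
    by_contra! hcon
    choose u hu hup hui using hcon
    -- Pigeonhole: if every direction at `p.2` were occupied, the corresponding domain points would
    -- occupy equally many directions at `p.1`, hence all of them, including that of `r`.
    have hinj : Function.Injective fun i => f (u i).1 := by
      intro i j hij
      have h1 := (hf _ _ (hne _ (hu i) (hup i)) (hne _ (hu j) (hup j))).1 hij
      rw [hF.iff _ (hu i) p hp _ (hu j), ← hf' _ _ (hup i) (hup j), hui, hui] at h1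
      exact h1
    have hbij := (Fintype.bijective_iff_injective_and_card _).2
      ⟨hinj, by simp [hF.colour p hp]⟩
    obtain ⟨i, hi⟩ := hbij.2 (f r)
    exact (hf _ _ (hne _ (hu i) (hup i)) hr).1 hi (hleaf _ (hu i))
  obtain ⟨i, hi⟩ := hfree
  obtain ⟨y, hy, rfl⟩ := hs' i
  refine ⟨y, hy, fun u hu => ?_⟩
  by_cases h1 : u.2 = p.2
  · rw [h1]; exact hb.left _ _
  · by_contra h2
    exact hi u hu h1 ((hf' _ _ h1 hy).2 h2)

/-- The image of `r` is put into a free direction at `p.2`, where `full` supplies a point at the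
right distance. Its colour is then right as well, and all other relations pass through `p`. -/
theorem IsRichTree.extend_leaf {F : Finset (P × P)} (hF : IsPartialIso B d k F)
    {p : P × P} (hp : p ∈ F) {r : P} (hr : r ≠ p.1) (hleaf : ∀ u ∈ F, B u.1 p.1 r) :
    ∃ r', IsPartialIso B d k (insert (r, r') F) := by
  have hb := h.between
  obtain ⟨y, hy, hyF⟩ := h.exists_free_direction hF hp hr hleaf
  obtain ⟨r', hr', hdr⟩ := h.full hy (d p.1 r)
  have hr'p : r' ≠ p.2 := by
    rintro rfl
    exact hr' (hb.right _ _)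
  have hleaf' : ∀ u ∈ F, B u.2 p.2 r' := by
    intro u hu
    rcases hb.or_of (hyF u hu) r' with h1 | h1
    · exact h1
    · exact absurd (hb.symm h1) hr'
  refine ⟨r', ?_⟩
  have hne : ∀ u ∈ F, r ≠ u.1 ∧ r' ≠ u.2 := by
    intro u hu
    constructor
    · rintro rfl
      exact hr (hb.eq_of_self (hleaf u hu)).symm
    · rintro rfl
      exact hr'p (hb.eq_of_self (hleaf' u hu)).symm
  refine hF.insert_pair h (h.colour (hF.colour p hp) hdr.symm) ?_ hne ?_ ?_ ?_
  · intro u hu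
    rw [h.dist_add (hb.symm (hleaf u hu)), h.dist_add (hb.symm (hleaf' u hu)),
      hF.dist p hp u hu, h.dist_comm r, h.dist_comm r', hdr]
  · intro u hu v hv
    exact iff_of_false (hb.not_of_leaf (hleaf u hu) (hleaf v hv) hr)
      (hb.not_of_leaf (hleaf' u hu) (hleaf' v hv) hr'p)
  · intro u hu v hv
    rw [hb.leaf_iff (hleaf u hu) (hleaf v hv), hb.leaf_iff (hleaf' u hu) (hleaf' v hv),
      hF.iff p hp u hu v hv]
  · intro u hu v hv
    obtain ⟨m, hm, h1, h2, h3⟩ := hF.median p hp u hu v hv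
    exact ⟨m, Finset.mem_insert_of_mem hm, (hb.leaf_iff (hleaf m hm) (hleaf u hu)).2 h1, h2,
      (hb.leaf_iff (hleaf m hm) (hleaf v hv)).2 h3⟩

/-- By `hside` nothing in the domain branches off strictly between `p` and `q`. `dense` gives an
image at the right distance from `p.2`, and additivity makes the distance from `q.2` right too. -/
theorem IsRichTree.extend_edge {F : Finset (P × P)} (hF : IsPartialIso B d k F)
    {p q : P × P} (hp : p ∈ F) (hq : q ∈ F) (hside : ∀ u ∈ F, B u.1 p.1 q.1 ∨ B u.1 q.1 p.1)
    {g : P} (hg : B p.1 g q.1) (hgp : g ≠ p.1) (hgq : g ≠ q.1) :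
    ∃ g', IsPartialIso B d k (insert (g, g') F) := by
  have hb := h.between
  have hpq : p.1 ≠ q.1 := by
    intro h1
    rw [← h1] at hg
    exact hgp (hb.eq_of_self hg)
  have hpq' : p.2 ≠ q.2 := by
    intro h1
    have h2 := (hF.iff p hp q hq p hp).2 (by rw [h1]; exact hb.left _ _)
    exact hpq (hb.eq_of_self h2).symm
  have hdg := h.dist_add hg
  obtain ⟨g', hgp', hgq', hg', hd'⟩ := h.dense hpq' (d p.1 g) (by
    rw [← hF.dist p hp q hq, hdg]; exact Nat.le_add_right _ _)
  have hdq : d g q.1 = d g' q.2 := by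
    have := h.dist_add hg'
    rw [← hF.dist p hp q hq] at this
    omega
  have hnot : ∀ u ∈ F, B u.1 p.1 q.1 → B u.1 q.1 p.1 → False := by
    intro u hu h1 h2
    exact hpq (hb.antisymm h1 h2)
  have hiff : ∀ u ∈ F, (B u.1 p.1 q.1 ↔ B u.2 p.2 q.2) := fun u hu => hF.iff u hu p hp q hq
  have hiff' : ∀ u ∈ F, (B u.1 q.1 p.1 ↔ B u.2 q.2 p.2) := fun u hu => hF.iff u hu q hq p hp
  have hne : ∀ u ∈ F, g ≠ u.1 ∧ g' ≠ u.2 := by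
    intro u hu
    rcases hside u hu with h1 | h1
    · constructor
      · rintro rfl
        exact hgp (hb.eq_of_self (hb.edge_gate hg hgp h1)).symm
      · rintro rfl
        exact hgp' (hb.eq_of_self (hb.edge_gate hg' hgp' ((hiff u hu).1 h1))).symm
    · constructor
      · rintro rfl
        exact hgq (hb.eq_of_self (hb.edge_gate (hb.symm hg) hgq h1)).symm
      · rintro rfl
        exact hgq' (hb.eq_of_self (hb.edge_gate (hb.symm hg') hgq' ((hiff' u hu).1 h1))).symm
  refine ⟨g', ?_⟩
  refine hF.insert_pair h (h.colour (hF.colour p hp) hd'.symm) ?_ hne ?_ ?_ ?_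
  · intro u hu
    rcases hside u hu with h1 | h1
    · rw [h.dist_add (hb.symm (hb.edge_gate hg hgp h1)),
        h.dist_add (hb.symm (hb.edge_gate hg' hgp' ((hiff u hu).1 h1))),
        hF.dist p hp u hu, h.dist_comm g, h.dist_comm g', hd']
    · rw [h.dist_add (hb.symm (hb.edge_gate (hb.symm hg) hgq h1)),
        h.dist_add (hb.symm (hb.edge_gate (hb.symm hg') hgq' ((hiff' u hu).1 h1))),
        hF.dist q hq u hu, hdq]
  · intro u hu v hv
    rcases hside u hu with h1 | h1 <;> rcases hside v hv with h2 | h2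
    · exact iff_of_false (hb.edge_not hg hgp h1 h2)
        (hb.edge_not hg' hgp' ((hiff u hu).1 h1) ((hiff v hv).1 h2))
    · exact iff_of_true (hb.edge_between hg hgq h1 h2)
        (hb.edge_between hg' hgq' ((hiff u hu).1 h1) ((hiff' v hv).1 h2))
    · exact iff_of_true (hb.edge_between (hb.symm hg) hgp h1 h2)
        (hb.edge_between (hb.symm hg') hgp' ((hiff' u hu).1 h1) ((hiff v hv).1 h2))
    · exact iff_of_false (hb.edge_not (hb.symm hg) hgq h1 h2)
        (hb.edge_not (hb.symm hg') hgq' ((hiff' u hu).1 h1) ((hiff' v hv).1 h2))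
  · intro u hu v hv
    rcases hside u hu with h1 | h1
    · rw [hb.edge_iff hg h1 (hne u hu).1.symm,
        hb.edge_iff hg' ((hiff u hu).1 h1) (hne u hu).2.symm, hF.iff q hq u hu v hv]
    · rw [hb.edge_iff (hb.symm hg) h1 (hne u hu).1.symm,
        hb.edge_iff (hb.symm hg') ((hiff' u hu).1 h1) (hne u hu).2.symm,
        hF.iff p hp u hu v hv]
  -- If `u` and `v` hang off the same end, the old median with that end serves; if they hang off
  -- opposite ends, `g` itself lies between them. Stated for both orientations of the edge.
  · have key : ∀ (p q : P × P), p ∈ F → q ∈ F → B p.1 g q.1 → g ≠ p.1 → g ≠ q.1 →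
        ∀ u ∈ F, ∀ v ∈ F, B u.1 p.1 q.1 →
        (B v.1 p.1 q.1 ∨ B v.1 q.1 p.1) → ∃ m ∈ insert (g, g') F,
          B g m.1 u.1 ∧ B u.1 m.1 v.1 ∧ B g m.1 v.1 := by
      intro p q hp hq hg hgp hgq u hu v hv h1 h2
      rcases h2 with h2 | h2
      · obtain ⟨m, hm, h3, h4, h5⟩ := hF.median p hp u hu v hv
        refine ⟨m, Finset.mem_insert_of_mem hm, hb.symm ?_, h4, hb.symm ?_⟩
        · exact hb.trans (hb.symm h3) (hb.edge_gate hg hgp h1)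
        · exact hb.trans (hb.symm h5) (hb.edge_gate hg hgp h2)
      · exact ⟨_, Finset.mem_insert_self _ _, hb.left _ _, hb.edge_between hg hgq h1 h2,
          hb.left _ _⟩
    intro u hu v hv
    rcases hside u hu with h1 | h1
    · exact key p q hp hq hg hgp hgq u hu v hv h1 (hside v hv)
    · exact key q p hq hp (hb.symm hg) hgq hgp u hu v hv h1 (hside v hv).symm

/-- Locate `r` relative to the finite tree `F`. Either it hangs off a vertex, or its path meets the
tree inside an edge `[p, q]`; then the meeting point `g` is added first and `r` is hung off `g`. -/
theorem IsRichTree.extend {F : Finset (P × P)} (hF : IsPartialIso B d k F) (hne : F.Nonempty)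
    (r : P) : ∃ F', IsPartialIso B d k F' ∧ F ⊆ F' ∧ ∃ r', (r, r') ∈ F' := by
  have hb := h.between
  by_cases hrF : ∃ u ∈ F, u.1 = r
  · obtain ⟨u, hu, rfl⟩ := hrF
    exact ⟨F, hF, subset_rfl, u.2, hu⟩
  push Not at hrF
  have hleafcase : ∀ {G : Finset (P × P)}, IsPartialIso B d k G → F ⊆ G → ∀ p ∈ G, r ≠ p.1 →
      (∀ u ∈ G, B u.1 p.1 r) → ∃ F', IsPartialIso B d k F' ∧ F ⊆ F' ∧ ∃ r', (r, r') ∈ F' := by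
    intro G hG hFG p hp hr hl
    obtain ⟨r', hr'⟩ := h.extend_leaf hG hp hr hl
    exact ⟨_, hr', hFG.trans (Finset.subset_insert _ _), r', Finset.mem_insert_self _ _⟩
  obtain ⟨p, hp, hpmin⟩ := F.exists_min_image
    (fun p => (F.filter fun u => ¬ B u.1 p.1 r).card) hne
  by_cases hl : ∀ u ∈ F, B u.1 p.1 r
  · exact hleafcase hF subset_rfl p hp (hrF p hp).symm hl
  push Not at hl
  -- `p` has the fewest domain points on the side of `r`. If `q`, on that side, lay between `p` and
  -- `r`, it would have strictly fewer, `q` itself being lost.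
  have hback : ∀ q ∈ F, ¬ B q.1 p.1 r → ¬ B p.1 q.1 r := by
    intro q hq hqp hpq
    have hsub : F.filter (fun u => ¬ B u.1 q.1 r) ⊆ F.filter (fun u => ¬ B u.1 p.1 r) := by
      intro u hu
      rw [Finset.mem_filter] at hu ⊢
      refine ⟨hu.1, fun h1 => ?_⟩
      have h2 : B p.1 q.1 u.1 := (hb.or_of hpq u.1).resolve_right hu.2
      have h3 : B u.1 p.1 q.1 := (hb.or_of h1 q.1).resolve_right hqp
      have h4 := hb.antisymm h3 (hb.symm h2)
      exact hqp (by rw [h4]; exact hb.left _ _)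
    have hlt := Finset.card_lt_card (Finset.ssubset_iff_of_subset hsub |>.2
      ⟨q, Finset.mem_filter.2 ⟨hq, hqp⟩, fun h1 => (Finset.mem_filter.1 h1).2 (hb.left _ _)⟩)
    exact absurd (hpmin q hq) (not_le.2 hlt)
  obtain ⟨q0, hq0, hq0p⟩ := hl
  -- Among the vertices on the side of `r`, the one with the fewest vertices on its path from `p` is
  -- the neighbour of `p`. Closure under medians forces all others on that side to lie behind it.
  obtain ⟨q, hq, hqmin⟩ := (F.filter fun u => ¬ B u.1 p.1 r).exists_min_image
    (fun q => (F.filter fun v => B p.1 v.1 q.1).card) ⟨q0, Finset.mem_filter.2 ⟨hq0, hq0p⟩⟩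
  obtain ⟨hq, hqp⟩ := Finset.mem_filter.1 hq
  have hnear : ∀ u ∈ F, ¬ B u.1 p.1 r → B p.1 q.1 u.1 := by
    intro u hu hup
    obtain ⟨m, hm, h1, h2, h3⟩ := hF.median p hp q hq u hu
    have h5 : ¬ B q.1 p.1 u.1 := fun h6 => (hb.or_of h6 r).elim hqp (fun h7 => hup (hb.symm h7))
    have hmr : ¬ B m.1 p.1 r := by
      intro h6
      rcases hb.or_of h6 q.1 with h7 | h7
      · rw [hb.antisymm (hb.symm h7) (hb.symm h1)] at h5
        exact h5 h2
      · exact hqp h7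
    have hmq : m.1 = q.1 := by
      by_contra hmq
      have hsub : F.filter (fun v => B p.1 v.1 m.1) ⊆ F.filter (fun v => B p.1 v.1 q.1) := by
        intro v hv
        rw [Finset.mem_filter] at hv ⊢
        exact ⟨hv.1, hb.trans hv.2 h1⟩
      have hlt := Finset.card_lt_card (Finset.ssubset_iff_of_subset hsub |>.2
        ⟨q, Finset.mem_filter.2 ⟨hq, hb.right _ _⟩, fun h8 =>
          hmq (hb.antisymm h1 (Finset.mem_filter.1 h8).2)⟩)
      exact absurd (hqmin m (Finset.mem_filter.2 ⟨hm, hmr⟩)) (not_le.2 hlt)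
    rw [← hmq]
    exact h3
  have hside : ∀ u ∈ F, B u.1 p.1 q.1 ∨ B u.1 q.1 p.1 := by
    intro u hu
    by_cases hup : B u.1 p.1 r
    · exact Or.inl ((hb.or_of hup q.1).resolve_right hqp)
    · exact Or.inr (hb.symm (hnear u hu hup))
  -- The point where the path to `r` leaves `[p, q]`. It differs from `p` since `q` is on the side
  -- of `r`, and from `q` by `hback`.
  obtain ⟨g, hg1, hg2, hg3⟩ := h.median p.1 q.1 r
  have hgp : g ≠ p.1 := by
    rintro rfl
    exact hqp hg2
  have hgq : g ≠ q.1 := by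
    rintro rfl
    exact hback q hq hqp hg3
  obtain ⟨g', hG⟩ := h.extend_edge hF hp hq hside hg1 hgp hgq
  have hFG : F ⊆ insert (g, g') F := Finset.subset_insert _ _
  by_cases hrg : r = g
  · subst hrg
    exact ⟨_, hG, hFG, g', Finset.mem_insert_self _ _⟩
  refine hleafcase hG hFG (g, g') (Finset.mem_insert_self _ _) hrg ?_
  rw [Finset.forall_mem_insert]
  refine ⟨hb.left _ _, fun u hu => ?_⟩
  have key : ∀ {p : P}, B p g r → g ≠ p → B u.1 p g → B u.1 g r := by
    intro p h1 h2 h3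
    rcases hb.or_of h1 u.1 with h4 | h4
    · exact absurd (hb.antisymm (hb.symm h4) h3) h2
    · exact h4
  rcases hside u hu with h1 | h1
  · exact key hg3 hgp (hb.edge_gate hg1 hgp h1)
  · exact key hg2 hgq (hb.edge_gate (hb.symm hg1) hgq h1)

omit h in
theorem IsPartialIso.swap {F : Finset (P × P)} (hF : IsPartialIso B d k F) :
    IsPartialIso B d k (F.image Prod.swap) := by
  refine ⟨?_, ?_, ?_, ?_⟩ <;> simp only [Finset.forall_mem_image, Finset.exists_mem_image]
  · exact fun u hu => (hF.colour u hu).symm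
  · exact fun u hu v hv => (hF.dist u hu v hv).symm
  · exact fun u hu v hv w hw => (hF.iff u hu v hv w hw).symm
  · intro u hu v hv w hw
    obtain ⟨m, hm, h1, h2, h3⟩ := hF.median u hu v hv w hw
    exact ⟨m, hm, (hF.iff u hu m hm v hv).1 h1, (hF.iff v hv m hm w hw).1 h2,
      (hF.iff u hu m hm w hw).1 h3⟩

theorem IsRichTree.extend_symm {F : Finset (P × P)} (hF : IsPartialIso B d k F) (hne : F.Nonempty)
    (r : P) : ∃ F', IsPartialIso B d k F' ∧ F ⊆ F' ∧ ∃ r', (r', r) ∈ F' := by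
  obtain ⟨F', h1, h2, r', h3⟩ := h.extend hF.swap (hne.image _) r
  refine ⟨_, h1.swap, ?_, r', Finset.mem_image_of_mem Prod.swap h3⟩
  intro u hu
  exact Finset.mem_image.2 ⟨u.swap, h2 (Finset.mem_image_of_mem _ hu), by simp⟩

/-- Every nonempty finite partial isomorphism extends to an automorphism. -/
theorem IsRichTree.exists_equiv [Countable P] {F : Finset (P × P)} (hF : IsPartialIso B d k F)
    (hne : F.Nonempty) : ∃ σ : P ≃ P, (∀ u ∈ F, σ u.1 = u.2) ∧
      ∀ x p y, B x p y ↔ B (σ x) (σ p) (σ y) := by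
  have hb := h.between
  cases nonempty_encodable P
  let Q := {G : Finset (P × P) // IsPartialIso B d k G ∧ F ⊆ G}
  -- One cofinal family asks for `r` in the domain, the other for `r` in the range. An ideal meeting
  -- these countably many families is a directed system whose union is the automorphism.
  let C : P ⊕ P → Order.Cofinal Q := fun s => Sum.recOn s
    (fun r => ⟨{G | ∃ r', (r, r') ∈ G.1}, fun G => by
      obtain ⟨F', h1, h2, h3⟩ := h.extend G.2.1 (hne.mono G.2.2) r
      exact ⟨⟨F', h1, G.2.2.trans h2⟩, h3, h2⟩⟩)
    (fun r => ⟨{G | ∃ r', (r', r) ∈ G.1}, fun G => by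
      obtain ⟨F', h1, h2, h3⟩ := h.extend_symm G.2.1 (hne.mono G.2.2) r
      exact ⟨⟨F', h1, G.2.2.trans h2⟩, h3, h2⟩⟩)
  let I : Order.Ideal Q := Order.idealOfCofinals ⟨F, hF, subset_rfl⟩ C
  have hI : ∀ s, ∃ x, x ∈ C s ∧ x ∈ I := Order.cofinal_meets_idealOfCofinals _ C
  have hmem : ∀ r, ∃ r', ∃ G ∈ I, (r, r') ∈ G.1 := by
    intro r
    obtain ⟨G, ⟨r', h1⟩, h2⟩ := hI (Sum.inl r)
    exact ⟨r', G, h2, h1⟩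
  have hmem' : ∀ r, ∃ r', ∃ G ∈ I, (r', r) ∈ G.1 := by
    intro r
    obtain ⟨G, ⟨r', h1⟩, h2⟩ := hI (Sum.inr r)
    exact ⟨r', G, h2, h1⟩
  have hrel : ∀ {x y z x' y' z' : P}, (∃ G ∈ I, (x, x') ∈ G.1) → (∃ G ∈ I, (y, y') ∈ G.1) →
      (∃ G ∈ I, (z, z') ∈ G.1) → (B x y z ↔ B x' y' z') := by
    rintro x y z x' y' z' ⟨G1, hG1, h1⟩ ⟨G2, hG2, h2⟩ ⟨G3, hG3, h3⟩
    obtain ⟨G4, hG4, h41, h42⟩ := I.directed _ hG1 _ hG2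
    obtain ⟨G5, hG5, h51, h52⟩ := I.directed _ hG4 _ hG3
    exact G5.2.1.iff _ (h51 (h41 h1)) _ (h51 (h42 h2)) _ (h52 h3)
  -- `B x y x` expresses equality, so preserving `B` already makes the union a well-defined
  -- injective map.
  have hfun : ∀ {x y x' y' : P}, (∃ G ∈ I, (x, x') ∈ G.1) → (∃ G ∈ I, (y, y') ∈ G.1) →
      (x = y ↔ x' = y') := by
    intro x y x' y' h1 h2
    have h3 := hrel h1 h2 h1
    constructor
    · rintro rfl
      exact (hb.eq_of_self (h3.1 (hb.left _ _))).symm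
    · rintro rfl
      exact (hb.eq_of_self (h3.2 (hb.left _ _))).symm
  choose f hf using hmem
  choose g hg using hmem'
  refine ⟨⟨f, g, fun x => (hfun (hg (f x)) (hf x)).2 rfl, fun x => (hfun (hf (g x)) (hg x)).1 rfl⟩,
    fun u hu => ?_, fun x p y => hrel (hf x) (hf p) (hf y)⟩
  exact (hfun (hf u.1) ⟨⟨F, hF, subset_rfl⟩, Order.mem_idealOfCofinals _ C, hu⟩).1 rfl

end BackAndForth

/-! ### Compact topological trees given by a semilattice order -/

/-- A topological meet-semilattice whose principal ideals are densely ordered chains, with a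
continuous strictly monotone height. -/
structure IsTreeOrder (X : Type*) [TopologicalSpace X] [SemilatticeInf X] [OrderBot X] :
    Prop where
  continuous_inf : Continuous fun z : X × X => z.1 ⊓ z.2
  total : ∀ {x y z : X}, y ≤ x → z ≤ x → y ≤ z ∨ z ≤ y
  dense : ∀ {x y : X}, x < y → ∃ z, x < z ∧ z < y
  height : ∃ ρ : X → ℝ, Continuous ρ ∧ StrictMono ρ

/-- `p` lies on the path from `x` to `y`. -/
def OnPath {X : Type*} [SemilatticeInf X] (x p y : X) : Prop := x ⊓ y ≤ p ∧ (p ≤ x ∨ p ≤ y)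

/-- `n` is the number of directions at `p`. -/
def HasDirections {X : Type*} [SemilatticeInf X] (p : X) (n : ℕ) : Prop :=
  ∃ f : X → Fin n, (∀ x y, x ≠ p → y ≠ p → (f x = f y ↔ ¬ OnPath x p y)) ∧ ∀ i, ∃ x, x ≠ p ∧ f x = i

namespace IsTreeOrder

variable {X : Type*} [TopologicalSpace X] [SemilatticeInf X] [OrderBot X] (h : IsTreeOrder X)
include h

theorem isBetweenness : IsBetweenness (OnPath (X := X)) where
  symm := fun {x p y} hp => ⟨by rw [inf_comm]; exact hp.1, hp.2.symm⟩
  left x y := ⟨inf_le_left, Or.inl le_rfl⟩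
  eq_of_self := fun {x p} hp => le_antisymm (hp.2.elim id id) (by simpa using hp.1)
  or_of := by
    -- In the chain below `x`, either `x ⊓ y ≤ p`, and `p` is on the way to `y`, or `p ≤ x ⊓ y`, and
    -- `p` is below `y` too.
    have key : ∀ {x p z : X}, x ⊓ z ≤ p → p ≤ x → ∀ y, OnPath x p y ∨ OnPath y p z := by
      intro x p z h1 h2 y
      rcases h.total h2 (inf_le_left : x ⊓ y ≤ x) with h3 | h3
      · by_cases h5 : y ⊓ z ≤ p
        · exact Or.inr ⟨h5, Or.inl (h3.trans inf_le_right)⟩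
        rcases h.total (inf_le_right : x ⊓ y ≤ y) (inf_le_left : y ⊓ z ≤ y) with h4 | h4
        · exact Or.inl ⟨(le_inf inf_le_left (h4.trans inf_le_right)).trans h1, Or.inl h2⟩
        · exact absurd ((le_inf (h4.trans inf_le_left) inf_le_right).trans h1) h5
      · exact Or.inl ⟨h3, Or.inl h2⟩
    intro x p z hp y
    rcases hp.2 with h2 | h2
    · exact key hp.1 h2 y
    · rcases key (by rw [inf_comm]; exact hp.1) h2 y with h3 | h3
      · exact Or.inr ⟨by rw [inf_comm]; exact h3.1, h3.2.symm⟩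
      · exact Or.inl ⟨by rw [inf_comm]; exact h3.1, h3.2.symm⟩
  antisymm := by
    intro x p y hp hy
    have key : p ≤ y → p = y := by
      intro hpy
      rcases hy.2 with h1 | h1
      · exact le_antisymm hpy (by simpa [h1] using hp.1)
      · exact le_antisymm hpy h1
    rcases hp.2 with h1 | h1
    · exact key (by simpa [h1] using hy.1)
    · exact key h1

theorem inf_total (x y z : X) : x ⊓ y ≤ x ⊓ z ∨ x ⊓ z ≤ x ⊓ y :=
  h.total inf_le_left inf_le_left

/-- Of the three pairwise meets two coincide, and the remaining, largest one is the median. The last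
clause is what puts medians of ramification points among the ramification points. -/
theorem exists_median (x y z : X) :
    ∃ m, OnPath x m y ∧ OnPath y m z ∧ OnPath x m z ∧ (m = x ⊓ y ∨ m = y ⊓ z ∨ m = x ⊓ z) := by
  rcases h.inf_total x y z with h1 | h1
  · have h2 : x ⊓ y ≤ y ⊓ z := le_inf inf_le_right (h1.trans inf_le_right)
    rcases h.inf_total z x y with h3 | h3
    · have h4 : x ⊓ z ≤ y ⊓ z := by simpa [inf_comm] using h3
      exact ⟨y ⊓ z, ⟨h2, Or.inr inf_le_left⟩, ⟨le_rfl, Or.inl inf_le_left⟩,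
        ⟨h4, Or.inr inf_le_right⟩, by simp⟩
    · have h4 : y ⊓ z ≤ x ⊓ z := by simpa [inf_comm] using h3
      exact ⟨x ⊓ z, ⟨h1, Or.inl inf_le_left⟩, ⟨h4, Or.inr inf_le_right⟩,
        ⟨le_rfl, Or.inl inf_le_left⟩, by simp⟩
  · have h2 : x ⊓ z ≤ y ⊓ z := le_inf (h1.trans inf_le_right) inf_le_right
    rcases h.inf_total y x z with h3 | h3
    · have h4 : x ⊓ y ≤ y ⊓ z := by simpa [inf_comm] using h3
      exact ⟨y ⊓ z, ⟨h4, Or.inr inf_le_left⟩, ⟨le_rfl, Or.inl inf_le_left⟩,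
        ⟨h2, Or.inr inf_le_right⟩, by simp⟩
    · have h4 : y ⊓ z ≤ x ⊓ y := by simpa [inf_comm] using h3
      exact ⟨x ⊓ y, ⟨le_rfl, Or.inl inf_le_left⟩, ⟨h4, Or.inl inf_le_right⟩,
        ⟨h1, Or.inl inf_le_left⟩, by simp⟩

omit [TopologicalSpace X] [OrderBot X] h in
theorem btw_of_le {x p y : X} (h1 : x ≤ p) (h2 : p ≤ y) : OnPath x p y :=
  ⟨inf_le_left.trans h1, Or.inr h2⟩

omit [TopologicalSpace X] [OrderBot X] h in
-- Every nondegenerate path contains an order interval, to which density of the order or of `R`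
-- applies.
theorem exists_ne_btw {x y : X} (hxy : x ≠ y) : ∃ a b, a < b ∧ x ⊓ y ≤ a ∧ (b ≤ x ∨ b ≤ y) := by
  by_cases h1 : x ≤ y
  · exact ⟨x, y, lt_of_le_of_ne h1 hxy, inf_le_left, Or.inr le_rfl⟩
  · exact ⟨x ⊓ y, x, lt_of_le_of_ne inf_le_left fun h2 => h1 (h2 ▸ inf_le_right), le_rfl,
      Or.inl le_rfl⟩

omit [TopologicalSpace X] [OrderBot X] h in
/-- A point strictly between `a` and `b` separates `x` and `y`, if `[a, b]` is part of the path. -/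
theorem btw_of_lt {x y a b r : X} (hxa : x ⊓ y ≤ a) (hb : b ≤ x ∨ b ≤ y) (har : a < r)
    (hrb : r < b) : OnPath x r y ∧ r ≠ x ∧ r ≠ y := by
  refine ⟨⟨hxa.trans har.le, hb.imp hrb.le.trans hrb.le.trans⟩, ?_, ?_⟩
  · rintro rfl
    rcases hb with h1 | h1
    · exact (hrb.trans_le h1).false
    · exact (har.trans_le (le_inf le_rfl (hrb.le.trans h1))).not_ge hxa
  · rintro rfl
    rcases hb with h1 | h1
    · exact (har.trans_le (le_inf (hrb.le.trans h1) le_rfl)).not_ge hxa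
    · exact (hrb.trans_le h1).false

/-! ### Topology of tree orders: cut points, arcs, components. -/

section closed

variable [T2Space X]

omit [T2Space X] in
theorem continuous_inf_left (x : X) : Continuous fun z : X => x ⊓ z :=
  h.continuous_inf.comp (continuous_const.prodMk continuous_id)

theorem isClosed_inf_le (x p : X) : IsClosed {z : X | x ⊓ z ≤ p} := by
  have : {z : X | x ⊓ z ≤ p} = {z | p ⊓ (x ⊓ z) = x ⊓ z} := by
    ext z; simp [inf_eq_right]
  rw [this]
  exact isClosed_eq ((h.continuous_inf_left p).comp (h.continuous_inf_left x))
    (h.continuous_inf_left x)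

theorem isClosed_Ici (p : X) : IsClosed (Ici p) := by
  have : Ici p = {z | p ⊓ z = p} := by ext z; simp [inf_eq_left]
  rw [this]
  exact isClosed_eq (h.continuous_inf_left p) continuous_const

theorem isClosed_Iic (p : X) : IsClosed (Iic p) := by
  have : Iic p = {z | p ⊓ z = z} := by ext z; simp [inf_eq_right]
  rw [this]
  exact isClosed_eq (h.continuous_inf_left p) continuous_id

theorem isClosed_btw_right (x p : X) : IsClosed {z : X | OnPath x p z} := by
  refine (h.isClosed_inf_le x p).inter ?_
  by_cases hp : p ≤ x
  · simp only [hp, true_or]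
    exact isClosed_const
  · simp only [hp, false_or]
    exact h.isClosed_Ici p

theorem isClosed_btw_mid (x y : X) : IsClosed {z : X | OnPath x z y} :=
  (h.isClosed_Ici (x ⊓ y)).inter ((h.isClosed_Iic x).union (h.isClosed_Iic y))

theorem isOpen_direction (x p : X) : IsOpen {z : X | ¬ OnPath x p z} :=
  (h.isClosed_btw_right x p).isOpen_compl

/-- Near `z` everything lies in the direction of `z` at `p`. With `isOpen_direction` this splits the
complement of `p` into two open sets. -/
theorem isOpen_other_directions (x p : X) : IsOpen {z : X | z ≠ p ∧ OnPath x p z} := by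
  have hb := h.isBetweenness
  rw [isOpen_iff_mem_nhds]
  rintro z ⟨hz, hxz⟩
  filter_upwards [(h.isOpen_direction z p).mem_nhds fun h1 => hz (hb.eq_of_self h1).symm] with v hv
  refine ⟨?_, (hb.or_of hxz v).resolve_right fun h1 => hv (hb.symm h1)⟩
  rintro rfl
  exact hv (hb.right _ _)

theorem not_btw_of_isPreconnected {S : Set X} (hS : IsPreconnected S) {x y w : X} (hx : x ∈ S)
    (hy : y ∈ S) (hw : w ∉ S) : ¬ OnPath x w y := by
  have hb := h.isBetweenness
  intro hxy
  obtain ⟨z, -, h1, h2⟩ := hS _ _ (h.isOpen_direction x w) (h.isOpen_other_directions x w)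
    (fun z hz => by
      by_cases h1 : OnPath x w z
      · exact Or.inr ⟨fun h2 => hw (h2 ▸ hz), h1⟩
      · exact Or.inl h1)
    ⟨x, hx, fun h1 => hw (hb.eq_of_self h1 ▸ hx)⟩ ⟨y, hy, fun h1 => hw (h1 ▸ hy), hxy⟩
  exact h1 h2.2

variable [CompactSpace X]

/-- An intermediate value theorem proved before the chain `[x, y]` is known to be connected:
compactness gives the highest point of height at most `s` and the lowest of height at least `s`, and
density of the order forbids a gap between them. -/
theorem exists_height_eq {ρ : X → ℝ} (hc : Continuous ρ) (hm : StrictMono ρ) {x y : X}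
    (hxy : x ≤ y) {s : ℝ} (h1 : ρ x ≤ s) (h2 : s ≤ ρ y) : ∃ z, x ≤ z ∧ z ≤ y ∧ ρ z = s := by
  have hS : IsCompact (Ici x ∩ Iic y) := ((h.isClosed_Ici x).inter (h.isClosed_Iic y)).isCompact
  obtain ⟨a, ⟨⟨ha1, ha2⟩, ha3⟩, hamax⟩ :=
    (hS.inter_right (isClosed_le hc continuous_const : IsClosed {z | ρ z ≤ s})).exists_isMaxOn
      ⟨x, ⟨⟨le_rfl, hxy⟩, h1⟩⟩ hc.continuousOn
  obtain ⟨b, ⟨⟨hb1, hb2⟩, hb3⟩, hbmin⟩ :=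
    (hS.inter_right (isClosed_le continuous_const hc : IsClosed {z | s ≤ ρ z})).exists_isMinOn
      ⟨y, ⟨⟨hxy, le_rfl⟩, h2⟩⟩ hc.continuousOn
  simp only [mem_ofPred_eq] at ha3 hb3
  rcases h.total ha2 hb2 with hab | hab
  · rcases hab.lt_or_eq with hab | rfl
    · obtain ⟨z, hz1, hz2⟩ := h.dense hab
      rcases le_total (ρ z) s with h3 | h3
      · exact absurd (hm hz1) (not_lt.2 (hamax ⟨⟨le_trans ha1 hz1.le, hz2.le.trans hb2⟩, h3⟩))
      · exact absurd (hm hz2) (not_lt.2 (hbmin ⟨⟨le_trans ha1 hz1.le, hz2.le.trans hb2⟩, h3⟩))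
    · exact ⟨a, ha1, ha2, le_antisymm ha3 hb3⟩
  · exact ⟨a, ha1, ha2, le_antisymm ha3 (hb3.trans (hm.monotone hab))⟩

theorem exists_arc {x y : X} (hxy : x ≠ y) : ∃ γ : unitInterval → X, IsEmbedding γ ∧ γ 0 = x ∧
    γ 1 = y ∧ range γ = {z | OnPath x z y} ∧ (x ≤ y → StrictMono γ) := by
  have hb := h.isBetweenness
  obtain ⟨ρ, hc, hm⟩ := h.height
  set e := x ⊓ y with he
  let S : Set X := {z | OnPath x z y}
  have hScomp : CompactSpace S := isCompact_iff_compactSpace.1 (h.isClosed_btw_mid x y).isCompact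
  have hu : ρ e - ρ x ≤ 0 := sub_nonpos.2 (hm.monotone inf_le_left)
  have hv : 0 ≤ ρ y - ρ e := sub_nonneg.2 (hm.monotone inf_le_right)
  have huv : ρ e - ρ x < ρ y - ρ e := by
    rcases hu.lt_or_eq with h1 | h1
    · exact h1.trans_le hv
    rcases hv.lt_or_eq with h2 | h2
    · exact hu.trans_lt h2
    exfalso
    apply hxy
    have h3 : e = x := by
      by_contra h3
      exact (hm (lt_of_le_of_ne inf_le_left h3)).ne (by linarith)
    have h4 : e = y := by
      by_contra h4
      exact (hm (lt_of_le_of_ne inf_le_right h4)).ne (by linarith)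
    exact h3.symm.trans h4
  -- A continuous signed height: on the path it is `ρ e - ρ z` on the branch of `x` and `ρ z - ρ e`
  -- on the branch of `y`. It maps the compact path bijectively onto an interval, and its inverse is
  -- the arc.
  let g : X → ℝ := fun z => ρ (y ⊓ z) - ρ (x ⊓ z)
  have hg : Continuous g :=
    (hc.comp (h.continuous_inf_left y)).sub (hc.comp (h.continuous_inf_left x))
  have hgx : ∀ z, e ≤ z → z ≤ x → g z = ρ e - ρ z := by
    intro z h1 h2
    have h3 : y ⊓ z = e := le_antisymm (le_inf (inf_le_right.trans h2) inf_le_left)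
      (le_inf inf_le_right h1)
    simp only [g, h3, inf_eq_right.2 h2]
  have hgy : ∀ z, e ≤ z → z ≤ y → g z = ρ z - ρ e := by
    intro z h1 h2
    have h3 : x ⊓ z = e := le_antisymm (le_inf inf_le_left (inf_le_right.trans h2))
      (le_inf inf_le_left h1)
    simp only [g, h3, inf_eq_right.2 h2]
  have heq : ∀ {z w}, z ≤ w → ρ w ≤ ρ z → z = w := fun {z w} h1 h2 => by
    by_contra h3
    exact absurd (hm (lt_of_le_of_ne h1 h3)) (not_lt.2 h2)
  have hinj : InjOn g S := by
    have key : ∀ {z w}, e ≤ z → e ≤ w → z ≤ x → w ≤ y → g z = g w → z = w := by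
      intro z w h1 h2 h3 h4 h5
      rw [hgx z h1 h3, hgy w h2 h4] at h5
      have h6 := hm.monotone h1
      have h7 := hm.monotone h2
      rw [← heq h1 (by linarith), ← heq h2 (by linarith)]
    have key2 : ∀ {t z w}, z ≤ t → w ≤ t → ρ z = ρ w → z = w := by
      intro t z w h1 h2 h3
      rcases h.total h1 h2 with h4 | h4
      · exact heq h4 h3.ge
      · exact (heq h4 h3.le).symm
    rintro z ⟨hz1, hz2⟩ w ⟨hw1, hw2⟩ hzw
    rcases hz2 with hz2 | hz2 <;> rcases hw2 with hw2 | hw2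
    · rw [hgx z hz1 hz2, hgx w hw1 hw2] at hzw
      exact key2 hz2 hw2 (by linarith)
    · exact key hz1 hw1 hz2 hw2 hzw
    · exact (key hw1 hz1 hw2 hz2 hzw.symm).symm
    · rw [hgy z hz1 hz2, hgy w hw1 hw2] at hzw
      exact key2 hz2 hw2 (by linarith)
  have hmaps : ∀ z : S, g z ∈ Icc (ρ e - ρ x) (ρ y - ρ e) := by
    rintro ⟨z, hz1, hz2⟩
    have h6 := hm.monotone hz1
    rcases hz2 with hz2 | hz2
    · have h7 := hm.monotone hz2
      simp only [hgx z hz1 hz2]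
      constructor <;> linarith
    · have h7 := hm.monotone hz2
      simp only [hgy z hz1 hz2]
      constructor <;> linarith
  let f : S → Icc (ρ e - ρ x) (ρ y - ρ e) := fun z => ⟨g z, hmaps z⟩
  have hf : Continuous f := (hg.comp continuous_subtype_val).subtype_mk _
  have hbij : Function.Bijective f := by
    constructor
    · intro z w hzw
      exact Subtype.ext (hinj z.2 w.2 (congrArg Subtype.val hzw))
    · rintro ⟨s, hs1, hs2⟩
      rcases le_total s 0 with h1 | h1
      · obtain ⟨z, hz1, hz2, hz3⟩ := h.exists_height_eq hc hm (inf_le_left : e ≤ x)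
          (s := ρ e - s) (by linarith) (by linarith)
        refine ⟨⟨z, hz1, Or.inl hz2⟩, Subtype.ext ?_⟩
        simp only [f, hgx z hz1 hz2, hz3]
        ring
      · obtain ⟨z, hz1, hz2, hz3⟩ := h.exists_height_eq hc hm (inf_le_right : e ≤ y)
          (s := ρ e + s) (by linarith) (by linarith)
        refine ⟨⟨z, hz1, Or.inr hz2⟩, Subtype.ext ?_⟩
        simp only [f, hgy z hz1 hz2, hz3]
        ring
  let F : S ≃ₜ Icc (ρ e - ρ x) (ρ y - ρ e) :=
    hf.homeoOfEquivCompactToT2 (f := Equiv.ofBijective f hbij)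
  have hF : ∀ z, F z = f z := fun z => rfl
  let I := iccHomeoI _ _ huv
  let G := I.symm.trans F.symm
  have hI0 : ((I.symm 0 : Icc (ρ e - ρ x) (ρ y - ρ e)) : ℝ) = ρ e - ρ x := by
    rw [iccHomeoI_symm_apply_coe]; simp
  have hI1 : ((I.symm 1 : Icc (ρ e - ρ x) (ρ y - ρ e)) : ℝ) = ρ y - ρ e := by
    rw [iccHomeoI_symm_apply_coe]; simp
  have hG0 : G 0 = ⟨x, hb.left x y⟩ := by
    refine (F.symm_apply_eq).2 (Subtype.ext ?_)
    exact hI0.trans (hgx x inf_le_left le_rfl).symm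
  have hG1 : G 1 = ⟨y, hb.right x y⟩ := by
    refine (F.symm_apply_eq).2 (Subtype.ext ?_)
    exact hI1.trans (hgy y inf_le_right le_rfl).symm
  refine ⟨fun t => (G t : X), IsEmbedding.subtypeVal.comp G.isEmbedding, by simp [hG0],
    by simp [hG1], ?_, ?_⟩
  · change range (Subtype.val ∘ G) = S
    rw [range_comp, G.surjective.range_eq, image_univ, Subtype.range_coe]
  · intro hle s t hst
    have hex : e = x := inf_eq_left.2 hle
    have hle' : ∀ z : S, e ≤ z.1 ∧ z.1 ≤ y := fun z => ⟨z.2.1, z.2.2.elim (·.trans hle) id⟩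
    have h1 : (F (G s) : ℝ) < F (G t) := by
      simp only [G, Homeomorph.trans_apply, Homeomorph.apply_symm_apply, I,
        iccHomeoI_symm_apply_coe]
      have : (s : ℝ) < t := hst
      have := mul_lt_mul_of_pos_left this (sub_pos.2 huv)
      linarith
    simp only [hF, f, hgy _ (hle' _).1 (hle' _).2] at h1
    rcases h.total (hle' (G s)).2 (hle' (G t)).2 with h2 | h2
    · exact lt_of_le_of_ne h2 fun h3 => h1.ne (by rw [show (G s : X) = G t from h3])
    · have := hm.monotone h2
      linarith

theorem isPreconnected_segment (x y : X) : IsPreconnected {z | OnPath x z y} := by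
  have hb := h.isBetweenness
  by_cases hxy : x = y
  · subst hxy
    have : {z | OnPath x z x} ⊆ {x} := fun z hz => hb.eq_of_self hz
    exact (subsingleton_singleton.anti this).isPreconnected
  · obtain ⟨γ, hγ, -, -, hr, -⟩ := h.exists_arc hxy
    rw [← hr]
    exact isPreconnected_range hγ.continuous

theorem isPreconnected_of_convex {S : Set X}
    (hS : ∀ x ∈ S, ∀ y ∈ S, ∀ z, OnPath x z y → z ∈ S) : IsPreconnected S := by
  have hb := h.isBetweenness
  exact isPreconnected_of_forall_pair fun x hx y hy =>
    ⟨{z | OnPath x z y}, fun z hz => hS x hx y hy z hz, hb.left _ _, hb.right _ _,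
      h.isPreconnected_segment x y⟩

omit [T2Space X] [CompactSpace X] in
theorem direction_convex {x p y z w : X} (hy : ¬ OnPath x p y) (hz : ¬ OnPath x p z)
    (hw : OnPath y w z) :
    ¬ OnPath x p w := by
  have hb := h.isBetweenness
  intro h1
  have h2 := (hb.or_of h1 y).resolve_left hy
  rcases hb.or_of (hb.trans h2 hw) x with h3 | h3
  · exact hy (hb.symm h3)
  · exact hz h3

theorem isPreconnected_direction (x p : X) : IsPreconnected {z : X | ¬ OnPath x p z} :=
  h.isPreconnected_of_convex fun _ hy _ hz _ hw => h.direction_convex hy hz hw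

omit [CompactSpace X] in
theorem btw_of_arc {γ : unitInterval → X} (hc : Continuous γ)
    {s t : unitInterval} {w : X} (hw : OnPath (γ s) w (γ t)) (hst : s ≤ t) :
    ∃ r, s ≤ r ∧ r ≤ t ∧ γ r = w := by
  by_contra! hcon
  have hpre : IsPreconnected (γ '' Icc s t) := isPreconnected_Icc.image _ hc.continuousOn
  refine h.not_btw_of_isPreconnected hpre (mem_image_of_mem _ ⟨le_rfl, hst⟩)
    (mem_image_of_mem _ ⟨hst, le_rfl⟩) ?_ hw
  rintro ⟨r, hr, hrw⟩
  exact hcon r hr.1 hr.2 hrw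

omit [CompactSpace X] in
-- The median of the three points is met by `γ` both in `[s, r]` and in `[r, t]`; by injectivity it
-- is `γ r`.
theorem arc_btw {γ : unitInterval → X} (hc : Continuous γ) (hi : Function.Injective γ)
    {s r t : unitInterval} (hsr : s ≤ r) (hrt : r ≤ t) : OnPath (γ s) (γ r) (γ t) := by
  obtain ⟨m, h1, h2, h3, -⟩ := h.exists_median (γ s) (γ r) (γ t)
  obtain ⟨a, -, ha, hma⟩ := h.btw_of_arc hc h1 hsr
  obtain ⟨b, hb, -, hmb⟩ := h.btw_of_arc hc h2 hrt
  have hab := hi (hma.trans hmb.symm)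
  have har : a = r := le_antisymm ha (hab ▸ hb)
  rw [← har, hma]
  exact h3

/-- Each point off `V` is cut from `x` by some `p`. By compactness finitely many cuts suffice, and
the finite intersection of the sides of `x` is open and convex, hence connected. -/
theorem locallyConnectedSpace : LocallyConnectedSpace X := by
  have hb := h.isBetweenness
  rw [locallyConnectedSpace_iff_subsets_isOpen_isConnected]
  intro x U hU
  obtain ⟨V, hVU, hVo, hxV⟩ := mem_nhds_iff.1 hU
  have hsep : ∀ y ∈ Vᶜ, ∃ p, p ≠ x ∧ p ≠ y ∧ OnPath x p y := by
    intro y hy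
    have hxy : x ≠ y := fun h1 => hy (h1 ▸ hxV)
    obtain ⟨a, b, hab, h1, h2⟩ := exists_ne_btw hxy
    obtain ⟨r, hr1, hr2⟩ := h.dense hab
    obtain ⟨h3, h4, h5⟩ := btw_of_lt h1 h2 hr1 hr2
    exact ⟨r, h4, h5, h3⟩
  choose! p hp1 hp2 hp3 using hsep
  obtain ⟨T, hT, hcov⟩ := hVo.isClosed_compl.isCompact.elim_nhds_subcover
    (fun y => {z | z ≠ p y ∧ OnPath x (p y) z}) fun y hy =>
      (h.isOpen_other_directions x (p y)).mem_nhds ⟨(hp2 y hy).symm, hp3 y hy⟩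
  refine ⟨⋂ y ∈ T, {z | ¬ OnPath x (p y) z}, ?_, ?_, ?_, ⟨x, ?_⟩, ?_⟩
  · intro z hz
    apply hVU
    by_contra hzV
    obtain ⟨y, hy, hzy⟩ := mem_iUnion₂.1 (hcov hzV)
    exact (mem_iInter₂.1 hz y hy) hzy.2
  · exact isOpen_biInter_finset fun y _ => h.isOpen_direction x (p y)
  · exact mem_iInter₂.2 fun y hy h1 => hp1 y (hT y hy) (hb.eq_of_self h1)
  · exact mem_iInter₂.2 fun y hy h1 => hp1 y (hT y hy) (hb.eq_of_self h1)
  · refine h.isPreconnected_of_convex fun a ha b hb c hc => ?_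
    rw [mem_iInter₂] at *
    exact fun y hy => h.direction_convex (ha y hy) (hb y hy) hc

theorem isDendrite [TopologicalSpace.MetrizableSpace X] : IsDendrite X where
  compact := inferInstance
  connected := by
    have : PreconnectedSpace X := ⟨h.isPreconnected_of_convex fun _ _ _ _ _ _ => mem_univ _⟩
    exact { toNonempty := ⟨⊥⟩ }
  locallyConnected := h.locallyConnectedSpace
  metrizable := inferInstance
  uniqueArc x y hxy := by
    obtain ⟨γ, hγ, h0, h1, hr, -⟩ := h.exists_arc hxy
    refine ⟨_, ⟨γ, hγ, h0, h1, hr⟩, ?_⟩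
    rintro A ⟨δ, hδ, rfl, rfl, rfl⟩
    ext z
    constructor
    · rintro ⟨t, rfl⟩
      exact h.arc_btw hδ.continuous hδ.injective unitInterval.nonneg' unitInterval.le_one'
    · intro hz
      obtain ⟨t, -, -, ht⟩ := h.btw_of_arc hδ.continuous hz unitInterval.nonneg'
      exact ⟨t, ht⟩

/-- Directions at `p` are convex, hence connected, and a connected set avoiding `p` cannot leave a
direction. So components of the complement are directions, and orders can be counted in the order
structure. -/
theorem component_eq_iff (p : X) (a b : ↥({p}ᶜ : Set X)) :
    (ConnectedComponents.mk a = ConnectedComponents.mk b) ↔ ¬ OnPath (a : X) p b := by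
  have hbt := h.isBetweenness
  rw [ConnectedComponents.coe_eq_coe]
  constructor
  · intro h1
    refine h.not_btw_of_isPreconnected (isPreconnected_connectedComponent (x := a)
      |>.image _ continuous_subtype_val.continuousOn) (mem_image_of_mem _ mem_connectedComponent)
      (mem_image_of_mem _ (h1.symm ▸ mem_connectedComponent)) ?_
    rintro ⟨z, -, hz⟩
    exact z.2 hz
  · intro h1
    have ha : ¬ OnPath (a : X) p a := fun h2 => a.2 (hbt.eq_of_self h2).symm
    have hsub : {z : X | ¬ OnPath (a : X) p z} ⊆ range (Subtype.val : ↥({p}ᶜ : Set X) → X) := by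
      intro z hz
      refine ⟨⟨z, ?_⟩, rfl⟩
      rintro rfl
      exact hz (hbt.right _ _)
    have hpre : IsPreconnected ((Subtype.val : ↥({p}ᶜ : Set X) → X) ⁻¹' {z : X | ¬ OnPath (a : X) p z})
        := by
      rw [← IsInducing.subtypeVal.isPreconnected_image, image_preimage_eq_of_subset hsub]
      exact h.isPreconnected_direction _ _
    exact (connectedComponent_eq (hpre.subset_connectedComponent ha h1))

theorem pointOrder_eq {p : X} {n : ℕ} (hp : HasDirections p n) : pointOrder p = n := by
  obtain ⟨f, hf, hs⟩ := hp
  let g : ConnectedComponents ↥({p}ᶜ : Set X) → Fin n := Quotient.lift (fun a => f a.1) fun a b hab =>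
    (hf _ _ a.2 b.2).2 ((h.component_eq_iff p a b).1 (Quotient.sound hab))
  have hg : ∀ a, g (ConnectedComponents.mk a) = f a.1 := fun a => rfl
  have hbij : Function.Bijective g := by
    constructor
    · intro a b
      obtain ⟨a, rfl⟩ := ConnectedComponents.surjective_coe a
      obtain ⟨b, rfl⟩ := ConnectedComponents.surjective_coe b
      rw [hg, hg, hf _ _ a.2 b.2, h.component_eq_iff]
      exact id
    · intro i
      obtain ⟨x, hx, hxi⟩ := hs i
      exact ⟨ConnectedComponents.mk ⟨x, hx⟩, by rw [hg]; exact hxi⟩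
  rw [pointOrder, ENat.card_congr (Equiv.ofBijective g hbij)]
  simp

/-- A point with something above it separates that from `⊥`. -/
theorem isMax_of_isEndpoint {p : X} (hp : IsEndpoint p) (hbot : p ≠ ⊥) : IsMax p := by
  intro y hy
  by_contra hyp
  have hne : y ≠ p := fun h1 => hyp h1.le
  have h1 := ENat.card_le_one_iff_subsingleton _ |>.1 (le_of_eq hp)
  have h2 := (h.component_eq_iff p ⟨⊥, hbot.symm⟩ ⟨y, hne⟩).1 (Subsingleton.elim _ _)
  exact h2 (btw_of_le bot_le hy)

omit [TopologicalSpace X] [T2Space X] [CompactSpace X] h in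
theorem hasDirections_one {p : X} (hp : IsMax p) (hbot : p ≠ ⊥) : HasDirections p 1 := by
  refine ⟨fun _ => 0, fun x y hx hy => iff_of_true rfl fun h1 => ?_, fun i =>
    ⟨⊥, hbot.symm, Subsingleton.elim _ _⟩⟩
  rcases h1.2 with h2 | h2
  · exact hx (hp.eq_of_le h2).symm
  · exact hy (hp.eq_of_le h2).symm

theorem exists_lt_Icc_subset {x : X} (hx : x ≠ ⊥) {U : Set X} (hU : U ∈ 𝓝 x) :
    ∃ y < x, Icc y x ⊆ U := by
  obtain ⟨γ, hγ, h0, h1, hr, hm⟩ := h.exists_arc (Ne.symm hx)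
  have hmono := hm bot_le
  have : γ ⁻¹' U ∈ 𝓝 (1 : unitInterval) := hγ.continuous.continuousAt (by rw [h1]; exact hU)
  obtain ⟨s, hs, hsU⟩ := exists_Ioc_subset_of_mem_nhds this ⟨0, by simp⟩
  obtain ⟨t, ht1, ht2⟩ := exists_between hs
  refine ⟨γ t, by rw [← h1]; exact hmono ht2, ?_⟩
  rintro z ⟨hz1, hz2⟩
  obtain ⟨r, rfl⟩ : z ∈ range γ := by rw [hr]; exact btw_of_le bot_le hz2
  exact hsU ⟨ht1.trans_le (hmono.le_iff_le.1 hz1), unitInterval.le_one'⟩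

/-- The cones above the points `y < b` are nested compact sets whose intersection is `{b}`, since
`b` is maximal. -/
theorem exists_lt_Ici_subset {b : X} (hb : IsMax b) (hbot : b ≠ ⊥) {U : Set X} (hU : U ∈ 𝓝 b) :
    ∃ y < b, Ici y ⊆ U := by
  have : Nonempty (Iio b) := ⟨⟨⊥, bot_lt_iff_ne_bot.2 hbot⟩⟩
  obtain ⟨y, hy⟩ := exists_subset_nhds_of_isCompact' (V := fun y : Iio b => Ici (y : X))
    (by
      rintro ⟨y, hy⟩ ⟨z, hz⟩
      rcases h.total (le_of_lt hy) (le_of_lt hz) with h1 | h1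
      · exact ⟨⟨z, hz⟩, Ici_subset_Ici.2 h1, subset_rfl⟩
      · exact ⟨⟨y, hy⟩, subset_rfl, Ici_subset_Ici.2 h1⟩)
    (fun y => (h.isClosed_Ici _).isCompact) (fun y => h.isClosed_Ici _) (U := U) (by
      intro z hz
      have hbz : b ≤ z := by
        by_contra h1
        obtain ⟨w, hw1, hw2⟩ := h.dense (lt_of_le_of_ne inf_le_left
          fun h2 => h1 (inf_eq_left.1 h2) : b ⊓ z < b)
        exact hw1.not_ge (le_inf hw2.le (mem_iInter.1 hz ⟨w, hw2⟩))
      rwa [← hb.eq_of_le hbz])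
  exact ⟨y, y.2, hy⟩

end closed

end IsTreeOrder

/-! ### Coloured trees and the distance of ramification points. -/

theorem IsBetweenness.restrict {P : Type*} {B : P → P → P → Prop} (h : IsBetweenness B)
    (R : Set P) : IsBetweenness fun x p y : R => B x p y where
  symm := h.symm
  left _ _ := h.left _ _
  eq_of_self := fun h1 => Subtype.ext (h.eq_of_self h1)
  or_of := fun h1 _ => h.or_of h1 _
  antisymm := fun h1 h2 => Subtype.ext (h.antisymm h1 h2)

/-- A tree order with a countable arcwise dense set `R` of ramification points; `c` counts the
changes of colour on the way from `⊥`, and the colour of a point is the parity of `c`. -/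
structure IsColouredTree (X : Type*) [TopologicalSpace X] [SemilatticeInf X] [OrderBot X]
    (R : Set X) (c : X → ℕ) : Prop extends IsTreeOrder X where
  countable : R.Countable
  bot_mem : ⊥ ∈ R
  count_bot : c ⊥ = 0
  inf_mem : ∀ {x y : X}, ¬ x ≤ y → ¬ y ≤ x → x ⊓ y ∈ R
  mono : ∀ {p q : X}, p ∈ R → q ∈ R → p ≤ q → c p ≤ c q
  between : ∀ {p q : X} {i : ℕ}, p ∈ R → q ∈ R → p < q → c p ≤ i → i ≤ c q →
    ∃ g ∈ R, p < g ∧ g < q ∧ c g = i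
  above : ∀ {p y : X} {i : ℕ}, p ∈ R → p < y → c p ≤ i → ∃ g ∈ R, p < g ∧ p < g ⊓ y ∧ c g = i
  dirs : ∀ {p : X}, p ∈ R → HasDirections p (if Even (c p) then 4 else 3)
  disjoint : ∀ {p : X}, p ≠ ⊥ → ∃ y : X, y ≠ ⊥ ∧ y ⊓ p = ⊥
  exists_mem : ∀ {x y : X}, x < y → ∃ r ∈ R, x < r ∧ r < y
  mem_of_order : ∀ {x : X}, 3 ≤ pointOrder x → x ∈ R

/-- The number of changes of colour between two points. -/
def colourDist {X : Type*} [SemilatticeInf X] (c : X → ℕ) (x y : X) : ℕ :=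
  (c x - c (x ⊓ y)) + (c y - c (x ⊓ y))

namespace IsColouredTree

variable {X : Type*} [TopologicalSpace X] [SemilatticeInf X] [OrderBot X] {R : Set X} {c : X → ℕ}
  (h : IsColouredTree X R c)
include h

theorem inf_mem' {x y : X} (hx : x ∈ R) (hy : y ∈ R) : x ⊓ y ∈ R := by
  by_cases h1 : x ≤ y
  · rwa [inf_eq_left.2 h1]
  by_cases h2 : y ≤ x
  · rwa [inf_eq_right.2 h2]
  exact h.inf_mem h1 h2

theorem count_inf_le {x y : X} (hx : x ∈ R) (hy : y ∈ R) :
    c (x ⊓ y) ≤ c x ∧ c (x ⊓ y) ≤ c y :=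
  ⟨h.mono (h.inf_mem' hx hy) hx inf_le_left, h.mono (h.inf_mem' hx hy) hy inf_le_right⟩

theorem colourDist_add {x p y : X} (hx : x ∈ R) (hp : p ∈ R) (hy : y ∈ R) (hb : OnPath x p y) :
    colourDist c x y = colourDist c x p + colourDist c p y := by
  obtain ⟨h1, h2⟩ := hb
  have k1 := h.count_inf_le hx hy
  have k2 := h.count_inf_le hx hp
  have k3 := h.count_inf_le hp hy
  unfold colourDist
  rcases h2 with h2 | h2
  · have e1 : x ⊓ p = p := inf_eq_right.2 h2
    have e2 : p ⊓ y = x ⊓ y := le_antisymm (inf_le_inf_right _ h2) (le_inf h1 inf_le_right)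
    rw [e1] at k2; rw [e2] at k3; rw [e1, e2]
    omega
  · have e1 : p ⊓ y = p := inf_eq_left.2 h2
    have e2 : x ⊓ p = x ⊓ y := le_antisymm (inf_le_inf_left _ h2) (le_inf inf_le_left h1)
    rw [e2] at k2; rw [e1] at k3; rw [e1, e2]
    omega

theorem even_colourDist {x y : X} (hx : x ∈ R) (hy : y ∈ R) :
    Even (colourDist c x y) ↔ (Even (c x) ↔ Even (c y)) := by
  have := h.count_inf_le hx hy
  have h1 : colourDist c x y + 2 * c (x ⊓ y) = c x + c y := by unfold colourDist; omega
  rw [← Nat.even_add, ← h1, Nat.even_add]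
  simp

/-- The path goes down from `p` to `p ⊓ q` and then up to `q`. The first `c p - c (p ⊓ q)` changes
are met on the descent, the others on the ascent. -/
theorem exists_strictly_between {p q : X} (hp : p ∈ R) (hq : q ∈ R) (hpq : p ≠ q) {i : ℕ}
    (hi : i ≤ colourDist c p q) :
    ∃ g ∈ R, g ≠ p ∧ g ≠ q ∧ OnPath p g q ∧ colourDist c p g = i := by
  have he := h.inf_mem' hp hq
  have k := h.count_inf_le hp hq
  by_cases h1 : p ⊓ q < p ∧ i ≤ c p - c (p ⊓ q)
  · obtain ⟨g, hg, hg1, hg2, hg3⟩ := h.between he hp h1.1 (i := c p - i) (by omega) (by omega)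
    have := IsTreeOrder.btw_of_lt (x := p) (y := q) le_rfl (Or.inl le_rfl) hg1 hg2
    refine ⟨g, hg, this.2.1, this.2.2, this.1, ?_⟩
    simp only [colourDist, inf_eq_right.2 hg2.le]
    omega
  · have h2 : p ⊓ q < q := by
      refine lt_of_le_of_ne inf_le_right fun h2 => h1 ⟨lt_of_le_of_ne inf_le_left fun h3 =>
        hpq (h3.symm.trans h2), ?_⟩
      unfold colourDist at hi
      rw [h2] at hi ⊢
      omega
    have h3 : c p - c (p ⊓ q) ≤ i := by
      by_cases h4 : p ⊓ q < p
      · by_contra h5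
        exact h1 ⟨h4, by omega⟩
      · have : p ⊓ q = p := by
          by_contra h5
          exact h4 (lt_of_le_of_ne inf_le_left h5)
        rw [this]; omega
    obtain ⟨g, hg, hg1, hg2, hg3⟩ := h.between he hq h2
      (i := c (p ⊓ q) + (i - (c p - c (p ⊓ q)))) (by omega) (by unfold colourDist at hi; omega)
    have := IsTreeOrder.btw_of_lt (x := p) (y := q) le_rfl (Or.inr le_rfl) hg1 hg2
    refine ⟨g, hg, this.2.1, this.2.2, this.1, ?_⟩
    have e : p ⊓ g = p ⊓ q := le_antisymm (inf_le_inf_left _ hg2.le) (le_inf inf_le_left hg1.le)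
    simp only [colourDist, e]
    omega

/-- An upward direction is covered by `above`. The downward one has points at distance up to `c p`
on the way to `⊥`; for larger distances one continues through `⊥` into a branch disjoint from `p`.
-/
theorem exists_in_direction {p y : X} (hp : p ∈ R) (hy : y ≠ p) (i : ℕ) :
    ∃ g ∈ R, ¬ OnPath y p g ∧ colourDist c p g = i := by
  by_cases hpy : p ≤ y
  · obtain ⟨g, hg, h1, h2, h3⟩ := h.above hp (lt_of_le_of_ne hpy hy.symm)
      (Nat.le_add_right (c p) i)
    refine ⟨g, hg, fun h4 => ?_, ?_⟩
    · exact h2.not_ge (by rw [inf_comm]; exact h4.1)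
    · simp only [colourDist, inf_eq_left.2 h1.le]
      omega
  · have hbot : ⊥ ≠ p := fun h1 => hpy (h1 ▸ bot_le)
    have hlt : ⊥ < p := bot_lt_iff_ne_bot.2 hbot.symm
    by_cases hi : i ≤ c p
    · obtain ⟨g, hg, h1, h2, h3⟩ := h.between h.bot_mem hp hlt (i := c p - i)
        (by rw [h.count_bot]; omega) (by omega)
      refine ⟨g, hg, fun h4 => h4.2.elim hpy h2.not_ge, ?_⟩
      simp only [colourDist, inf_eq_right.2 h2.le]
      omega
    · obtain ⟨z, hz, hzp⟩ := h.disjoint hbot.symm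
      obtain ⟨g, hg, h1, h2, h3⟩ := h.above h.bot_mem (bot_lt_iff_ne_bot.2 hz) (i := i - c p)
        (by rw [h.count_bot]; omega)
      have hgp : p ⊓ g = ⊥ := by
        rcases h.total (inf_le_left : g ⊓ z ≤ g) (inf_le_right : p ⊓ g ≤ g) with h4 | h4
        · exact absurd (le_inf inf_le_right (h4.trans inf_le_left)) (by rw [hzp]; exact h2.not_ge)
        · exact le_bot_iff.1 (hzp ▸ le_inf (h4.trans inf_le_right) inf_le_left)
      refine ⟨g, hg, fun h4 => h4.2.elim hpy fun h5 => ?_, ?_⟩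
      · rw [inf_eq_left.2 h5] at hgp
        exact hbot hgp.symm
      · simp only [colourDist, hgp, h.count_bot]
        omega

variable [T2Space X] [CompactSpace X]

theorem dense_mem : Dense R := by
  intro x
  rw [mem_closure_iff_nhds]
  intro U hU
  by_cases hx : x = ⊥
  · exact ⟨x, mem_of_mem_nhds hU, hx ▸ h.bot_mem⟩
  · obtain ⟨y, hy, hyU⟩ := h.exists_lt_Icc_subset hx hU
    obtain ⟨r, hr, h1, h2⟩ := h.exists_mem hy
    exact ⟨r, hyU ⟨h1.le, h2.le⟩, hr⟩

theorem exists_mem_direction {x p : X} (hx : x ≠ p) : ∃ r ∈ R, ¬ OnPath x p r := by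
  obtain ⟨r, h1, h2⟩ := h.dense_mem.inter_open_nonempty _ (h.isOpen_direction x p)
    ⟨x, fun h1 => hx (h.isBetweenness.eq_of_self h1).symm⟩
  exact ⟨r, h2, h1⟩

theorem isRichTree : IsRichTree (fun x p y : R => OnPath (x : X) p y)
    (fun x y => colourDist c x y) fun p => if Even (c p) then 4 else 3 where
  between := h.isBetweenness.restrict R
  median x y z := by
    obtain ⟨m, h1, h2, h3, h4⟩ := h.exists_median (x : X) y z
    have hm : m ∈ R := by
      rcases h4 with rfl | rfl | rfl
      · exact h.inf_mem' x.2 y.2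
      · exact h.inf_mem' y.2 z.2
      · exact h.inf_mem' x.2 z.2
    exact ⟨⟨m, hm⟩, h1, h2, h3⟩
  dist_comm x y := by simp only [colourDist, inf_comm (x : X)]; omega
  dist_self x := by simp [colourDist]
  dist_add := fun {x p y} hb => h.colourDist_add x.2 p.2 y.2 hb
  colour := by
    intro p g p' g' h1 h2
    have h3 : Even (c p) ↔ Even (c p') := by
      by_cases h4 : Even (c p) <;> by_cases h5 : Even (c p') <;> simp [h4, h5] at h1 ⊢
    have h4 := h.even_colourDist p.2 g.2
    have h5 := h.even_colourDist p'.2 g'.2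
    rw [h2] at h4
    have h6 : Even (c g) ↔ Even (c g') := by tauto
    simp only [h6]
  dense := by
    intro p q hpq i hi
    obtain ⟨g, hg, h1, h2, h3, h4⟩ := h.exists_strictly_between p.2 q.2
      (fun h1 => hpq (Subtype.ext h1)) hi
    exact ⟨⟨g, hg⟩, fun h5 => h1 (congrArg Subtype.val h5), fun h5 => h2 (congrArg Subtype.val h5),
      h3, h4⟩
  full := by
    intro p y hy i
    obtain ⟨g, hg, h1, h2⟩ := h.exists_in_direction p.2 (fun h1 => hy (Subtype.ext h1)) i
    exact ⟨⟨g, hg⟩, h1, h2⟩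
  directions p := by
    obtain ⟨f, hf, hs⟩ := h.dirs p.2
    refine ⟨fun x => f x, fun x y hx hy => hf _ _ (fun h1 => hx (Subtype.ext h1))
      (fun h1 => hy (Subtype.ext h1)), fun i => ?_⟩
    obtain ⟨x, hx, rfl⟩ := hs i
    obtain ⟨r, hr, hxr⟩ := h.exists_mem_direction hx
    have hrp : r ≠ p := by
      rintro rfl
      exact hxr (h.isBetweenness.right _ _)
    exact ⟨⟨r, hr⟩, fun h1 => hrp (congrArg Subtype.val h1), ((hf _ _ hx hrp).2 hxr).symm⟩

omit [T2Space X] [CompactSpace X] in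
theorem exists_separating {y z : X} (hyz : y ≠ z) : ∃ r ∈ R, OnPath y r z ∧ r ≠ y ∧ r ≠ z := by
  obtain ⟨a, b, hab, h1, h2⟩ := IsTreeOrder.exists_ne_btw hyz
  obtain ⟨r, hr, h3, h4⟩ := h.exists_mem hab
  exact ⟨r, hr, IsTreeOrder.btw_of_lt h1 h2 h3 h4⟩

/-! ### From automorphisms of `R` to homeomorphisms of `X`. -/

section extension

variable (σ : R ≃ R) (hσ : ∀ x p y : R, OnPath (x : X) p y ↔ OnPath (σ x : X) (σ p) (σ y))
include hσ

/-- An automorphism of the betweenness structure of `R` determines the image of every point. -/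
theorem exists_image (x : X) :
    ∃ y : X, ∀ p q : R, OnPath x (p : X) q ↔ OnPath y (σ p : X) (σ q) := by
  have hb := h.isBetweenness
  by_cases hx : x ∈ R
  · exact ⟨σ ⟨x, hx⟩, fun p q => hσ ⟨x, hx⟩ p q⟩
  let I := {u : R × R // OnPath x (u.1 : X) u.2}
  -- The image must satisfy the transported closed conditions. Finitely many of them are satisfied
  -- by `σ r` for some `r ∈ R` close to `x`, so compactness gives a common solution.
  obtain ⟨y, hy⟩ : (⋂ u : I, {y : X | OnPath y (σ u.1.1 : X) (σ u.1.2)}).Nonempty := by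
    refine CompactSpace.iInter_nonempty (fun u => ?_) fun T => ?_
    · have : {y : X | OnPath y (σ u.1.1 : X) (σ u.1.2)} =
          {y : X | OnPath (σ u.1.2 : X) (σ u.1.1) y} := by
        ext y; exact ⟨hb.symm, hb.symm⟩
      rw [this]
      exact h.isClosed_btw_right _ _
    · obtain ⟨r, hr1, hr2⟩ := h.dense_mem.inter_open_nonempty
        (⋂ u ∈ T, {z | ¬ OnPath x (u.1.1 : X) z})
        (isOpen_biInter_finset fun u _ => h.isOpen_direction x _)
        ⟨x, mem_iInter₂.2 fun u _ h1 => hx (hb.eq_of_self h1 ▸ u.1.1.2)⟩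
      refine ⟨σ ⟨r, hr2⟩, mem_iInter₂.2 fun u hu => ?_⟩
      exact (hσ ⟨r, hr2⟩ _ _).1 ((hb.or_of u.2 r).resolve_left (mem_iInter₂.1 hr1 u hu))
  have hy' : ∀ p q : R, OnPath x p q → OnPath y (σ p : X) (σ q) := fun p q hpq =>
    mem_iInter.1 hy ⟨(p, q), hpq⟩
  refine ⟨y, fun p q => ⟨hy' p q, fun hyp => ?_⟩⟩
  by_contra hxp
  have hpx : x ≠ p := fun h1 => hx (h1 ▸ p.2)
  -- Conversely, a point `s` of `R` between `p` and `x` records that `x` is strictly on its own side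
  -- of `p`, and its image contradicts `hyp`.
  obtain ⟨s, hs, h1, h2, h3⟩ := h.exists_separating hpx
  have hsq : ¬ OnPath (s : X) p q := by
    intro h4
    rcases hb.or_of h4 x with h5 | h5
    · exact h3 (hb.antisymm h1 (hb.symm h5))
    · exact hxp h5
  have h4 : OnPath y (σ p : X) (σ ⟨s, hs⟩) :=
    (hb.or_of hyp _).resolve_right fun h5 => hsq ((hσ ⟨s, hs⟩ p q).2 h5)
  have h5 := hb.antisymm h4 (hy' ⟨s, hs⟩ p h1)
  exact h3 (congrArg Subtype.val (σ.injective (Subtype.ext h5))).symm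

end extension

theorem eq_of_forall_iff {x y : X} (hxy : ∀ p q : R, OnPath x (p : X) q ↔ OnPath y (p : X) q) :
    x = y := by
  have hb := h.isBetweenness
  by_contra hne
  obtain ⟨r, hr, h1, h2, h3⟩ := h.exists_separating hne
  obtain ⟨q, hq, h4⟩ := h.exists_mem_direction (Ne.symm h2)
  have h5 : ¬ OnPath y r q := fun h5 => h4 ((hxy ⟨r, hr⟩ ⟨q, hq⟩).2 h5)
  rcases hb.or_of h1 q with h6 | h6
  · exact h4 h6
  · exact h5 (hb.symm h6)

/-- Preimages of directions at points of `R` are again directions, hence open, and by compactness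
finitely many directions separate `Φ x` from a closed set. -/
theorem continuous_of_iff {σ : R ≃ R} {Φ : X → X}
    (hΦ : ∀ x : X, ∀ p q : R, OnPath x (p : X) q ↔ OnPath (Φ x) (σ p : X) (σ q)) : Continuous Φ := by
  have hb := h.isBetweenness
  have hopen : ∀ p q : R, IsOpen {x | ¬ OnPath (Φ x) (p : X) q} := by
    intro p q
    have : {x | ¬ OnPath (Φ x) (p : X) q} = {x | ¬ OnPath (σ.symm q : X) (σ.symm p) x} := by
      ext x
      have := hΦ x (σ.symm p) (σ.symm q)
      simp only [Equiv.apply_symm_apply] at this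
      change ¬ _ ↔ ¬ _
      rw [← this]
      exact not_congr ⟨hb.symm, hb.symm⟩
    rw [this]
    exact h.isOpen_direction _ _
  rw [continuous_iff_isClosed]
  intro K hK
  rw [← isOpen_compl_iff, isOpen_iff_mem_nhds]
  intro x hx
  have hsep : ∀ y ∈ K, ∃ p q : R, y ≠ (p : X) ∧ OnPath y (p : X) q ∧ ¬ OnPath (Φ x) (p : X) q := by
    intro y hy
    have hne : Φ x ≠ y := fun h1 => hx (show Φ x ∈ K from h1 ▸ hy)
    obtain ⟨r, hr, h1, h2, h3⟩ := h.exists_separating hne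
    obtain ⟨q, hq, h4⟩ := h.exists_mem_direction (Ne.symm h2)
    refine ⟨⟨r, hr⟩, ⟨q, hq⟩, h3.symm, ?_, h4⟩
    exact hb.symm ((hb.or_of h1 q).resolve_left h4)
  have : Nonempty R := ⟨⟨⊥, h.bot_mem⟩⟩
  choose! p q h1 h2 h3 using hsep
  obtain ⟨T, hT, hcov⟩ := hK.isCompact.elim_nhds_subcover
    (fun y => {z | z ≠ p y ∧ OnPath (q y : X) (p y) z}) fun y hy =>
      (h.isOpen_other_directions _ _).mem_nhds ⟨h1 y hy, hb.symm (h2 y hy)⟩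
  filter_upwards [(isOpen_biInter_finset (s := T) fun y _ => hopen (p y) (q y)).mem_nhds
    (mem_iInter₂.2 fun y hy => h3 y (hT y hy))] with z hz hzK
  obtain ⟨y, hy, hzy⟩ := mem_iUnion₂.1 (hcov hzK)
  exact mem_iInter₂.1 hz y hy (hb.symm hzy.2)

/-- Automorphisms of the betweenness structure of `R` extend to homeomorphisms. -/
theorem exists_homeomorph (σ : R ≃ R)
    (hσ : ∀ x p y : R, OnPath (x : X) p y ↔ OnPath (σ x : X) (σ p) (σ y)) :
    ∃ Φ : X ≃ₜ X, ∀ x : X, ∀ p q : R, OnPath x (p : X) q ↔ OnPath (Φ x) (σ p : X) (σ q) := by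
  have hσ' : ∀ x p y : R, OnPath (x : X) p y ↔ OnPath (σ.symm x : X) (σ.symm p) (σ.symm y) := by
    intro x p y
    rw [hσ (σ.symm x)]
    simp
  choose Φ hΦ using h.exists_image σ hσ
  choose Ψ hΨ using h.exists_image σ.symm hσ'
  refine ⟨⟨⟨Φ, Ψ, fun x => ?_, fun x => ?_⟩, h.continuous_of_iff hΦ, h.continuous_of_iff hΨ⟩, hΦ⟩
  · refine h.eq_of_forall_iff fun p q => ?_
    rw [hΦ x, hΨ (Φ x)]
    simp
  · refine h.eq_of_forall_iff fun p q => ?_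
    rw [hΨ x, hΦ (Ψ x)]
    simp

/-- Homogeneity for pairs of points of the same colour at the same distance. -/
theorem exists_homeomorph_pair {u v u' v' : X} (hu : u ∈ R) (hv : v ∈ R) (hu' : u' ∈ R)
    (hv' : v' ∈ R) (huv : u ≠ v) (huv' : u' ≠ v') (hc : Even (c u) ↔ Even (c u'))
    (hd : colourDist c u v = colourDist c u' v') :
    ∃ Φ : X ≃ₜ X, (∀ x, OnPath x u v → OnPath (Φ x) u' v') ∧
      ∀ x, OnPath x v u → OnPath (Φ x) v' u' := by
  classical
  have hb := h.isBetweenness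
  have hrich := h.isRichTree
  have : Countable R := h.countable.to_subtype
  have hne : ∀ {x y : X}, x ≠ y → ¬ OnPath x y x := fun h1 h2 => h1 (hb.eq_of_self h2).symm
  let a : R × R := (⟨u, hu⟩, ⟨u', hu'⟩)
  let b : R × R := (⟨v, hv⟩, ⟨v', hv'⟩)
  -- Two points are closed under medians, so equal colours and distances already make the two pairs
  -- a partial isomorphism.
  obtain ⟨σ, h1, h2⟩ := hrich.exists_equiv (F := {a, b}) (by
    refine ⟨?_, ?_, ?_, ?_⟩
    · simp only [Finset.forall_mem_insert, Finset.mem_singleton, forall_eq]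
      refine ⟨by simp only [a, hc], ?_⟩
      have := hrich.colour (p := a.1) (p' := a.2) (g := b.1) (g' := b.2) (by simp only [a, hc]) hd
      exact this
    · simp only [Finset.forall_mem_insert, Finset.mem_singleton, forall_eq]
      refine ⟨⟨by simp [colourDist], hd⟩, ?_, by simp [colourDist]⟩
      rw [hrich.dist_comm, hrich.dist_comm b.2]
      exact hd
    · simp only [Finset.forall_mem_insert, Finset.mem_singleton, forall_eq]
      simp [hb.left, hb.right, hne, huv, huv', huv.symm, huv'.symm, a, b]
    · simp only [Finset.forall_mem_insert, Finset.mem_singleton, forall_eq,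
        Finset.exists_mem_insert, exists_eq_left]
      simp [hb.left, hb.right, hne, huv, huv.symm, a, b]) (by simp)
  have ha := h1 a (by simp)
  have hb' := h1 b (by simp)
  obtain ⟨Φ, hΦ⟩ := h.exists_homeomorph σ h2
  refine ⟨Φ, fun x hx => ?_, fun x hx => ?_⟩
  · have := (hΦ x a.1 b.1).1 hx
    rwa [ha, hb'] at this
  · have := (hΦ x b.1 a.1).1 hx
    rwa [ha, hb'] at this

end IsColouredTree

namespace IsColouredTree

variable {X : Type*} [TopologicalSpace X] [SemilatticeInf X] [OrderBot X] {R : Set X} {c : X → ℕ}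

/-! ### Alternating endpoints -/

/-- `a` is a maximal point on the way to which the colour changes infinitely often. -/
def IsUnboundedEnd (R : Set X) (c : X → ℕ) (a : X) : Prop :=
  a ≠ ⊥ ∧ IsMax a ∧ ∀ N, ∃ p ∈ R, p < a ∧ N ≤ c p

variable (h : IsColouredTree X R c)
include h

theorem exists_count_eq {a y : X} (ha : IsUnboundedEnd R c a) (hy : y < a) :
    ∃ N, ∀ i ≥ N, ∃ g ∈ R, y < g ∧ g < a ∧ c g = i := by
  obtain ⟨q, hq, h1, h2⟩ := h.exists_mem hy
  refine ⟨c q, fun i hi => ?_⟩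
  obtain ⟨p, hp, h3, h4⟩ := ha.2.2 (i + 1)
  have hqp : q < p := by
    rcases h.total h2.le h3.le with h5 | h5
    · refine lt_of_le_of_ne h5 ?_
      rintro rfl
      omega
    · have := h.mono hp hq h5
      omega
  obtain ⟨g, hg, h5, h6, h7⟩ := h.between hq hp hqp hi (by omega)
  exact ⟨g, hg, h1.trans h5, h6.trans h3, h7⟩

variable [T2Space X] [CompactSpace X]

theorem pointOrder_of_mem {p : X} (hp : p ∈ R) : pointOrder p = if Even (c p) then 4 else 3 := by
  rw [h.pointOrder_eq (h.dirs hp)]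
  split_ifs <;> rfl

/-- If the count is bounded below `a`, it attains its maximum at some `p < a`. Beyond `p` it is
constant, so every arc ending at `a` finally sees one colour only. -/
theorem isUnboundedEnd_of_alternating {a : X} (ha : IsAlternatingEndpoint a) :
    IsUnboundedEnd R c a := by
  obtain ⟨hend, hgreen, hred⟩ := ha
  have hbot : a ≠ ⊥ := by
    rintro rfl
    have h1 := h.pointOrder_of_mem h.bot_mem
    rw [h.count_bot] at h1
    rw [IsEndpoint, h1] at hend
    simp at hend
  have hmax := h.isMax_of_isEndpoint hend hbot
  refine ⟨hbot, hmax, ?_⟩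
  by_contra! hcon
  obtain ⟨N, hN⟩ := hcon
  obtain ⟨p, ⟨hp, hpa⟩, hpmax⟩ : ∃ p, (p ∈ R ∧ p < a) ∧ ∀ q ∈ R, q < a → c q ≤ c p := by
    have hne : (c '' {p | p ∈ R ∧ p < a}).Nonempty :=
      ⟨_, ⊥, ⟨h.bot_mem, bot_lt_iff_ne_bot.2 hbot⟩, rfl⟩
    have hbdd : BddAbove (c '' {p | p ∈ R ∧ p < a}) := by
      refine ⟨N, ?_⟩
      rintro _ ⟨p, ⟨hp, hpa⟩, rfl⟩
      exact (hN p hp hpa).le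
    obtain ⟨p, hp, hpc⟩ := Nat.sSup_mem hne hbdd
    exact ⟨p, hp, fun q hq hqa => hpc ▸ le_csSup hbdd ⟨q, ⟨hq, hqa⟩, rfl⟩⟩
  have key : ∀ γ : unitInterval → X, IsEmbedding γ → γ 1 = a → ∃ r : unitInterval, r < 1 ∧
      ∀ s, r ≤ s → IsRamification (γ s) → pointOrder (γ s) = if Even (c p) then 4 else 3 := by
    intro γ hγ hγa
    have h0 : γ 0 ⊓ a < a := by
      refine lt_of_le_of_ne inf_le_right fun h1 => ?_
      have h2 := hmax.eq_of_le (inf_eq_right.1 h1)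
      exact zero_ne_one (hγ.injective (h2.symm.trans hγa.symm))
    -- `z` is beyond both `p` and the point where `γ` joins the branch from `⊥` to `a`; from `z` on,
    -- `γ` climbs that branch.
    obtain ⟨z, hz1, hz2, hz3⟩ : ∃ z, γ 0 ⊓ a ≤ z ∧ p ≤ z ∧ z < a := by
      rcases h.total h0.le hpa.le with h1 | h1
      · exact ⟨p, h1, le_rfl, hpa⟩
      · exact ⟨_, le_rfl, h1, h0⟩
    obtain ⟨r, -, -, rfl⟩ := h.btw_of_arc hγ.continuous (s := 0) (t := 1) (w := z)
      (by rw [hγa]; exact ⟨hz1, Or.inr hz3.le⟩) unitInterval.nonneg'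
    refine ⟨r, lt_of_le_of_ne unitInterval.le_one' ?_, ?_⟩
    · rintro rfl
      exact hz3.ne hγa
    intro s hs hram
    have h1 := h.arc_btw hγ.continuous hγ.injective hs unitInterval.le_one'
    rw [hγa] at h1
    have h2 : γ r ≤ γ s := by simpa [inf_eq_left.2 hz3.le] using h1.1
    have h3 : γ s ≤ a := h1.2.elim (fun h3 => h3.trans hz3.le) id
    have hsR := h.mem_of_order hram
    have h4 : γ s < a := by
      refine lt_of_le_of_ne h3 fun h4 => ?_
      rw [IsRamification, h4, hend] at hram
      norm_num at hram
    rw [h.pointOrder_of_mem hsR,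
      le_antisymm (hpmax _ hsR h4) (h.mono hp hsR (hz2.trans h2))]
  by_cases hev : Even (c p)
  · exact hred ⟨hend, by simpa only [hev, if_true] using key⟩
  · exact hgreen ⟨hend, by simpa only [hev, if_false] using key⟩

theorem alternating_of_isUnboundedEnd {a : X} (ha : IsUnboundedEnd R c a) :
    IsAlternatingEndpoint a := by
  have hend : IsEndpoint a := h.pointOrder_eq (IsTreeOrder.hasDirections_one ha.2.1 ha.1)
  obtain ⟨γ, hγ, h0, h1, hr, hm⟩ := h.exists_arc ha.1.symm
  have hmono := hm bot_le
  have key : ∀ r : unitInterval, r < 1 → ∃ N, ∀ i ≥ N, ∃ s, r ≤ s ∧ γ s ∈ R ∧ c (γ s) = i := by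
    intro r hr1
    obtain ⟨N, hN⟩ := h.exists_count_eq ha (y := γ r) (by rw [← h1]; exact hmono hr1)
    refine ⟨N, fun i hi => ?_⟩
    obtain ⟨g, hg, h2, h3, h4⟩ := hN i hi
    obtain ⟨s, rfl⟩ : g ∈ range γ := by rw [hr]; exact IsTreeOrder.btw_of_le bot_le h3.le
    exact ⟨s, (hmono.lt_iff_lt.1 h2).le, hg, h4⟩
  refine ⟨hend, fun hg => ?_, fun hg => ?_⟩
  · obtain ⟨r, hr1, hr2⟩ := hg.2 γ hγ h1
    obtain ⟨N, hN⟩ := key r hr1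
    -- An even count means order `4` and refutes green; the odd count `2 * N + 1` below refutes red.
    obtain ⟨s, hs, hsR, hsc⟩ := hN (2 * N) (by omega)
    have h5 := h.pointOrder_of_mem hsR
    rw [hsc, if_pos (by simp)] at h5
    have := hr2 s hs (by rw [IsRamification, h5]; norm_num)
    rw [h5] at this
    norm_num at this
  · obtain ⟨r, hr1, hr2⟩ := hg.2 γ hγ h1
    obtain ⟨N, hN⟩ := key r hr1
    obtain ⟨s, hs, hsR, hsc⟩ := hN (2 * N + 1) (by omega)
    have h5 := h.pointOrder_of_mem hsR
    rw [hsc, if_neg (by simp)] at h5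
    have := hr2 s hs (by rw [IsRamification, h5])
    rw [h5] at this
    norm_num at this

/-! ### The Ellis semigroup -/

/-- The cone above `p1` lies in `V` and the cone above `p2` in `U`. A homeomorphism with `p0 ↦ p1`
and `p1 ↦ p2` sends what is behind `p0`, such as `b`, behind `p1`, and what is behind `p1` as seen
from `p0`, such as all points outside `V`, behind `p2`. -/
theorem exists_homeomorph_collapse {a b : X} (ha : IsUnboundedEnd R c a)
    (hb : IsUnboundedEnd R c b) (hab : a ≠ b) {U V : Set X} (hU : U ∈ 𝓝 a) (hV : V ∈ 𝓝 b) :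
    ∃ Φ : X ≃ₜ X, Φ b ∈ V ∧ ∀ x ∉ V, Φ x ∈ U := by
  have hea : a ⊓ b < a := lt_of_le_of_ne inf_le_left fun h1 =>
    hab (ha.2.1.eq_of_le (inf_eq_left.1 h1))
  have heb : a ⊓ b < b := lt_of_le_of_ne inf_le_right fun h1 =>
    hab (hb.2.1.eq_of_le (inf_eq_right.1 h1)).symm
  have hmax : ∀ {x y : X}, y < x → a ⊓ b < x → ∃ z, y ≤ z ∧ a ⊓ b ≤ z ∧ z < x := by
    intro x y h1 h2
    rcases h.total h1.le h2.le with h3 | h3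
    · exact ⟨_, h3, le_rfl, h2⟩
    · exact ⟨_, le_rfl, h3, h1⟩
  obtain ⟨y1, hy1, hy1V⟩ := h.exists_lt_Ici_subset hb.2.1 hb.1 hV
  obtain ⟨y2, hy2, hy2U⟩ := h.exists_lt_Ici_subset ha.2.1 ha.1 hU
  obtain ⟨z1, hz1, hez1, hz1b⟩ := hmax hy1 heb
  obtain ⟨z2, hz2, hez2, hz2a⟩ := hmax hy2 hea
  obtain ⟨p1, hp1, hzp1, hp1b⟩ := h.exists_mem hz1b
  obtain ⟨N, hN⟩ := h.exists_count_eq ha hz2a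
  -- This count is at least `N` and has the parity of `c p1`, so `p1` and `p2` have the same colour
  -- and their distance is even.
  obtain ⟨p2, hp2, hzp2, hp2a, hp2c⟩ := hN (2 * N + c p1) (by omega)
  have hp1a : ¬ p1 ≤ a := fun h1 => (hez1.trans_lt hzp1).not_ge (le_inf h1 hp1b.le)
  have hp2b : ¬ p2 ≤ b := fun h1 => (hez2.trans_lt hzp2).not_ge (le_inf hp2a.le h1)
  have h12 : ¬ p1 ≤ p2 := fun h1 => hp1a (h1.trans hp2a.le)
  have h21 : ¬ p2 ≤ p1 := fun h1 => hp2b (h1.trans hp1b.le)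
  -- Unboundedness below `b` leaves room for a `p0` above `p1` at distance exactly `colourDist c p1
  -- p2`.
  obtain ⟨p', hp', hp'b, hp'c⟩ := hb.2.2 (c p1 + colourDist c p1 p2 + 1)
  have hp1p' : p1 < p' := by
    rcases h.total hp1b.le hp'b.le with h5 | h5
    · refine lt_of_le_of_ne h5 ?_
      rintro rfl
      omega
    · have := h.mono hp' hp1 h5
      omega
  obtain ⟨p0, hp0, h10, hp0p', hp0c⟩ := h.between hp1 hp' hp1p'
    (i := c p1 + colourDist c p1 p2) (by omega) (by omega)
  have hev := h.even_colourDist hp1 hp2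
  have hev2 : Even (c p1) ↔ Even (c p2) := by rw [hp2c, Nat.even_add]; simp
  obtain ⟨Φ, h1, h2⟩ := h.exists_homeomorph_pair hp0 hp1 hp1 hp2 h10.ne' (fun h3 => h12 h3.le)
    (by rw [hp0c, Nat.even_add]; tauto)
    (by simp only [colourDist, inf_eq_right.2 h10.le, hp0c]; omega)
  refine ⟨Φ, ?_, fun x hx => ?_⟩
  · have h3 := h1 b ((h.isBetweenness).symm (IsTreeOrder.btw_of_le h10.le (hp0p'.trans hp'b).le))
    exact hy1V ((hz1.trans hzp1.le).trans (h3.2.resolve_right h12))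
  · have hp1x : ¬ p1 ≤ x := fun h3 => hx (hy1V ((hz1.trans hzp1.le).trans h3))
    have h3 := h2 x ⟨?_, Or.inr h10.le⟩
    · exact hy2U ((hz2.trans hzp2.le).trans (h3.2.resolve_right h21))
    · rcases h.total (inf_le_right : x ⊓ p0 ≤ p0) h10.le with h3 | h3
      · exact h3
      · exact absurd (h3.trans inf_le_left) hp1x

theorem collapseMap_mem {a b : X} (ha : IsUnboundedEnd R c a)
    (hb : IsUnboundedEnd R c b) (hab : a ≠ b) :
    collapseMap a b ∈ ellisSemigroup (X ≃ₜ X) X := by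
  rw [ellisSemigroup, mem_closure_iff_nhds]
  intro W hW
  rw [nhds_pi, Filter.mem_pi] at hW
  obtain ⟨I, hI, t, ht, htW⟩ := hW
  have hta : ∀ x, x ≠ b → t x ∈ 𝓝 a := fun x hx => by simpa [collapseMap, hx] using ht x
  have htb : t b ∈ 𝓝 b := by simpa [collapseMap] using ht b
  obtain ⟨Φ, h1, h2⟩ := h.exists_homeomorph_collapse ha hb hab
    -- The finitely many tested points other than `b` are removed from `V`, so that all of them are
    -- sent into `U`.
    (U := ⋂ x ∈ I \ {b}, t x) (V := t b ∩ (I \ {b})ᶜ)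
    ((Filter.biInter_mem hI.sdiff).2 fun x hx => hta x hx.2)
    (Filter.inter_mem htb (hI.sdiff.isClosed.isOpen_compl.mem_nhds (by simp)))
  refine ⟨fun x => Φ x, htW fun x hx => ?_, Φ, rfl⟩
  by_cases hxb : x = b
  · subst hxb
    exact h1.1
  · exact mem_iInter₂.1 (h2 x fun h3 => h3.2 ⟨hx, hxb⟩) x ⟨hx, hxb⟩

end IsColouredTree

theorem collapseMap_comp_self {X : Type*} {a b : X} (hab : a ≠ b) :
    collapseMap a b ∘ collapseMap a b = collapseMap a b := by
  funext x
  by_cases hx : x = b <;> simp [collapseMap, hx, hab]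

/-! ### Dynamical consequences of the collapse maps. -/

section dynamics

variable {X : Type*} [TopologicalSpace X] {A : Set X} (hA : ¬ A.Countable)
  (hE : ∀ a ∈ A, ∀ b ∈ A, a ≠ b → collapseMap a b ∈ ellisSemigroup (X ≃ₜ X) X)
include hA hE

/-- For `b` different from `a` and `x`, the map `p_{a,b}` sends `x` to `a`; homeomorphisms close to
it bring the orbit of `x` close to any `a ∈ A`. -/
theorem isMinimal_of_collapseMap (hdense : Dense A) : MulAction.IsMinimal (X ≃ₜ X) X := by
  refine ⟨fun x => dense_iff_inter_open.2 fun U hU hne => ?_⟩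
  obtain ⟨a, haU, ha⟩ := hdense.inter_open_nonempty U hU hne
  obtain ⟨b, hb, hbx⟩ : ∃ b ∈ A, b ∉ ({a, x} : Set X) := by
    by_contra! hcon
    exact hA ((toFinite _).countable.mono hcon)
  simp only [mem_insert_iff, mem_singleton_iff, not_or] at hbx
  have h1 := hE a ha b hb (Ne.symm hbx.1)
  rw [ellisSemigroup, mem_closure_iff] at h1
  obtain ⟨_, h2, g, rfl⟩ := h1 {f | f x ∈ U} (hU.preimage (continuous_apply x))
    (by simpa [collapseMap, Ne.symm hbx.2] using haU)
  exact ⟨g • x, h2, g, rfl⟩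

/-- A neighbourhood of the constant map `a` contains `p_{a,b}` for all but finitely many `b`. With a
countable base, some `b ∈ A` would have `p_{a,b}` in every neighbourhood, although evaluation at `b`
separates it from the constant. -/
theorem not_firstCountable_of_collapseMap [T2Space X] :
    ¬ FirstCountableTopology (ellisSemigroup (X ≃ₜ X) X) := by
  intro hfc
  obtain ⟨a, ha⟩ : A.Nonempty := by
    by_contra h1
    rw [not_nonempty_iff_eq_empty] at h1
    exact hA (h1 ▸ countable_empty)
  have hcol : ∀ {I : Set X} {t : X → Set X}, (∀ x, t x ∈ 𝓝 a) → ∀ b ∉ I,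
      collapseMap a b ∈ I.pi t := by
    intro I t ht b hb x hx
    have hxb : x ≠ b := fun h1 => hb (h1 ▸ hx)
    simpa [collapseMap, hxb] using mem_of_mem_nhds (ht x)
  have hconst : (fun _ => a) ∈ ellisSemigroup (X ≃ₜ X) X := by
    rw [ellisSemigroup, ← closure_closure, mem_closure_iff_nhds]
    intro W hW
    rw [nhds_pi, Filter.mem_pi] at hW
    obtain ⟨I, hI, t, ht, htW⟩ := hW
    obtain ⟨b, hb, hbI⟩ : ∃ b ∈ A, b ∉ insert a I := by
      by_contra! hcon
      exact hA ((hI.insert a).countable.mono hcon)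
    rw [mem_insert_iff, not_or] at hbI
    exact ⟨_, htW (hcol ht b hbI.2), hE a ha b hb (Ne.symm hbI.1)⟩
  let E := ellisSemigroup (X ≃ₜ X) X
  obtain ⟨V, hV⟩ := (𝓝 (⟨_, hconst⟩ : E)).exists_antitone_basis
  have hfin : ∀ n, ∃ I : Set X, I.Finite ∧ ∀ b ∉ I, ∀ hb : collapseMap a b ∈ E,
      (⟨_, hb⟩ : E) ∈ V n := by
    intro n
    obtain ⟨W, hW, hWV⟩ := (mem_nhds_subtype _ _ _).1 (hV.1.mem_of_mem (i := n) trivial)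
    rw [nhds_pi, Filter.mem_pi] at hW
    obtain ⟨I, hI, t, ht, htW⟩ := hW
    exact ⟨I, hI, fun b hb hbE => hWV (htW (hcol ht b hb))⟩
  choose I hI hIV using hfin
  obtain ⟨b, hb, hbI⟩ : ∃ b ∈ A, b ∉ insert a (⋃ n, I n) := by
    by_contra! hcon
    exact hA (((countable_iUnion fun n => (hI n).countable).insert a).mono hcon)
  rw [mem_insert_iff, not_or, mem_iUnion, not_exists] at hbI
  have hbE : collapseMap a b ∈ E := hE a ha b hb (Ne.symm hbI.1)
  have hopen : {f : E | f.1 b ≠ b} ∈ 𝓝 (⟨_, hconst⟩ : E) :=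
    (isOpen_compl_singleton.preimage ((continuous_apply b).comp continuous_subtype_val)).mem_nhds
      (Ne.symm hbI.1)
  obtain ⟨n, -, hn⟩ := hV.1.mem_iff.1 hopen
  exact hn (hIV n b (hbI.2 n) hbE) (by simp [collapseMap])

end dynamics

/-! ### Coordinates and meets on the inverse limit. -/

namespace ColouredDendrite

noncomputable instance : DecidableEq Leg := fun m n => Classical.propDecidable (m = n)

/-- The leg `m` can be attached to the leg `ℓ` at position `a`. -/
def IsChild (m ℓ : Leg) (a : unitInterval) : Prop := (∃ k, m = .red ℓ a k) ∨ m = .green ℓ a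

namespace IsChild

variable {m n ℓ ℓ' : Leg} {a a' : unitInterval}

theorem level_eq (h : IsChild m ℓ a) : m.level = ℓ.level + 1 := by
  rcases h with ⟨k, rfl⟩ | rfl <;> rfl

theorem point_eq (h : IsChild m ℓ a) (t : unitInterval) :
    m.point t = Function.update (ℓ.point a) m t := by
  rcases h with ⟨k, rfl⟩ | rfl <;> rfl

theorem unique (h : IsChild m ℓ a) (h' : IsChild m ℓ' a') : ℓ = ℓ' ∧ a = a' := by
  rcases h with ⟨k, rfl⟩ | rfl <;> rcases h' with ⟨k', h'⟩ | h' <;> cases h' <;> exact ⟨rfl, rfl⟩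

theorem valid {D : Fin 2 → Set unitInterval} (h : IsChild m ℓ a) (hm : m.Valid D) :
    ℓ.Valid D ∧ a ∈ D ℓ.kind ∧ 0 < a ∧ a < 1 := by
  have key : ∀ n : ℕ, (n / (n + 1) : ℝ) < a → (a : ℝ) < (n + 1) / (n + 2) → 0 < a ∧ a < 1 := by
    intro n h1 h2
    constructor
    · exact Subtype.coe_lt_coe.1 (lt_of_le_of_lt (by simp only [Set.Icc.coe_zero]; positivity) h1)
    · refine Subtype.coe_lt_coe.1 (lt_of_lt_of_le h2 ?_)
      rw [div_le_iff₀ (by positivity)]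
      simp
  rcases h with ⟨k, rfl⟩ | rfl
  · obtain ⟨n, h1, h2, -⟩ := hm.2.2
    exact ⟨hm.1, hm.2.1, key n h1 h2⟩
  · obtain ⟨n, h1, h2, -⟩ := hm.2.2
    exact ⟨hm.1, hm.2.1, key n h1 h2⟩

end IsChild

@[elab_as_elim]
theorem Leg.child_induction {P : Leg → Prop} (root : ∀ j, P (.root j))
    (child : ∀ m ℓ a, IsChild m ℓ a → P ℓ → P m) : ∀ m, P m
  | .root j => root j
  | .red ℓ _ k => child _ _ _ (Or.inl ⟨k, rfl⟩) (Leg.child_induction root child ℓ)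
  | .green ℓ _ => child _ _ _ (Or.inr rfl) (Leg.child_induction root child ℓ)

theorem Leg.exists_isChild {m : Leg} (h : 0 < m.level) : ∃ ℓ a, IsChild m ℓ a := by
  cases m with
  | root j => simp [Leg.level] at h
  | red ℓ a k => exact ⟨ℓ, a, Or.inl ⟨k, rfl⟩⟩
  | green ℓ a => exact ⟨ℓ, a, Or.inr rfl⟩

theorem Leg.point_self (m : Leg) (t : unitInterval) : m.point t m = t := by
  cases m <;> simp [Leg.point]

theorem Leg.point_of_ne {m n : Leg} (t s : unitInterval) (h : n ≠ m) :
    m.point t n = m.point s n := by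
  cases m <;> simp [Leg.point, h]

theorem Leg.point_of_level_eq {m n : Leg} (t : unitInterval) (hl : n.level = m.level)
    (h : n ≠ m) : m.point t n = 0 := by
  induction m using Leg.child_induction with
  | root j => simp [Leg.point, h]
  | child m ℓ a hm _ =>
    rw [hm.point_eq, Function.update_of_ne h]
    exact ℓ.point_eq_zero _ _ (by have := hm.level_eq; omega)

/-- The families of coordinates of the points of `X`. -/
structure IsCoherent (D : Fin 2 → Set unitInterval) (f : Leg → unitInterval) : Prop where
  valid : ∀ m, f m ≠ 0 → m.Valid D
  root : ∀ i j, f (.root i) ≠ 0 → f (.root j) ≠ 0 → i = j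
  child : ∀ m ℓ a, IsChild m ℓ a → f m ≠ 0 → f ℓ = a
  sibling : ∀ m n ℓ a, IsChild m ℓ a → IsChild n ℓ a → f m ≠ 0 → f n ≠ 0 → m = n

variable {D : Fin 2 → Set unitInterval}

theorem isCoherent_point {m : Leg} (hm : m.Valid D) (t : unitInterval) :
    IsCoherent D (m.point t) := by
  induction m using Leg.child_induction generalizing t with
  | root j =>
    have key : ∀ n, (Leg.root j).point t n ≠ 0 → n = .root j := by
      intro n hn
      by_contra h1
      simp [Leg.point, h1] at hn
    refine ⟨fun n hn => ?_, fun i i' hi hi' => ?_, fun n ℓ a hn hn' => ?_,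
      fun n n' ℓ a hn hn' h1 h2 => (key _ h1).trans (key _ h2).symm⟩
    · rw [key n hn]; trivial
    · have h1 := key _ hi
      have h2 := key _ hi'
      simp_all
    · have h1 := hn.level_eq
      rw [key _ hn'] at h1
      simp [Leg.level] at h1
  | child m ℓ a hmc ih =>
    have ih := ih (hmc.valid hm).1 a
    have hlev := hmc.level_eq
    have hz : ∀ n, ℓ.level < n.level → ℓ.point a n = 0 := fun n hn => ℓ.point_eq_zero n a hn
    have hle : ∀ n, ℓ.point a n ≠ 0 → n.level ≤ ℓ.level := by
      intro n hn
      by_contra h1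
      exact hn (hz n (by omega))
    rw [hmc.point_eq]
    set f := Function.update (ℓ.point a) m t with hf
    have hfn : ∀ n, n ≠ m → f n = ℓ.point a n := fun n hn => Function.update_of_ne hn _ _
    have hlow : ∀ n, n.level ≤ ℓ.level → f n = ℓ.point a n := by
      intro n hn
      exact hfn n (by rintro rfl; omega)
    refine ⟨fun n hn => ?_, fun i j hi hj => ?_, fun n ℓ' a' hn hn' => ?_,
      fun n n' ℓ' a' hn hn' h1 h2 => ?_⟩
    · by_cases h1 : n = m
      · exact h1 ▸ hm
      · exact ih.valid n (by rwa [← hfn n h1])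
    · rw [hlow _ (Nat.zero_le _)] at hi hj
      exact ih.root i j hi hj
    · have hlev' := hn.level_eq
      by_cases h1 : n = m
      · subst h1
        obtain ⟨rfl, rfl⟩ := hn.unique hmc
        rw [hlow _ le_rfl, Leg.point_self]
      · rw [hfn n h1] at hn'
        rw [hlow _ (by have := hle n hn'; omega)]
        exact ih.child n ℓ' a' hn hn'
    · have hlev1 := hn.level_eq
      have hlev2 := hn'.level_eq
      by_cases h3 : n = m <;> by_cases h4 : n' = m
      · rw [h3, h4]
      · rw [hfn n' h4] at h2
        have := hle n' h2
        rw [h3] at hlev1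
        omega
      · rw [hfn n h3] at h1
        have := hle n h1
        rw [h4] at hlev2
        omega
      · rw [hfn n h3] at h1
        rw [hfn n' h4] at h2
        exact ih.sibling n n' ℓ' a' hn hn' h1 h2

/-- A nonzero coordinate at `m` forces the coordinates at all ancestors of `m` to be the attaching
positions, and leaves no other nonzero coordinate up to its level. -/
theorem IsCoherent.eq_point {f : Leg → unitInterval} (hf : IsCoherent D f) {m : Leg}
    (hm : f m ≠ 0) {n : Leg} (hn : n.level ≤ m.level) : f n = m.point (f m) n := by
  by_cases hnm : n = m
  · rw [hnm, Leg.point_self]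
  induction m using Leg.child_induction generalizing n with
  | root j =>
    cases n with
    | root i =>
      have h1 : f (.root i) = 0 := by
        by_contra h1
        exact hnm (by rw [hf.root i j h1 hm])
      simp [Leg.point, h1, hnm]
    | red ℓ a k => simp [Leg.level] at hn
    | green ℓ a => simp [Leg.level] at hn
  | child m ℓ a hmc ih =>
    have hlev := hmc.level_eq
    have hℓ : f ℓ = a := hf.child m ℓ a hmc hm
    have ha := (hmc.valid (hf.valid m hm)).2.2.1
    have hℓ0 : f ℓ ≠ 0 := by rw [hℓ]; exact ha.ne'
    have ih' : ∀ n, n.level ≤ ℓ.level → f n = ℓ.point a n := by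
      intro n hn
      by_cases h1 : n = ℓ
      · rw [h1, hℓ, Leg.point_self]
      · rw [ih hℓ0 hn h1, hℓ]
    rw [hmc.point_eq, Function.update_of_ne hnm]
    by_cases h1 : n.level ≤ ℓ.level
    · exact ih' n h1
    rw [ℓ.point_eq_zero _ _ (not_le.1 h1)]
    by_contra hn0
    obtain ⟨ℓ', a', hnc⟩ := Leg.exists_isChild (m := n) (by omega)
    have hlev' := hnc.level_eq
    -- A second nonzero leg on the level of `m` has a parent with nonzero coordinate, which must be
    -- `ℓ`; then the sibling condition applies.
    have h2 := hf.child n ℓ' a' hnc hn0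
    have ha' := (hnc.valid (hf.valid n hn0)).2.2.1
    have h3 : ℓ' = ℓ := by
      by_contra h3
      rw [ih' ℓ' (by omega), Leg.point_of_level_eq _ (by omega) h3] at h2
      exact ha'.ne h2
    subst h3
    rw [h2] at hℓ
    subst hℓ
    exact hnm (hf.sibling n m ℓ' a' hnc hmc hn0 hm)

theorem IsCoherent.trunc_mem {f : Leg → unitInterval} (hf : IsCoherent D f) (i : ℕ) :
    trunc i f ∈ stage D i := by
  by_cases hex : ∃ m : Leg, m.level ≤ i ∧ f m ≠ 0
  · have hne : {l | ∃ m : Leg, m.level ≤ i ∧ f m ≠ 0 ∧ m.level = l}.Nonempty :=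
      ⟨_, hex.choose, hex.choose_spec.1, hex.choose_spec.2, rfl⟩
    have hbdd : BddAbove {l | ∃ m : Leg, m.level ≤ i ∧ f m ≠ 0 ∧ m.level = l} := by
      refine ⟨i, ?_⟩
      rintro _ ⟨m, hm, -, rfl⟩
      exact hm
    obtain ⟨m, hmi, hm, hml⟩ := Nat.sSup_mem hne hbdd
    refine ⟨m, hf.valid m hm, hmi, f m, ?_⟩
    funext n
    by_cases hn : n.level ≤ m.level
    · rw [← hf.eq_point hm hn]
      simp [trunc, hn.trans hmi]
    · rw [m.point_eq_zero _ _ (not_le.1 hn)]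
      by_cases hni : n.level ≤ i
      · by_contra hn0
        simp only [trunc, hni, if_true] at hn0
        exact hn (hml ▸ le_csSup hbdd ⟨n, hni, hn0, rfl⟩)
      · simp [trunc, hni]
  · push Not at hex
    refine ⟨.root 0, trivial, Nat.zero_le _, 0, ?_⟩
    funext n
    have : (Leg.root 0).point 0 n = 0 := by simp [Leg.point]
    rw [this]
    by_cases hni : n.level ≤ i
    · simp [trunc, hni, hex n hni]
    · simp [trunc, hni]

/-- The coordinate of a point of `X` belonging to the leg `m`. -/
noncomputable def coord (x : Limit D) (m : Leg) : unitInterval := (x.1 m.level).1 m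

theorem trunc_coord (x : Limit D) (i : ℕ) : (x.1 i).1 = trunc i (coord x) := by
  have hb : ∀ j, (x.1 j).1 = trunc j (x.1 (j + 1)).1 := fun j =>
    congrArg Subtype.val (x.2 j).symm
  funext m
  by_cases hm : m.level ≤ i
  · simp only [trunc, hm, if_true, coord]
    induction i, hm using Nat.le_induction with
    | base => rfl
    | succ j hj ih =>
      rw [← ih, hb j]
      simp [trunc, hj]
  · rw [hb i]
    simp [trunc, hm]

theorem coord_injective : Function.Injective (coord : Limit D → Leg → unitInterval) := by
  intro x y hxy
  refine Subtype.ext (funext fun i => Subtype.ext ?_)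
  rw [trunc_coord, trunc_coord, hxy]

theorem le_iff_coord {x y : Limit D} : x ≤ y ↔ ∀ m, coord x m ≤ coord y m := by
  constructor
  · intro h m
    exact h m.level m
  · intro h i m
    change (x.1 i).1 m ≤ (y.1 i).1 m
    rw [trunc_coord, trunc_coord]
    by_cases hm : m.level ≤ i
    · simpa [trunc, hm] using h m
    · simp [trunc, hm]

theorem isCoherent_coord (x : Limit D) : IsCoherent D (coord x) := by
  have key : ∀ i, ∃ f, IsCoherent D f ∧ ∀ m : Leg, m.level ≤ i → f m = coord x m := by
    intro i
    obtain ⟨ℓ, hℓ, -, t, ht⟩ := (x.1 i).2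
    refine ⟨_, isCoherent_point hℓ t, fun m hm => ?_⟩
    rw [← ht, trunc_coord]
    simp [trunc, hm]
  refine ⟨fun m hm => ?_, fun i j hi hj => ?_, fun m ℓ a hm hm0 => ?_,
    fun m n ℓ a hm hn hm0 hn0 => ?_⟩
  · obtain ⟨f, hf, hfx⟩ := key m.level
    exact hf.valid m (by rwa [hfx m le_rfl])
  · obtain ⟨f, hf, hfx⟩ := key 0
    exact hf.root i j (by rwa [hfx _ le_rfl]) (by rwa [hfx _ le_rfl])
  · obtain ⟨f, hf, hfx⟩ := key m.level
    rw [← hfx ℓ (by have := hm.level_eq; omega)]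
    exact hf.child m ℓ a hm (by rwa [hfx m le_rfl])
  · obtain ⟨f, hf, hfx⟩ := key m.level
    exact hf.sibling m n ℓ a hm hn (by rwa [hfx m le_rfl])
      (by rwa [hfx n (by rw [hn.level_eq, hm.level_eq])])

/-- The point of `X` with given coordinates. -/
noncomputable def ofCoord (f : Leg → unitInterval) (hf : IsCoherent D f) : Limit D :=
  ⟨fun i => ⟨trunc i f, hf.trunc_mem i⟩, fun i => by
    apply Subtype.ext
    funext m
    by_cases hm : m.level ≤ i
    · simp [bond, trunc, hm, Nat.le_succ_of_le hm]
    · simp [bond, trunc, hm]⟩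

@[simp]
theorem coord_ofCoord (f : Leg → unitInterval) (hf : IsCoherent D f) :
    coord (ofCoord f hf) = f := by
  funext m
  simp [coord, ofCoord, trunc]

@[simp]
theorem coord_legPoint (ℓ : Leg) (hℓ : ℓ.Valid D) (t : unitInterval) :
    coord (legPoint D ℓ hℓ t) = ℓ.point t := by
  funext m
  simp [coord, legPoint, trunc]

theorem isCoherent_zero : IsCoherent D 0 :=
  ⟨by simp, by simp, by simp, by simp⟩

theorem IsCoherent.inf {f g : Leg → unitInterval} (hf : IsCoherent D f) (hg : IsCoherent D g) :
    IsCoherent D (f ⊓ g) := by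
  have key : ∀ m, (f ⊓ g) m ≠ 0 → f m ≠ 0 ∧ g m ≠ 0 := by
    intro m hm
    have h1 : 0 < f m ⊓ g m := lt_of_le_of_ne unitInterval.nonneg' hm.symm
    exact ⟨(h1.trans_le inf_le_left).ne', (h1.trans_le inf_le_right).ne'⟩
  refine ⟨fun m hm => hf.valid m (key m hm).1, fun i j hi hj => hf.root i j (key _ hi).1 (key _ hj).1,
    fun m ℓ a hm hm0 => ?_, fun m n ℓ a hm hn hm0 hn0 =>
    hf.sibling m n ℓ a hm hn (key _ hm0).1 (key _ hn0).1⟩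
  rw [Pi.inf_apply, hf.child m ℓ a hm (key m hm0).1, hg.child m ℓ a hm (key m hm0).2, inf_idem]

noncomputable instance : SemilatticeInf (Limit D) where
  __ := (inferInstance : PartialOrder (Limit D))
  inf x y := ofCoord (coord x ⊓ coord y) ((isCoherent_coord x).inf (isCoherent_coord y))
  inf_le_left x y := le_iff_coord.2 fun m => by simp
  inf_le_right x y := le_iff_coord.2 fun m => by simp
  le_inf x y z hy hz := le_iff_coord.2 fun m => by
    simp [le_iff_coord.1 hy m, le_iff_coord.1 hz m]

noncomputable instance : OrderBot (Limit D) where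
  bot := ofCoord 0 isCoherent_zero
  bot_le x := le_iff_coord.2 fun m => by simp

@[simp]
theorem coord_inf (x y : Limit D) (m : Leg) : coord (x ⊓ y) m = coord x m ⊓ coord y m :=
  congrFun (coord_ofCoord _ ((isCoherent_coord x).inf (isCoherent_coord y))) m

@[simp]
theorem coord_bot (m : Leg) : coord (⊥ : Limit D) m = 0 :=
  congrFun (coord_ofCoord _ isCoherent_zero) m

theorem continuous_coord : Continuous (coord : Limit D → Leg → unitInterval) :=
  continuous_pi fun m => (continuous_apply m).comp
    (continuous_subtype_val.comp ((continuous_apply m.level).comp continuous_subtype_val))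

theorem continuous_ofCoord {Y : Type*} [TopologicalSpace Y] {f : Y → Leg → unitInterval}
    (hf : Continuous f) (hc : ∀ y, IsCoherent D (f y)) :
    Continuous fun y => ofCoord (f y) (hc y) := by
  refine Continuous.subtype_mk (continuous_pi fun i => Continuous.subtype_mk
    (continuous_pi fun m => ?_) _) _
  by_cases hm : m.level ≤ i
  · simpa [trunc, hm] using (continuous_pi_iff.1 hf m)
  · simpa [trunc, hm] using continuous_const

/-- Each condition says that some coordinate vanishes or that a closed equation holds. Compactness
of the limit follows. -/
theorem isClosed_isCoherent : IsClosed {f | IsCoherent D f} := by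
  have hz : ∀ m, IsClosed {f : Leg → unitInterval | f m = 0} := fun m =>
    isClosed_eq (continuous_apply m) continuous_const
  have himp : ∀ m (p : Prop), IsClosed {f : Leg → unitInterval | f m ≠ 0 → p} := by
    intro m p
    by_cases hp : p
    · simp only [hp, implies_true]
      exact isClosed_const
    · simpa [hp] using hz m
  have heq : {f | IsCoherent D f} = {f | ∀ m, f m ≠ 0 → m.Valid D} ∩
      ({f | ∀ i j, f (.root i) ≠ 0 → f (.root j) ≠ 0 → i = j} ∩
      ({f | ∀ m ℓ a, IsChild m ℓ a → f m ≠ 0 → f ℓ = a} ∩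
      {f | ∀ m n ℓ a, IsChild m ℓ a → IsChild n ℓ a → f m ≠ 0 → f n ≠ 0 → m = n})) := by
    ext f
    exact ⟨fun h => ⟨h.1, h.2, h.3, h.4⟩, fun h => ⟨h.1, h.2.1, h.2.2.1, h.2.2.2⟩⟩
  have himp2 : ∀ m n (p : Prop), IsClosed {f : Leg → unitInterval | f m ≠ 0 → f n ≠ 0 → p} := by
    intro m n p
    have : {f : Leg → unitInterval | f m ≠ 0 → f n ≠ 0 → p} =
        {f | f m = 0} ∪ {f | f n ≠ 0 → p} := by
      ext f; simp only [mem_union, mem_ofPred_eq]; tauto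
    rw [this]
    exact (hz m).union (himp n p)
  rw [heq]
  refine IsClosed.inter ?_ (IsClosed.inter ?_ (IsClosed.inter ?_ ?_))
  · simp only [ofPred_forall]
    exact isClosed_iInter fun m => himp m _
  · simp only [ofPred_forall]
    exact isClosed_iInter fun i => isClosed_iInter fun j => himp2 _ _ _
  · simp only [ofPred_forall]
    refine isClosed_iInter fun m => isClosed_iInter fun ℓ => isClosed_iInter fun a =>
      isClosed_iInter fun _ => ?_
    have : {f : Leg → unitInterval | f m ≠ 0 → f ℓ = a} = {f | f m = 0} ∪ {f | f ℓ = a} := by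
      ext f; simp only [mem_union, mem_ofPred_eq]; tauto
    rw [this]
    exact (hz m).union (isClosed_eq (continuous_apply ℓ) continuous_const)
  · simp only [ofPred_forall]
    refine isClosed_iInter fun m => isClosed_iInter fun n => isClosed_iInter fun ℓ =>
      isClosed_iInter fun a => isClosed_iInter fun _ => isClosed_iInter fun _ => himp2 _ _ _

instance : CompactSpace (Limit D) := by
  have hK : CompactSpace (Subtype (IsCoherent D)) :=
    isCompact_iff_compactSpace.1 isClosed_isCoherent.isCompact
  have hs : Function.Surjective fun f : Subtype (IsCoherent D) => (ofCoord f.1 f.2 : Limit D) := by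
    intro x
    exact ⟨⟨coord x, isCoherent_coord x⟩, coord_injective (coord_ofCoord _ _)⟩
  exact hs.compactSpace (continuous_ofCoord continuous_subtype_val fun f => f.2)

theorem continuous_inf : Continuous fun z : Limit D × Limit D => z.1 ⊓ z.2 :=
  continuous_ofCoord (continuous_pi fun m =>
    ((continuous_apply m).comp (continuous_coord.comp continuous_fst)).inf
      ((continuous_apply m).comp (continuous_coord.comp continuous_snd))) fun z =>
      (isCoherent_coord z.1).inf (isCoherent_coord z.2)

end ColouredDendrite

/-! ### The tree order, height and metrizability of the limit. -/

namespace ColouredDendrite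

variable {D : Fin 2 → Set unitInterval}

theorem valid_root (j : Fin 4) : (Leg.root j).Valid D := trivial

theorem exists_coord_lt {x y : Limit D} (h : ¬ y ≤ x) : ∃ m, coord x m < coord y m := by
  by_contra! hcon
  exact h (le_iff_coord.2 hcon)

/-- Suppose `y` exceeds `z` at `m`, and `z` exceeds `y` at `n`, with `n` not deeper than `m`. Since
`x` and `y` are both nonzero at `m`, they agree at `n ≠ m`, which contradicts `z ≤ x`. -/
theorem le_total_of_le {x y z : Limit D} (hy : y ≤ x) (hz : z ≤ x) : y ≤ z ∨ z ≤ y := by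
  by_contra! hcon
  obtain ⟨m, hm⟩ := exists_coord_lt hcon.1
  obtain ⟨n, hn⟩ := exists_coord_lt hcon.2
  have key : ∀ {y z : Limit D}, y ≤ x → z ≤ x → ∀ {m n : Leg}, n.level ≤ m.level →
      coord z m < coord y m → coord y n < coord z n → False := by
    intro y z hy hz m n hl hm hn
    have hym : coord y m ≠ 0 := (lt_of_le_of_lt unitInterval.nonneg' hm).ne'
    have hxm : coord x m ≠ 0 :=
      ((lt_of_le_of_lt unitInterval.nonneg' hm).trans_le (le_iff_coord.1 hy m)).ne'
    by_cases hnm : n = m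
    · subst hnm
      exact lt_asymm hm hn
    · have h1 := le_iff_coord.1 hz n
      rw [(isCoherent_coord x).eq_point hxm hl, Leg.point_of_ne _ (coord y m) hnm,
        ← (isCoherent_coord y).eq_point hym hl] at h1
      exact hn.not_ge h1
  rcases le_total n.level m.level with hl | hl
  · exact key hy hz hl hm hn
  · exact key hz hy hl hn hm

theorem legPoint_le_iff {m : Leg} (hm : m.Valid D) {s : unitInterval} (hs : s ≠ 0)
    {y : Limit D} : legPoint D m hm s ≤ y ↔ s ≤ coord y m := by
  constructor
  · intro h
    have := le_iff_coord.1 h m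
    rwa [coord_legPoint, Leg.point_self] at this
  · intro h
    have hym : coord y m ≠ 0 := (lt_of_lt_of_le (unitInterval.pos_iff_ne_zero.2 hs) h).ne'
    refine le_iff_coord.2 fun n => ?_
    rw [coord_legPoint]
    by_cases hnm : n = m
    · rwa [hnm, Leg.point_self]
    by_cases hl : n.level ≤ m.level
    · rw [(isCoherent_coord y).eq_point hym hl, Leg.point_of_ne _ (coord y m) hnm]
    · rw [m.point_eq_zero _ _ (not_le.1 hl)]
      exact unitInterval.nonneg'

theorem legPoint_between {x y : Limit D} (hxy : x ≤ y) {m : Leg} (hm : m.Valid D)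
    {s : unitInterval} (h1 : coord x m < s) (h2 : s < coord y m) :
    x < legPoint D m hm s ∧ legPoint D m hm s < y := by
  have hs : s ≠ 0 := (lt_of_le_of_lt unitInterval.nonneg' h1).ne'
  have h3 : legPoint D m hm s ≤ y := (legPoint_le_iff hm hs).2 h2.le
  have h4 : ¬ legPoint D m hm s ≤ x := fun h => h1.not_ge ((legPoint_le_iff hm hs).1 h)
  refine ⟨lt_of_le_of_ne ((le_total_of_le hxy h3).resolve_right h4) fun h => h4 h.ge,
    lt_of_le_of_ne h3 fun h => ?_⟩
  rw [← h, coord_legPoint, Leg.point_self] at h2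
  exact h2.false

theorem valid_of_coord_lt {x y : Limit D} {m : Leg} (h : coord x m < coord y m) : m.Valid D :=
  (isCoherent_coord y).valid m (lt_of_le_of_lt unitInterval.nonneg' h).ne'

theorem countable_valid (hcountable : ∀ i, (D i).Countable) : {m : Leg | m.Valid D}.Countable := by
  have key : ∀ n, {m : Leg | m.Valid D ∧ m.level = n}.Countable := by
    intro n
    induction n with
    | zero =>
      refine (countable_range Leg.root).mono ?_
      rintro m ⟨-, hl⟩
      cases m with
      | root j => exact ⟨j, rfl⟩
      | red ℓ a k => simp [Leg.level] at hl
      | green ℓ a => simp [Leg.level] at hl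
    | succ n ih =>
      refine (ih.biUnion fun ℓ _ => (hcountable ℓ.kind).biUnion fun a _ =>
        ((countable_range fun k => Leg.red ℓ a k).union
          (countable_singleton (Leg.green ℓ a)))).mono ?_
      rintro m ⟨hm, hl⟩
      obtain ⟨ℓ, a, hc⟩ := Leg.exists_isChild (m := m) (by omega)
      have hv := hc.valid hm
      refine mem_iUnion₂.2 ⟨ℓ, ⟨hv.1, by have := hc.level_eq; omega⟩,
        mem_iUnion₂.2 ⟨a, hv.2.1, ?_⟩⟩
      rcases hc with ⟨k, rfl⟩ | rfl
      · exact Or.inl ⟨k, rfl⟩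
      · exact Or.inr rfl
  refine (countable_iUnion key).mono fun m hm => ?_
  exact mem_iUnion.2 ⟨m.level, hm, rfl⟩

/-- A weighted sum over the countably many valid legs. Coordinates of invalid legs vanish, so a
strict inequality is always visible in the sum. -/
theorem exists_height (hcountable : ∀ i, (D i).Countable) :
    ∃ ρ : Limit D → ℝ, Continuous ρ ∧ StrictMono ρ := by
  have : Countable {m : Leg // m.Valid D} := (countable_valid hcountable).to_subtype
  cases nonempty_encodable {m : Leg // m.Valid D}
  have hsum := summable_geometric_two_encode (ι := {m : Leg // m.Valid D})
  have hle : ∀ (x : Limit D) (v : {m : Leg // m.Valid D}),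
      (1 / 2 : ℝ) ^ Encodable.encode v * (coord x v : ℝ) ≤ (1 / 2 : ℝ) ^ Encodable.encode v :=
    fun x v => mul_le_of_le_one_right (by positivity) (coord x v).2.2
  have hnn : ∀ (x : Limit D) (v : {m : Leg // m.Valid D}),
      0 ≤ (1 / 2 : ℝ) ^ Encodable.encode v * (coord x v : ℝ) :=
    fun x v => mul_nonneg (by positivity) (coord x v).2.1
  have hsx : ∀ x : Limit D, Summable fun v : {m : Leg // m.Valid D} =>
      (1 / 2 : ℝ) ^ Encodable.encode v * (coord x v : ℝ) := fun x =>
    Summable.of_nonneg_of_le (hnn x) (hle x) hsum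
  refine ⟨fun x => ∑' v : {m : Leg // m.Valid D},
    (1 / 2 : ℝ) ^ Encodable.encode v * (coord x v : ℝ), ?_, ?_⟩
  · refine continuous_tsum (fun v => ?_) hsum fun v x => ?_
    · exact continuous_const.mul (continuous_subtype_val.comp
        (continuous_pi_iff.1 continuous_coord v))
    · rw [Real.norm_of_nonneg (hnn x v)]
      exact hle x v
  · intro x y hxy
    obtain ⟨m, hm⟩ := exists_coord_lt hxy.not_ge
    refine Summable.tsum_lt_tsum (i := ⟨m, valid_of_coord_lt hm⟩) (fun v => ?_) ?_ (hsx x) (hsx y)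
    · exact mul_le_mul_of_nonneg_left (le_iff_coord.1 hxy.le v) (by positivity)
    · exact mul_lt_mul_of_pos_left hm (by positivity)

theorem metrizableSpace (hcountable : ∀ i, (D i).Countable) :
    TopologicalSpace.MetrizableSpace (Limit D) := by
  have : Countable {m : Leg // m.Valid D} := (countable_valid hcountable).to_subtype
  let f : Limit D → {m : Leg // m.Valid D} → unitInterval := fun x v => coord x v
  have hf : Continuous f := continuous_pi fun v => continuous_pi_iff.1 continuous_coord v
  have hinj : Function.Injective f := by
    intro x y hxy
    refine coord_injective (funext fun m => ?_)
    by_cases hm : m.Valid D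
    · exact congrFun hxy ⟨m, hm⟩
    · have h0 : ∀ x : Limit D, coord x m = 0 := fun x => by
        by_contra h1
        exact hm ((isCoherent_coord x).valid m h1)
      rw [h0, h0]
  exact (hf.isClosedEmbedding hinj).isEmbedding.metrizableSpace

theorem isTreeOrder (hcountable : ∀ i, (D i).Countable) : IsTreeOrder (Limit D) where
  continuous_inf := continuous_inf
  total := le_total_of_le
  dense := by
    intro x y hxy
    obtain ⟨m, hm⟩ := exists_coord_lt hxy.not_ge
    obtain ⟨s, h1, h2⟩ := exists_between hm
    exact ⟨_, legPoint_between hxy.le (valid_of_coord_lt hm) h1 h2⟩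
  height := exists_height hcountable

/-! ### Points of the legs -/

theorem eq_legPoint_of_le {m : Leg} (hm : m.Valid D) {t : unitInterval} {x : Limit D}
    (hx : x ≤ legPoint D m hm t) (h0 : coord x m ≠ 0) : x = legPoint D m hm (coord x m) := by
  refine coord_injective (funext fun n => ?_)
  rw [coord_legPoint]
  by_cases hl : n.level ≤ m.level
  · exact (isCoherent_coord x).eq_point h0 hl
  · have := le_iff_coord.1 hx n
    rw [coord_legPoint, m.point_eq_zero _ _ (not_le.1 hl)] at this
    rw [m.point_eq_zero _ _ (not_le.1 hl)]
    exact le_antisymm this unitInterval.nonneg'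

theorem le_base_of_le {m ℓ : Leg} {a : unitInterval} (hc : IsChild m ℓ a) (hm : m.Valid D)
    {t : unitInterval} {x : Limit D} (hx : x ≤ legPoint D m hm t) (h0 : coord x m = 0) :
    x ≤ legPoint D ℓ (hc.valid hm).1 a := by
  refine le_iff_coord.2 fun n => ?_
  by_cases hn : n = m
  · rw [hn, h0]
    exact unitInterval.nonneg'
  · have := le_iff_coord.1 hx n
    rw [coord_legPoint, hc.point_eq, Function.update_of_ne hn] at this
    rwa [coord_legPoint]

theorem eq_bot_of_le_root {j : Fin 4} {hm : (Leg.root j).Valid D} {t : unitInterval} {x : Limit D}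
    (hx : x ≤ legPoint D (.root j) hm t) (h0 : coord x (.root j) = 0) : x = ⊥ := by
  refine le_bot_iff.1 (le_iff_coord.2 fun n => ?_)
  by_cases hn : n = .root j
  · rw [hn, h0]
    exact unitInterval.nonneg'
  · have := le_iff_coord.1 hx n
    simpa [Leg.point, hn] using this

theorem eq_legPoint_of_le' {m : Leg} (hm : m.Valid D) {t : unitInterval} {x : Limit D}
    (hx : x ≤ legPoint D m hm t) (hbot : x ≠ ⊥) :
    ∃ n, ∃ hn : n.Valid D, ∃ s, 0 < s ∧ x = legPoint D n hn s := by
  induction m using Leg.child_induction generalizing t with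
  | root j =>
    by_cases h0 : coord x (.root j) = 0
    · exact absurd (eq_bot_of_le_root hx h0) hbot
    · exact ⟨_, hm, _, unitInterval.pos_iff_ne_zero.2 h0, eq_legPoint_of_le hm hx h0⟩
  | child m ℓ a hc ih =>
    by_cases h0 : coord x m = 0
    · exact ih _ (le_base_of_le hc hm hx h0)
    · exact ⟨_, hm, _, unitInterval.pos_iff_ne_zero.2 h0, eq_legPoint_of_le hm hx h0⟩

/-- Below a point `y` there are only points of the finitely many legs leading to a coordinate where
`y` exceeds `x`; points on no leg are therefore maximal. -/
theorem eq_legPoint_of_lt {x y : Limit D} (hxy : x < y) (hbot : x ≠ ⊥) :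
    ∃ n, ∃ hn : n.Valid D, ∃ s, 0 < s ∧ x = legPoint D n hn s := by
  obtain ⟨m, hm⟩ := exists_coord_lt hxy.not_ge
  have h0 : coord y m ≠ 0 := (lt_of_le_of_lt unitInterval.nonneg' hm).ne'
  have hv := valid_of_coord_lt hm
  have h1 : legPoint D m hv (coord y m) ≤ y := (legPoint_le_iff hv h0).2 le_rfl
  refine eq_legPoint_of_le' hv ((le_total_of_le hxy.le h1).resolve_right fun h2 => ?_) hbot
  exact hm.not_ge ((legPoint_le_iff hv h0).1 h2)

theorem legPoint_inj {m n : Leg} {hm : m.Valid D} {hn : n.Valid D} {s t : unitInterval}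
    (hs : 0 < s) (ht : 0 < t) (h : legPoint D m hm s = legPoint D n hn t) : m = n ∧ s = t := by
  have h1 : m.point s = n.point t := by rw [← coord_legPoint m hm, h, coord_legPoint]
  have key : ∀ {m n : Leg} {s t : unitInterval}, 0 < s → m.point s = n.point t →
      m.level ≤ n.level := by
    intro m n s t hs h1
    by_contra hl
    have h2 := congrFun h1 m
    rw [Leg.point_self, n.point_eq_zero _ _ (not_le.1 hl)] at h2
    exact hs.ne' h2
  have hmn : m = n := by
    by_contra hne
    have h2 := congrFun h1 m
    rw [Leg.point_self, Leg.point_of_level_eq _ (le_antisymm (key hs h1) (key ht h1.symm)) hne]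
      at h2
    exact hs.ne' h2
  subst hmn
  refine ⟨rfl, ?_⟩
  rw [← Leg.point_self m s, h1, Leg.point_self]

theorem exists_child_of_level_lt (x : Limit D) {m n : Leg} (hm : coord x m ≠ 0)
    (hn : coord x n ≠ 0) (hl : m.level < n.level) :
    ∃ n', IsChild n' m (coord x m) ∧ coord x n' ≠ 0 := by
  have hx := isCoherent_coord x
  induction n using Leg.child_induction with
  | root j => simp [Leg.level] at hl
  | child n ℓ a hc ih =>
    have hlev := hc.level_eq
    have hℓ := hx.child n ℓ a hc hn
    have ha := (hc.valid (hx.valid n hn)).2.2.1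
    by_cases h1 : m.level < ℓ.level
    · exact ih (by rw [hℓ]; exact ha.ne') h1
    have hmℓ : ℓ = m := by
      by_contra h2
      rw [hx.eq_point hm (by omega), Leg.point_of_level_eq _ (by omega) h2] at hℓ
      exact ha.ne hℓ
    subst hmℓ
    exact ⟨n, by rwa [hℓ], hn⟩

/-- What lies above a point of a leg. -/
theorem lt_coord_or_exists_child {m : Leg} {hm : m.Valid D} {t : unitInterval} (ht : 0 < t)
    {x : Limit D} (h : legPoint D m hm t < x) :
    t < coord x m ∨ ∃ n, IsChild n m t ∧ coord x n ≠ 0 := by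
  have h1 := (legPoint_le_iff hm ht.ne').1 h.le
  rcases h1.lt_or_eq with h2 | h2
  · exact Or.inl h2
  have h0 : coord x m ≠ 0 := h2 ▸ ht.ne'
  obtain ⟨n, hn⟩ := exists_coord_lt h.not_ge
  rw [coord_legPoint] at hn
  have hl : m.level < n.level := by
    by_contra hl
    rw [(isCoherent_coord x).eq_point h0 (not_lt.1 hl), ← h2] at hn
    exact hn.false
  obtain ⟨n', h3, h4⟩ := exists_child_of_level_lt x h0
    (lt_of_le_of_lt unitInterval.nonneg' hn).ne' hl
  exact Or.inr ⟨n', h2 ▸ h3, h4⟩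

theorem exists_root_of_ne_bot {x : Limit D} (hx : x ≠ ⊥) : ∃ j, coord x (.root j) ≠ 0 := by
  have h1 : ¬ x ≤ ⊥ := fun h => hx (le_bot_iff.1 h)
  obtain ⟨n, hn⟩ := exists_coord_lt h1
  have hn : coord x n ≠ 0 := (lt_of_le_of_lt unitInterval.nonneg' hn).ne'
  induction n using Leg.child_induction with
  | root j => exact ⟨j, hn⟩
  | child n ℓ a hc ih =>
    have hc' := hc.valid ((isCoherent_coord x).valid n hn)
    have hℓ := (isCoherent_coord x).child n ℓ a hc hn
    refine ih ?_ ?_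
    · rw [hℓ, coord_bot]
      exact hc'.2.2.1
    · rw [hℓ]
      exact hc'.2.2.1.ne'

theorem legPoint_lt_of_child {m n : Leg} {t : unitInterval} (hc : IsChild n m t) {x : Limit D}
    (hn : coord x n ≠ 0) {hm : m.Valid D} : legPoint D m hm t < x := by
  have hx := isCoherent_coord x
  have ht := (hc.valid (hx.valid n hn)).2.2.1
  refine lt_of_le_of_ne ((legPoint_le_iff hm ht.ne').2 (hx.child n m t hc hn).ge) fun h1 => hn ?_
  rw [← h1, coord_legPoint, m.point_eq_zero _ _ (by rw [hc.level_eq]; omega)]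

end ColouredDendrite

/-! ### Counting directions -/

section labels

variable {X ι : Type*} [SemilatticeInf X] {p : X} {Q : ι → X → Prop}

/-- The directions leading up from `p` are given by the labels `Q`. -/
structure IsUpLabelling (p : X) (Q : ι → X → Prop) : Prop where
  exists_label : ∀ x, p < x → ∃ i, Q i x
  lt : ∀ i x, Q i x → p < x
  inf : ∀ i x y, Q i (x ⊓ y) ↔ Q i x ∧ Q i y
  unique : ∀ i j x, Q i x → Q j x → i = j
  nonempty : ∀ i, ∃ x, Q i x

theorem IsUpLabelling.iff (h : IsUpLabelling p Q) {x y : X} (hx : p < x) (hy : p < y) :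
    (∃ i, Q i x ∧ Q i y) ↔ ¬ OnPath x p y := by
  constructor
  · rintro ⟨i, hi⟩ h1
    exact (h.lt i _ ((h.inf i x y).2 hi)).not_ge h1.1
  · intro h1
    have h2 : p < x ⊓ y := lt_of_le_of_ne (le_inf hx.le hy.le) fun h3 =>
      h1 ⟨h3.ge, Or.inl hx.le⟩
    obtain ⟨i, hi⟩ := h.exists_label _ h2
    exact ⟨i, (h.inf i x y).1 hi⟩

theorem hasDirections_of_card [Fintype ι] {n : ℕ} (hn : Fintype.card ι = n) (f : X → ι)
    (hf : ∀ x y, x ≠ p → y ≠ p → (f x = f y ↔ ¬ OnPath x p y)) (hs : ∀ i, ∃ x, x ≠ p ∧ f x = i) :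
    HasDirections p n := by
  let e := Fintype.equivFinOfCardEq hn
  refine ⟨fun x => e (f x), fun x y hx hy => by rw [e.injective.eq_iff, hf x y hx hy], fun i => ?_⟩
  obtain ⟨x, hx, hxi⟩ := hs (e.symm i)
  exact ⟨x, hx, by simp [hxi]⟩

theorem IsUpLabelling.exists_fun (h : IsUpLabelling p Q) :
    ∃ g : X → Option ι, (∀ x, ¬ p < x → g x = none) ∧
      (∀ x, p < x → ∃ i, g x = some i ∧ Q i x) := by
  classical
  refine ⟨fun x => if hx : p < x then some (h.exists_label x hx).choose else none,
    fun x hx => by simp [hx], fun x hx => ⟨_, by simp only [hx, dif_pos],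
      (h.exists_label x hx).choose_spec⟩⟩

theorem IsUpLabelling.hasDirections_bot [OrderBot X] [Fintype ι] {Q : ι → X → Prop}
    (h : IsUpLabelling (⊥ : X) Q) [Nonempty ι] : HasDirections (⊥ : X) (Fintype.card ι) := by
  have hex : ∀ x : X, ∃ i, x ≠ ⊥ → Q i x := by
    intro x
    by_cases hx : x = ⊥
    · exact ⟨Classical.arbitrary ι, fun h1 => absurd hx h1⟩
    · obtain ⟨i, hi⟩ := h.exists_label x (bot_lt_iff_ne_bot.2 hx)
      exact ⟨i, fun _ => hi⟩
  choose f hf using hex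
  refine hasDirections_of_card rfl f (fun x y hx hy => ?_) fun i => ?_
  · rw [← h.iff (bot_lt_iff_ne_bot.2 hx) (bot_lt_iff_ne_bot.2 hy)]
    constructor
    · intro h1
      exact ⟨f x, hf x hx, h1 ▸ hf y hy⟩
    · rintro ⟨i, h1, h2⟩
      rw [h.unique _ _ _ (hf x hx) h1, h.unique _ _ _ (hf y hy) h2]
  · obtain ⟨x, hx⟩ := h.nonempty i
    have hx0 := bot_lt_iff_ne_bot.1 (h.lt i x hx)
    exact ⟨x, hx0, h.unique _ _ _ (hf x hx0) hx⟩

/-- The extra direction is the downward one, containing `⊥` and labelled `none`. -/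
theorem IsUpLabelling.hasDirections [OrderBot X] [Fintype ι]
    (htotal : ∀ {x y z : X}, y ≤ x → z ≤ x → y ≤ z ∨ z ≤ y) (h : IsUpLabelling p Q)
    (hp : p ≠ ⊥) : HasDirections p (Fintype.card ι + 1) := by
  obtain ⟨f, hf1, hf2⟩ := h.exists_fun
  have hmixed : ∀ {x y : X}, p < x → ¬ p ≤ y → x ⊓ y ≤ p := by
    intro x y hx hy
    exact (htotal inf_le_left hx.le).resolve_right fun h1 => hy (h1.trans inf_le_right)
  refine hasDirections_of_card (by simp) f (fun x y hx hy => ?_) fun i => ?_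
  · have hlt : ∀ {x : X}, x ≠ p → ¬ p < x → ¬ p ≤ x := fun h1 h2 h3 =>
      h2 (lt_of_le_of_ne h3 h1.symm)
    by_cases hpx : p < x <;> by_cases hpy : p < y
    · rw [← h.iff hpx hpy]
      obtain ⟨i, hi, hix⟩ := hf2 x hpx
      obtain ⟨j, hj, hjy⟩ := hf2 y hpy
      rw [hi, hj, Option.some_inj]
      constructor
      · rintro rfl
        exact ⟨i, hix, hjy⟩
      · rintro ⟨k, h1, h2⟩
        rw [h.unique _ _ _ hix h1, h.unique _ _ _ hjy h2]
    · obtain ⟨i, hi, hix⟩ := hf2 x hpx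
      rw [hi, hf1 y hpy]
      exact iff_of_false (by simp) (not_not.2 ⟨hmixed hpx (hlt hy hpy), Or.inl hpx.le⟩)
    · obtain ⟨i, hi, hix⟩ := hf2 y hpy
      rw [hi, hf1 x hpx]
      refine iff_of_false (by simp) (not_not.2 ⟨?_, Or.inr hpy.le⟩)
      rw [inf_comm]
      exact hmixed hpy (hlt hx hpx)
    · rw [hf1 x hpx, hf1 y hpy]
      exact iff_of_true rfl fun h1 => h1.2.elim (hlt hx hpx) (hlt hy hpy)
  · rcases i with _ | i
    · exact ⟨⊥, hp.symm, hf1 _ not_lt_bot⟩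
    · obtain ⟨x, hx⟩ := h.nonempty i
      have hpx := h.lt i x hx
      obtain ⟨j, hj, hjx⟩ := hf2 x hpx
      exact ⟨x, hpx.ne', by rw [hj, h.unique _ _ _ hjx hx]⟩

end labels

namespace ColouredDendrite

variable {D : Fin 2 → Set unitInterval}

theorem inf_ne_zero_iff {s t : unitInterval} : s ⊓ t ≠ 0 ↔ s ≠ 0 ∧ t ≠ 0 := by
  simp only [← unitInterval.pos_iff_ne_zero, lt_inf_iff]

theorem hasDirections_bot : HasDirections (⊥ : Limit D) 4 := by
  have h : IsUpLabelling (⊥ : Limit D) fun (j : Fin 4) x => coord x (.root j) ≠ 0 := by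
    refine ⟨fun x hx => exists_root_of_ne_bot hx.ne', fun j x hj => bot_lt_iff_ne_bot.2 ?_,
      fun j x y => ?_, fun i j x hi hj => (isCoherent_coord x).root i j hi hj, fun j => ?_⟩
    · rintro rfl
      exact hj (coord_bot _)
    · rw [coord_inf, inf_ne_zero_iff]
    · exact ⟨legPoint D (.root j) (valid_root j) 1, by rw [coord_legPoint, Leg.point_self]; simp⟩
  exact h.hasDirections_bot

/-- The `k` attached legs, the continuation of `m` (label `none`) and the downward direction make `k
+ 2`. -/
theorem hasDirections_legPoint {m : Leg} (hm : m.Valid D) {t : unitInterval} (h0 : 0 < t)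
    (h1 : t < 1) {k : ℕ} (ch : Fin k → Leg) (hch : ∀ i, IsChild (ch i) m t)
    (hv : ∀ i, (ch i).Valid D) (hinj : Function.Injective ch)
    (hall : ∀ n, IsChild n m t → n.Valid D → ∃ i, n = ch i) :
    HasDirections (legPoint D m hm t) (k + 2) := by
  have hbot : legPoint D m hm t ≠ ⊥ := fun h => by
    have := congrFun (congrArg coord h) m
    rw [coord_legPoint, Leg.point_self, coord_bot] at this
    exact h0.ne' this
  let Q : Option (Fin k) → Limit D → Prop := fun o x =>
    o.elim (t < coord x m) fun i => coord x (ch i) ≠ 0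
  have h : IsUpLabelling (legPoint D m hm t) Q := by
    refine ⟨fun x hx => ?_, ?_, ?_, ?_, ?_⟩
    · rcases lt_coord_or_exists_child h0 hx with h2 | ⟨n, h2, h3⟩
      · exact ⟨none, h2⟩
      · obtain ⟨i, rfl⟩ := hall n h2 ((isCoherent_coord x).valid n h3)
        exact ⟨some i, h3⟩
    · rintro (_ | i) x hx
      · refine lt_of_le_of_ne ((legPoint_le_iff hm h0.ne').2 (le_of_lt hx)) ?_
        rintro rfl
        change t < coord _ m at hx
        rw [coord_legPoint, Leg.point_self] at hx
        exact hx.false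
      · exact legPoint_lt_of_child (hch i) hx
    · rintro (_ | i) x y
      · change t < coord (x ⊓ y) m ↔ _
        rw [coord_inf, lt_inf_iff]
        rfl
      · change coord (x ⊓ y) (ch i) ≠ 0 ↔ _
        rw [coord_inf, inf_ne_zero_iff]
        rfl
    · have key : ∀ i x, Q none x → Q (some i) x → False := by
        intro i x hx hi
        have := (isCoherent_coord x).child _ m t (hch i) hi
        exact (show t < coord x m from hx).ne' this
      rintro (_ | i) (_ | j) x hi hj
      · rfl
      · exact (key j x hi hj).elim
      · exact (key i x hj hi).elim
      · rw [hinj ((isCoherent_coord x).sibling _ _ m t (hch i) (hch j) hi hj)]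
    · rintro (_ | i)
      · refine ⟨legPoint D m hm 1, ?_⟩
        change t < coord _ m
        rwa [coord_legPoint, Leg.point_self]
      · refine ⟨legPoint D (ch i) (hv i) 1, ?_⟩
        change coord _ (ch i) ≠ 0
        rw [coord_legPoint, Leg.point_self]
        simp
  have := h.hasDirections le_total_of_le hbot
  simpa using this

end ColouredDendrite

namespace ColouredDendrite

/-! ### Counting the changes of colour -/

/-- The number of the interval `[n / (n + 1), (n + 1) / (n + 2))` containing `t`. -/
noncomputable def interval (t : unitInterval) : ℕ := ⌊(t : ℝ) / (1 - t)⌋₊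

/-- `t / (1 - t)` increases and takes the value `j` at `j / (j + 1)`. At `t = 1` division by zero
would give `0`, whence `ht`. -/
theorem le_interval_iff {t : unitInterval} (ht : t < 1) {j : ℕ} :
    j ≤ interval t ↔ (j / (j + 1) : ℝ) ≤ t := by
  have h1 : (0 : ℝ) < 1 - t := sub_pos.2 ht
  rw [interval, Nat.le_floor_iff (div_nonneg t.2.1 h1.le), le_div_iff₀ h1,
    div_le_iff₀ (by positivity)]
  constructor <;> intro h <;> linarith

theorem interval_lt {t : unitInterval} (ht : t < 1) {j : ℕ} :
    interval t < j + 1 ↔ (t : ℝ) < (j + 1) / (j + 2) := by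
  rw [← not_le, le_interval_iff ht, not_le]
  push_cast
  rw [show (j : ℝ) + 1 + 1 = j + 2 by ring]

theorem interval_eq {t : unitInterval} {j : ℕ} (h1 : (j / (j + 1) : ℝ) ≤ t)
    (h2 : (t : ℝ) < (j + 1) / (j + 2)) : interval t = j := by
  have ht : t < 1 := by
    refine Subtype.coe_lt_coe.1 (h2.trans_le ?_)
    rw [div_le_iff₀ (by positivity)]
    simp
  have := (le_interval_iff ht).2 h1
  have := (interval_lt ht).2 h2
  omega

theorem interval_mono {s t : unitInterval} (hst : s ≤ t) (ht : t < 1) :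
    interval s ≤ interval t := by
  rw [le_interval_iff ht]
  exact ((le_interval_iff (hst.trans_lt ht)).1 le_rfl).trans hst

/-- The point `n / (n + 1)`. -/
noncomputable def barrier (n : ℕ) : unitInterval :=
  ⟨n / (n + 1), by positivity, (div_le_one₀ (by positivity)).2 (by simp)⟩

theorem barrier_lt (n : ℕ) : barrier n < barrier (n + 1) := by
  refine Subtype.coe_lt_coe.1 ?_
  simp only [barrier]
  rw [div_lt_div_iff₀ (by positivity) (by positivity)]
  push_cast
  nlinarith

theorem coe_barrier_succ (n : ℕ) : ((barrier (n + 1) : unitInterval) : ℝ) = (n + 1) / (n + 2) := by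
  simp only [barrier]
  push_cast
  rw [show (n : ℝ) + 1 + 1 = n + 2 by ring]

variable {D : Fin 2 → Set unitInterval}

theorem exists_mem_interval (hdense : ∀ i, Dense (D i)) (i : Fin 2) {u v : unitInterval} {j : ℕ}
    (huv : u < v) (hu : u < barrier (j + 1)) (hv : barrier j < v) :
    ∃ s ∈ D i, u < s ∧ s < v ∧ s < 1 ∧ interval s = j := by
  obtain ⟨s, hs, h1, h2⟩ := (hdense i).exists_between
    (show max u (barrier j) < min v (barrier (j + 1)) from
      max_lt (lt_min huv hu) (lt_min hv (barrier_lt j)))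
  rw [max_lt_iff] at h1
  rw [lt_min_iff] at h2
  refine ⟨s, hs, h1.1, h2.1, h2.1.trans_le unitInterval.le_one', interval_eq h1.2.le ?_⟩
  rw [← coe_barrier_succ]
  exact h2.2

section parity

variable (havoid : ∀ i, ∀ a ∈ D i, ∀ n : ℕ, (a : ℝ) ≠ n / (n + 1))
include havoid

theorem interval_spec {i : Fin 2} {t : unitInterval} (ht : t ∈ D i) (ht1 : t < 1) :
    ((interval t : ℝ) / (interval t + 1)) < t ∧ (t : ℝ) < (interval t + 1) / (interval t + 2) :=
  ⟨lt_of_le_of_ne ((le_interval_iff ht1).1 le_rfl) (havoid i t ht _).symm,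
    (interval_lt ht1).1 (Nat.lt_succ_self _)⟩

theorem pos_of_mem {i : Fin 2} {t : unitInterval} (ht : t ∈ D i) : 0 < t := by
  refine unitInterval.pos_iff_ne_zero.2 ?_
  rintro rfl
  exact havoid i 0 ht 0 (by simp)

theorem isRed_iff {i : Fin 2} {t : unitInterval} (ht : t ∈ D i) (ht1 : t < 1) :
    IsRed i t ↔ Even (interval t + i) := by
  constructor
  · rintro ⟨n, h1, h2, h3⟩
    rwa [interval_eq h1.le h2]
  · intro h
    obtain ⟨h1, h2⟩ := interval_spec havoid ht ht1
    exact ⟨_, h1, h2, h⟩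

theorem isGreen_iff {i : Fin 2} {t : unitInterval} (ht : t ∈ D i) (ht1 : t < 1) :
    IsGreen i t ↔ Odd (interval t + i) := by
  constructor
  · rintro ⟨n, h1, h2, h3⟩
    rwa [interval_eq h1.le h2]
  · intro h
    obtain ⟨h1, h2⟩ := interval_spec havoid ht ht1
    exact ⟨_, h1, h2, h⟩

end parity

/-- The number of changes of colour on the way from `⊥` to the beginning of a leg. -/
noncomputable def Leg.count : Leg → ℕ
  | .root _ => 0
  | .red ℓ a _ => ℓ.count + interval a
  | .green ℓ a => ℓ.count + interval a

theorem IsChild.count_eq {m ℓ : Leg} {a : unitInterval} (h : IsChild m ℓ a) :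
    m.count = ℓ.count + interval a := by
  rcases h with ⟨k, rfl⟩ | rfl <;> rfl

/-- Colour does not change at a branching: a leg of kind `0` starts red at a red point, one of kind
`1` starts green at a green point. -/
theorem even_count_iff (havoid : ∀ i, ∀ a ∈ D i, ∀ n : ℕ, (a : ℝ) ≠ n / (n + 1)) {m : Leg}
    (hm : m.Valid D) : Even m.count ↔ Even (m.kind : ℕ) := by
  induction m with
  | root j => simp [Leg.count, Leg.kind]
  | red ℓ a k ih =>
    have hc : IsChild (.red ℓ a k) ℓ a := Or.inl ⟨k, rfl⟩
    have h1 := (isRed_iff havoid hm.2.1 (hc.valid hm).2.2.2).1 hm.2.2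
    have h2 := ih hm.1
    simp only [Leg.count, Leg.kind, Nat.even_add] at *
    simp only [h2, Fin.val_zero, Even.zero, iff_true]
    tauto
  | green ℓ a ih =>
    have hc : IsChild (.green ℓ a) ℓ a := Or.inr rfl
    have h1 := (isGreen_iff havoid hm.2.1 (hc.valid hm).2.2.2).1 hm.2.2
    have h2 := ih hm.1
    rw [← Nat.not_even_iff_odd] at h1
    simp only [Leg.count, Leg.kind, Nat.even_add] at *
    simp only [h2, Fin.val_one, Nat.not_even_one, iff_false]
    tauto

/-- The number of changes of colour on the way from `⊥` to a point of a leg. -/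
noncomputable def count (x : Limit D) : ℕ :=
  sSup {k | ∃ m, ∃ hm : m.Valid D, ∃ s, 0 < s ∧ x = legPoint D m hm s ∧ k = m.count + interval s}

/-- At a positive position the leg and the position are unique, so the set in the definition of
`count` is a singleton. -/
theorem count_legPoint {m : Leg} (hm : m.Valid D) {s : unitInterval} (hs : 0 < s) :
    count (legPoint D m hm s) = m.count + interval s := by
  have : {k | ∃ n, ∃ hn : n.Valid D, ∃ t, 0 < t ∧ legPoint D m hm s = legPoint D n hn t ∧
      k = n.count + interval t} = {m.count + interval s} := by
    ext k
    constructor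
    · rintro ⟨n, hn, t, ht, h1, rfl⟩
      obtain ⟨rfl, rfl⟩ := legPoint_inj hs ht h1
      rfl
    · rintro rfl
      exact ⟨m, hm, s, hs, rfl, rfl⟩
  rw [count, this, csSup_singleton]

theorem legPoint_ne_bot {m : Leg} {hm : m.Valid D} {s : unitInterval} (hs : 0 < s) :
    legPoint D m hm s ≠ ⊥ := by
  intro h
  have := congrFun (congrArg coord h) m
  rw [coord_legPoint, Leg.point_self, coord_bot] at this
  exact hs.ne' this

theorem count_bot : count (⊥ : Limit D) = 0 := by
  have : {k | ∃ m, ∃ hm : m.Valid D, ∃ s, 0 < s ∧ (⊥ : Limit D) = legPoint D m hm s ∧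
      k = m.count + interval s} = ∅ := by
    rw [eq_empty_iff_forall_notMem]
    rintro k ⟨m, hm, s, hs, h, -⟩
    exact legPoint_ne_bot hs h.symm
  rw [count, this]
  simp

/-- The ramification points of `X`. -/
def ramificationPoints (D : Fin 2 → Set unitInterval) : Set (Limit D) :=
  {x | x = ⊥ ∨ ∃ m, ∃ hm : m.Valid D, ∃ s ∈ D m.kind, 0 < s ∧ s < 1 ∧ x = legPoint D m hm s}

theorem IsChild.base_mem {m ℓ : Leg} {a : unitInterval} (hc : IsChild m ℓ a) (hm : m.Valid D) :
    legPoint D ℓ (hc.valid hm).1 a ∈ ramificationPoints D :=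
  Or.inr ⟨ℓ, _, a, (hc.valid hm).2.1, (hc.valid hm).2.2.1, (hc.valid hm).2.2.2, rfl⟩

theorem count_base {m ℓ : Leg} {a : unitInterval} (hc : IsChild m ℓ a) (hm : m.Valid D) :
    count (legPoint D ℓ (hc.valid hm).1 a) = m.count := by
  rw [count_legPoint _ (hc.valid hm).2.2.1, hc.count_eq]

/-- Induction towards the root: the coordinate at an ancestor is an attaching position, whose
interval is already included in the count of the next leg. -/
theorem count_le_of_le_point {m n : Leg} (hn : n.Valid D) {s t : unitInterval} (hs : s < 1)
    (ht : 0 < t) (h : t ≤ n.point s m) : m.count + interval t ≤ n.count + interval s := by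
  induction n using Leg.child_induction generalizing s with
  | root j =>
    by_cases hm : m = .root j
    · subst hm
      rw [Leg.point_self] at h
      exact Nat.add_le_add_left (interval_mono h hs) _
    · simp only [Leg.point, Function.update_of_ne hm] at h
      exact absurd ht h.not_gt
  | child n ℓ a hc ih =>
    by_cases hm : m = n
    · subst hm
      rw [Leg.point_self] at h
      exact Nat.add_le_add_left (interval_mono h hs) _
    · rw [hc.point_eq, Function.update_of_ne hm] at h
      have := ih (hc.valid hn).1 (hc.valid hn).2.2.2 h
      rw [hc.count_eq]
      omega

theorem count_mono {p q : Limit D} (hp : p ∈ ramificationPoints D)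
    (hq : q ∈ ramificationPoints D) (hpq : p ≤ q) : count p ≤ count q := by
  rcases hp with rfl | ⟨m, hm, t, -, ht, -, rfl⟩
  · rw [count_bot]
    exact Nat.zero_le _
  rcases hq with rfl | ⟨n, hn, s, -, hs, hs1, rfl⟩
  · exact absurd (le_bot_iff.1 hpq) (legPoint_ne_bot ht)
  rw [count_legPoint _ ht, count_legPoint _ hs]
  rw [legPoint_le_iff _ ht.ne', coord_legPoint] at hpq
  exact count_le_of_le_point hn hs1 ht hpq

theorem lt_barrier_of_interval_le {t : unitInterval} (ht : t < 1) {j : ℕ} (h : interval t ≤ j) :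
    t < barrier (j + 1) := by
  refine Subtype.coe_lt_coe.1 ?_
  rw [coe_barrier_succ]
  exact (interval_lt ht).1 (Nat.lt_succ_of_le h)

theorem barrier_lt_of_le_interval (havoid : ∀ i, ∀ a ∈ D i, ∀ n : ℕ, (a : ℝ) ≠ n / (n + 1))
    {i : Fin 2} {t : unitInterval} (hti : t ∈ D i) (ht : t < 1) {j : ℕ} (h : j ≤ interval t) :
    barrier j < t :=
  Subtype.coe_lt_coe.1 (lt_of_le_of_ne ((le_interval_iff ht).1 h) (havoid i t hti j).symm)

theorem legPoint_lt_legPoint {m : Leg} {hm : m.Valid D} {s t : unitInterval} (hst : s < t) :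
    legPoint D m hm s < legPoint D m hm t := by
  have hle : legPoint D m hm s ≤ legPoint D m hm t := by
    refine le_iff_coord.2 fun n => ?_
    rw [coord_legPoint, coord_legPoint]
    by_cases hn : n = m
    · rw [hn, Leg.point_self, Leg.point_self]
      exact hst.le
    · exact (Leg.point_of_ne _ _ hn).le
  refine lt_of_le_of_ne hle fun h => ?_
  have := congrFun (congrArg coord h) m
  rw [coord_legPoint, coord_legPoint, Leg.point_self, Leg.point_self] at this
  exact hst.ne this

theorem legPoint_zero {m ℓ : Leg} {a : unitInterval} (hc : IsChild m ℓ a) (hm : m.Valid D) :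
    legPoint D m hm 0 = legPoint D ℓ (hc.valid hm).1 a := by
  apply coord_injective
  rw [coord_legPoint, coord_legPoint, hc.point_eq]
  refine Function.update_eq_self_iff.2 ?_
  rw [ℓ.point_eq_zero _ _ (by rw [hc.level_eq]; omega)]

section axioms

variable (hdense : ∀ i, Dense (D i))
  (havoid : ∀ i, ∀ a ∈ D i, ∀ n : ℕ, (a : ℝ) ≠ n / (n + 1))
include hdense havoid

theorem exists_between_on_leg {p : Limit D} {i : ℕ} {n : Leg}
    (hn : n.Valid D) {s t : unitInterval} (hsD : s ∈ D n.kind) (hs1 : s < 1)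
    (hpt : p ≤ legPoint D n hn t) (hts : t < s) (h2 : i ≤ n.count + interval s)
    (h3 : n.count + interval t ≤ i) :
    ∃ g ∈ ramificationPoints D, p < g ∧ g < legPoint D n hn s ∧ count g = i := by
  obtain ⟨u, hu, h5, h6, h7, h8⟩ := exists_mem_interval hdense n.kind hts
    (lt_barrier_of_interval_le (j := i - n.count) (hts.trans hs1) (by omega))
    (barrier_lt_of_le_interval havoid hsD hs1 (j := i - n.count) (by omega))
  have hu0 := pos_of_mem havoid hu
  exact ⟨_, Or.inr ⟨n, hn, u, hu, hu0, h7, rfl⟩, hpt.trans_lt (legPoint_lt_legPoint h5),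
    legPoint_lt_legPoint h6, by rw [count_legPoint _ hu0, h8]; omega⟩

/-- If `p` is not on `n`, values from `n.count` on are found on `n` itself; smaller ones lie before
the point where `n` is attached, and the search moves to the parent leg. -/
theorem exists_between_count {p : Limit D} {i : ℕ} {n : Leg}
    (hn : n.Valid D) {s : unitInterval} (hsD : s ∈ D n.kind) (hs1 : s < 1)
    (hpq : p < legPoint D n hn s) (h1 : count p ≤ i) (h2 : i ≤ n.count + interval s) :
    ∃ g ∈ ramificationPoints D, p < g ∧ g < legPoint D n hn s ∧ count g = i := by
  have hz : interval 0 = 0 := by simp [interval]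
  have hs0 := pos_of_mem havoid hsD
  by_cases h0 : coord p n = 0
  · induction n using Leg.child_induction generalizing s with
    | root j =>
      have hb := eq_bot_of_le_root hpq.le h0
      exact exists_between_on_leg hdense havoid hn hsD hs1 (t := 0) (hb ▸ bot_le) hs0 h2
        (by rw [hz]; exact Nat.zero_le _)
    | child n ℓ a hc ih =>
      have hle := le_base_of_le hc hn hpq.le h0
      have hv := hc.valid hn
      by_cases h3 : n.count ≤ i
      · exact exists_between_on_leg hdense havoid hn hsD hs1 (t := 0)
          (by rwa [legPoint_zero hc hn]) hs0 h2 (by rw [hz]; exact h3)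
      have hb := count_base hc hn
      have hlt : p < legPoint D ℓ hv.1 a := lt_of_le_of_ne hle fun h4 => by
        rw [h4, hb] at h1; omega
      have hlt2 : legPoint D ℓ hv.1 a < legPoint D n hn s := by
        rw [← legPoint_zero hc hn]
        exact legPoint_lt_legPoint hs0
      have hcount := hc.count_eq
      suffices h5 : ∃ g ∈ ramificationPoints D, p < g ∧ g < legPoint D ℓ hv.1 a ∧ count g = i by
        obtain ⟨g, hg, h6, h7, h8⟩ := h5
        exact ⟨g, hg, h6, h7.trans hlt2, h8⟩
      by_cases h0' : coord p ℓ = 0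
      · exact ih hv.1 hv.2.1 hv.2.2.2 hlt (by omega) hv.2.2.1 h0'
      · have h5 := eq_legPoint_of_le hv.1 hlt.le h0'
        have h6 : count p = ℓ.count + interval (coord p ℓ) := by
          conv_lhs => rw [h5]
          exact count_legPoint _ (unitInterval.pos_iff_ne_zero.2 h0')
        refine exists_between_on_leg hdense havoid hv.1 hv.2.1 hv.2.2.2 h5.le ?_ (by omega)
          (by omega)
        by_contra h7
        exact hlt.not_ge ((legPoint_le_iff _ hv.2.2.1.ne').2 (not_lt.1 h7))
  · have h5 := eq_legPoint_of_le hn hpq.le h0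
    have h6 : count p = n.count + interval (coord p n) := by
      conv_lhs => rw [h5]
      exact count_legPoint _ (unitInterval.pos_iff_ne_zero.2 h0)
    refine exists_between_on_leg hdense havoid hn hsD hs1 h5.le ?_ h2 (by omega)
    by_contra h7
    exact hpq.not_ge ((legPoint_le_iff _ hs0.ne').2 (not_lt.1 h7))

/-- From `p` some leg leads towards `y`, either the leg of `p` itself or one starting at `p`. It
crosses all later barriers, so any larger count occurs on it, possibly past the point where `y`
leaves it. -/
theorem exists_above_count {p y : Limit D} {i : ℕ} (hp : p ∈ ramificationPoints D) (hpy : p < y)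
    (hi : count p ≤ i) :
    ∃ g ∈ ramificationPoints D, p < g ∧ p < g ⊓ y ∧ count g = i := by
  have key : ∀ {m : Leg} (hm : m.Valid D) {t : unitInterval}, t < 1 → t < coord y m →
      p = legPoint D m hm t → m.count + interval t ≤ i →
      ∃ g ∈ ramificationPoints D, p < g ∧ p < g ⊓ y ∧ count g = i := by
    rintro m hm t ht1 hty rfl h1
    obtain ⟨u, hu, h2, -, h3, h4⟩ := exists_mem_interval hdense m.kind ht1
      (lt_barrier_of_interval_le (j := i - m.count) ht1 (by omega))
      (show barrier (i - m.count) < 1 from (barrier_lt _).trans_le unitInterval.le_one')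
    have hu0 := pos_of_mem havoid hu
    refine ⟨_, Or.inr ⟨m, hm, u, hu, hu0, h3, rfl⟩, legPoint_lt_legPoint h2, ?_, ?_⟩
    · refine lt_of_le_of_ne (le_inf (legPoint_lt_legPoint h2).le hpy.le) fun h5 => ?_
      have := congrFun (congrArg coord h5) m
      rw [coord_inf, coord_legPoint, coord_legPoint, Leg.point_self, Leg.point_self] at this
      exact (lt_inf_iff.2 ⟨h2, hty⟩).ne this
    · rw [count_legPoint _ hu0, h4]
      omega
  have hz : interval 0 = 0 := by simp [interval]
  rcases hp with rfl | ⟨m, hm, t, htD, ht, ht1, rfl⟩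
  · obtain ⟨j, hj⟩ := exists_root_of_ne_bot hpy.ne'
    refine key (valid_root j) (t := 0) (by simp) (unitInterval.pos_iff_ne_zero.2 hj) ?_ ?_
    · apply coord_injective
      rw [coord_legPoint]
      funext m
      simp [Leg.point]
    · rw [hz]; exact Nat.zero_le _
  · rw [count_legPoint _ ht] at hi
    rcases lt_coord_or_exists_child ht hpy with h1 | ⟨n, hc, hn⟩
    · exact key hm ht1 h1 rfl hi
    · have hv := (isCoherent_coord y).valid n hn
      refine key hv (t := 0) (by simp) (unitInterval.pos_iff_ne_zero.2 hn)
        (legPoint_zero hc hv).symm ?_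
      rw [hz, hc.count_eq]
      exact hi

omit hdense in
theorem hasDirections_of_red {m : Leg} (hm : m.Valid D) {t : unitInterval} (ht : t ∈ D m.kind)
    (h0 : 0 < t) (h1 : t < 1) (hred : IsRed m.kind t) :
    HasDirections (legPoint D m hm t) 4 := by
  refine hasDirections_legPoint hm h0 h1 (fun k : Fin 2 => .red m t k) (fun k => Or.inl ⟨k, rfl⟩)
    (fun k => ⟨hm, ht, hred⟩) (fun k k' h => by cases h; rfl) ?_
  rintro n (⟨k, rfl⟩ | rfl) hn
  · exact ⟨k, rfl⟩
  · have h2 := (isGreen_iff havoid ht h1).1 hn.2.2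
    exact absurd ((isRed_iff havoid ht h1).1 hred) (Nat.not_even_iff_odd.2 h2)

omit hdense in
theorem hasDirections_of_green {m : Leg} (hm : m.Valid D) {t : unitInterval} (ht : t ∈ D m.kind)
    (h0 : 0 < t) (h1 : t < 1) (hgreen : IsGreen m.kind t) :
    HasDirections (legPoint D m hm t) 3 := by
  refine hasDirections_legPoint hm h0 h1 (fun _ : Fin 1 => .green m t) (fun _ => Or.inr rfl)
    (fun _ => ⟨hm, ht, hgreen⟩) (fun k k' _ => Subsingleton.elim _ _) ?_
  rintro n (⟨k, rfl⟩ | rfl) hn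
  · have h2 := (isRed_iff havoid ht h1).1 hn.2.2
    exact absurd h2 (Nat.not_even_iff_odd.2 ((isGreen_iff havoid ht h1).1 hgreen))
  · exact ⟨0, rfl⟩

omit hdense havoid in
theorem hasDirections_of_not_mem {m : Leg} (hm : m.Valid D) {t : unitInterval} (ht : t ∉ D m.kind)
    (h0 : 0 < t) (h1 : t < 1) : HasDirections (legPoint D m hm t) 2 :=
  hasDirections_legPoint hm h0 h1 (fun k : Fin 0 => k.elim0) (fun k => k.elim0)
    (fun k => k.elim0) (fun k => k.elim0) fun _ hc hn => absurd (hc.valid hn).2.1 ht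

omit hdense in
theorem isRed_or_isGreen {i : Fin 2} {t : unitInterval} (ht : t ∈ D i) (ht1 : t < 1) :
    IsRed i t ∨ IsGreen i t := by
  rw [isRed_iff havoid ht ht1, isGreen_iff havoid ht ht1]
  exact Nat.even_or_odd _

omit hdense in
theorem even_count_legPoint {m : Leg} (hm : m.Valid D) {t : unitInterval} (ht : t ∈ D m.kind)
    (h1 : t < 1) : Even (count (legPoint D m hm t)) ↔ IsRed m.kind t := by
  rw [count_legPoint hm (pos_of_mem havoid ht), isRed_iff havoid ht h1, Nat.even_add,
    Nat.even_add, even_count_iff havoid hm]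
  tauto

omit hdense in
theorem hasDirections_of_mem {p : Limit D} (hp : p ∈ ramificationPoints D) :
    HasDirections p (if Even (count p) then 4 else 3) := by
  rcases hp with rfl | ⟨m, hm, t, htD, ht, ht1, rfl⟩
  · rw [count_bot, if_pos (by simp)]
    exact hasDirections_bot
  · split_ifs with hev
    · exact hasDirections_of_red havoid hm htD ht ht1 ((even_count_legPoint havoid hm htD ht1).1 hev)
    · exact hasDirections_of_green havoid hm htD ht ht1
        ((isRed_or_isGreen havoid htD ht1).resolve_left fun hr =>
          hev ((even_count_legPoint havoid hm htD ht1).2 hr))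

theorem isColouredTree (hcountable : ∀ i, (D i).Countable) :
    IsColouredTree (Limit D) (ramificationPoints D) count where
  toIsTreeOrder := isTreeOrder hcountable
  countable := by
    have : Countable {m : Leg // m.Valid D} := (countable_valid hcountable).to_subtype
    refine ((countable_singleton ⊥).union (countable_iUnion fun m : {m : Leg // m.Valid D} =>
      (hcountable m.1.kind).image (legPoint D m.1 m.2))).mono ?_
    rintro x (rfl | ⟨m, hm, s, hs, -, -, rfl⟩)
    · exact Or.inl rfl
    · exact Or.inr (mem_iUnion.2 ⟨⟨m, hm⟩, s, hs, rfl⟩)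
  bot_mem := Or.inl rfl
  count_bot := count_bot
  inf_mem := by
    intro x y hxy hyx
    have hx : x ⊓ y < x := lt_of_le_of_ne inf_le_left fun h => hxy (inf_eq_left.1 h)
    have hy : x ⊓ y < y := lt_of_le_of_ne inf_le_right fun h => hyx (inf_eq_right.1 h)
    by_cases hbot : x ⊓ y = ⊥
    · exact Or.inl hbot
    obtain ⟨m, hm, t, ht, he⟩ := eq_legPoint_of_lt hx hbot
    -- If both `x` and `y` continued along `m`, their meet would be farther along; so one of them
    -- leaves through an attached leg.
    have hchild : ∃ n, IsChild n m t ∧ n.Valid D := by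
      rcases lt_coord_or_exists_child ht (he ▸ hx) with h1 | ⟨n, h1, h2⟩
      · rcases lt_coord_or_exists_child ht (he ▸ hy) with h3 | ⟨n, h3, h4⟩
        · have h5 := coord_inf x y m
          rw [he, coord_legPoint, Leg.point_self] at h5
          exact absurd h5 (lt_inf_iff.2 ⟨h1, h3⟩).ne
        · exact ⟨n, h3, (isCoherent_coord y).valid n h4⟩
      · exact ⟨n, h1, (isCoherent_coord x).valid n h2⟩
    obtain ⟨n, hc, hn⟩ := hchild
    rw [he]
    exact hc.base_mem hn
  mono := count_mono
  between := by
    intro p q i hp hq hpq h1 h2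
    rcases hq with rfl | ⟨n, hn, s, hs, hs0, hs1, rfl⟩
    · exact absurd hpq not_lt_bot
    · rw [count_legPoint hn hs0] at h2
      exact exists_between_count hdense havoid hn hs hs1 hpq h1 h2
  above := exists_above_count hdense havoid
  dirs := hasDirections_of_mem havoid
  disjoint := by
    intro p hp
    obtain ⟨j, hj⟩ := exists_root_of_ne_bot hp
    obtain ⟨j', hj'⟩ := exists_ne j
    refine ⟨legPoint D (.root j') (valid_root j') 1, legPoint_ne_bot (by simp), ?_⟩
    refine eq_bot_of_le_root (hm := valid_root j') inf_le_left ?_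
    rw [coord_inf]
    by_contra h
    exact hj' ((isCoherent_coord p).root _ _ (inf_ne_zero_iff.1 h).2 hj)
  exists_mem := by
    intro x y hxy
    obtain ⟨m, hm⟩ := exists_coord_lt hxy.not_ge
    obtain ⟨s, hs, h1, h2⟩ := (hdense m.kind).exists_between hm
    have hv := valid_of_coord_lt hm
    exact ⟨_, Or.inr ⟨m, hv, s, hs, pos_of_mem havoid hs, h2.trans_le unitInterval.le_one', rfl⟩,
      legPoint_between hxy.le hv h1 h2⟩
  mem_of_order := by
    intro x hx
    have h := isTreeOrder hcountable
    by_cases hbot : x = ⊥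
    · exact Or.inl hbot
    by_cases hmax : IsMax x
    · rw [h.pointOrder_eq (IsTreeOrder.hasDirections_one hmax hbot)] at hx
      norm_num at hx
    obtain ⟨y, hxy⟩ := not_isMax_iff.1 hmax
    obtain ⟨m, hm, t, ht, rfl⟩ := eq_legPoint_of_lt hxy hbot
    have ht1 : t < 1 := by
      rcases lt_coord_or_exists_child ht hxy with h1 | ⟨n, h1, h2⟩
      · exact h1.trans_le unitInterval.le_one'
      · exact (h1.valid ((isCoherent_coord y).valid n h2)).2.2.2
    by_cases htD : t ∈ D m.kind
    · exact Or.inr ⟨m, hm, t, htD, ht, ht1, rfl⟩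
    · rw [h.pointOrder_eq (hasDirections_of_not_mem hm htD ht ht1)] at hx
      norm_num at hx

end axioms

end ColouredDendrite

/-! ### Invariance of the order under homeomorphisms -/

theorem Homeomorph.pointOrder_eq {X Y : Type*} [TopologicalSpace X] [TopologicalSpace Y]
    (e : X ≃ₜ Y) (x : X) : pointOrder (e x) = pointOrder x := by
  let f : ↥({x}ᶜ : Set X) ≃ₜ ↥({e x}ᶜ : Set Y) := e.subtype fun z => by simp
  refine (ENat.card_congr
    ⟨f.continuous.connectedComponentsMap, f.symm.continuous.connectedComponentsMap, ?_, ?_⟩).symm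
  · rintro ⟨z⟩
    exact congrArg ConnectedComponents.mk (f.symm_apply_apply z)
  · rintro ⟨z⟩
    exact congrArg ConnectedComponents.mk (f.apply_symm_apply z)

namespace ColouredDendrite

variable {D : Fin 2 → Set unitInterval}

theorem isInducing_coord : IsInducing (coord : Limit D → Leg → unitInterval) :=
  (continuous_coord.isClosedEmbedding coord_injective).isInducing

/-! ### Density of the ends of the legs -/

open Classical in
/-- The end of some leg attached at position `t` of the leg `m`, if there is one. -/
noncomputable def childEnd (m : Leg) (hm : m.Valid D) (t : unitInterval) : Limit D :=
  if h : ∃ n, IsChild n m t ∧ n.Valid D then legPoint D h.choose h.choose_spec.2 1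
  else legPoint D m hm t

theorem coord_childEnd {m : Leg} (hm : m.Valid D) {t : unitInterval} {k : Leg}
    (hk : ¬ IsChild k m t) : coord (childEnd m hm t) k = m.point t k := by
  rw [childEnd]
  split_ifs with h
  · have hc := h.choose_spec.1
    rw [coord_legPoint, hc.point_eq, Function.update_of_ne]
    rintro rfl
    exact hk hc
  · rw [coord_legPoint]

/-- The null family property: a given coordinate belongs to a leg attached to `m` at one position at
most, so near `s` it does not see the attached legs. -/
theorem tendsto_childEnd {m : Leg} (hm : m.Valid D) (s : unitInterval) :
    Filter.Tendsto (childEnd m hm) (𝓝[≠] s) (𝓝 (legPoint D m hm s)) := by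
  rw [isInducing_coord.tendsto_nhds_iff, tendsto_pi_nhds]
  intro k
  rw [coord_legPoint]
  have hcont : Continuous fun t => m.point t k := by
    by_cases hk : k = m
    · subst hk
      simp only [Leg.point_self]
      exact continuous_id
    · simp only [Leg.point_of_ne _ 0 hk]
      exact continuous_const
  refine ((hcont.tendsto s).mono_left nhdsWithin_le_nhds).congr' ?_
  have hsub : {t | IsChild k m t}.Subsingleton := fun t ht t' ht' => (ht.unique ht').2
  have hev : ∀ᶠ t in 𝓝[≠] s, ¬ IsChild k m t := by
    have : ({t | IsChild k m t} \ {s})ᶜ ∈ 𝓝 s :=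
      (hsub.finite.subset sdiff_subset).isClosed.isOpen_compl.mem_nhds (by simp)
    filter_upwards [mem_nhdsWithin_of_mem_nhds this, self_mem_nhdsWithin] with t h1 h2 h3
    exact h1 ⟨h3, h2⟩
  filter_upwards [hev] with t ht
  exact (coord_childEnd hm ht).symm

theorem isMax_legPoint_one {m : Leg} (hm : m.Valid D) : IsMax (legPoint D m hm 1) := by
  rw [isMax_iff_forall_not_lt]
  intro x hx
  rcases lt_coord_or_exists_child one_pos hx with h1 | ⟨n, h1, h2⟩
  · exact h1.not_ge unitInterval.le_one'
  · exact (h1.valid ((isCoherent_coord x).valid n h2)).2.2.2.false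

section axioms

variable (hdense : ∀ i, Dense (D i))
  (havoid : ∀ i, ∀ a ∈ D i, ∀ n : ℕ, (a : ℝ) ≠ n / (n + 1))
include hdense havoid

theorem isUnboundedEnd_legPoint_one {m : Leg} (hm : m.Valid D) :
    IsColouredTree.IsUnboundedEnd (ramificationPoints D) count (legPoint D m hm 1) := by
  refine ⟨legPoint_ne_bot one_pos, isMax_legPoint_one hm, fun N => ?_⟩
  obtain ⟨s, hs, -, -, h1, h2⟩ := exists_mem_interval hdense m.kind (u := 0) (v := 1) (j := N)
    one_pos (lt_of_le_of_lt unitInterval.nonneg' (barrier_lt N))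
    ((barrier_lt N).trans_le unitInterval.le_one')
  have h0 := pos_of_mem havoid hs
  refine ⟨_, Or.inr ⟨m, hm, s, hs, h0, h1, rfl⟩, legPoint_lt_legPoint h1, ?_⟩
  rw [count_legPoint hm h0]
  omega

omit hdense in
theorem exists_isChild_valid {m : Leg} (hm : m.Valid D) {t : unitInterval} (ht : t ∈ D m.kind)
    (ht1 : t < 1) : ∃ n, IsChild n m t ∧ n.Valid D := by
  rcases isRed_or_isGreen havoid ht ht1 with h | h
  · exact ⟨.red m t 0, Or.inl ⟨0, rfl⟩, hm, ht, h⟩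
  · exact ⟨.green m t, Or.inr rfl, hm, ht, h⟩

theorem legPoint_mem_closure {m : Leg} (hm : m.Valid D) {s : unitInterval} (hs : s < 1) :
    legPoint D m hm s ∈
      closure {x | IsColouredTree.IsUnboundedEnd (ramificationPoints D) count x} := by
  have hfreq : ∃ᶠ t in 𝓝[>] s, t ∈ D m.kind ∧ t < 1 := by
    rw [Filter.frequently_iff]
    intro U hU
    obtain ⟨u, hu, hsub⟩ := (mem_nhdsGT_iff_exists_Ioo_subset' hs).1 hU
    obtain ⟨t, ht, h1, h2⟩ := (hdense m.kind).exists_between (show s < u from hu)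
    exact ⟨t, hsub ⟨h1, h2⟩, ht, h2.trans_le unitInterval.le_one'⟩
  refine mem_closure_of_frequently_of_tendsto (f := childEnd m hm) (hfreq.mono ?_)
    ((tendsto_childEnd hm s).mono_left (nhdsWithin_mono s fun t ht => ne_of_gt ht))
  rintro t ⟨ht, ht1⟩
  have hex := exists_isChild_valid havoid hm ht ht1
  rw [childEnd, dif_pos hex]
  exact isUnboundedEnd_legPoint_one hdense havoid _

theorem dense_isUnboundedEnd (hcountable : ∀ i, (D i).Countable) :
    Dense {x : Limit D | IsColouredTree.IsUnboundedEnd (ramificationPoints D) count x} := by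
  refine dense_closure.1 ((isColouredTree hdense havoid hcountable).dense_mem.mono ?_)
  rintro x (rfl | ⟨m, hm, s, -, -, hs, rfl⟩)
  · have : (⊥ : Limit D) = legPoint D (.root 0) (valid_root 0) 0 := by
      apply coord_injective
      funext m
      simp [Leg.point]
    rw [this]
    exact legPoint_mem_closure hdense havoid _ one_pos
  · exact legPoint_mem_closure hdense havoid _ hs

end axioms

/-! ### Ends that are not on a leg -/

/-- The successive legs of kind `0`, each attached at position `a` of the preceding one, with the
choice between the two legs attached there made by `b`. -/
def redBranch (a : unitInterval) (b : ℕ → Fin 2) : ℕ → Leg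
  | 0 => .root 0
  | k + 1 => .red (redBranch a b k) a (b k)

section branch

variable {a : unitInterval} {b : ℕ → Fin 2}

theorem level_redBranch (k : ℕ) : (redBranch a b k).level = k := by
  induction k with
  | zero => rfl
  | succ k ih => simp [redBranch, Leg.level, ih]

theorem kind_redBranch (k : ℕ) : (redBranch a b k).kind = 0 := by
  cases k <;> rfl

theorem valid_redBranch (ha : a ∈ D 0) (hred : IsRed 0 a) (k : ℕ) :
    (redBranch a b k).Valid D := by
  induction k with
  | zero => trivial
  | succ k ih => exact ⟨ih, by rwa [kind_redBranch], by rwa [kind_redBranch]⟩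

theorem isChild_redBranch (k : ℕ) : IsChild (redBranch a b (k + 1)) (redBranch a b k) a :=
  Or.inl ⟨b k, rfl⟩

open Classical in
/-- The coordinates of the end of the branch `redBranch a b`. -/
noncomputable def branchCoord (a : unitInterval) (b : ℕ → Fin 2) (m : Leg) : unitInterval :=
  if m = redBranch a b m.level then a else 0

theorem branchCoord_ne_zero {m : Leg} (h : branchCoord a b m ≠ 0) :
    m = redBranch a b m.level := by
  by_contra h1
  exact h (if_neg h1)

theorem branchCoord_redBranch (k : ℕ) : branchCoord a b (redBranch a b k) = a := by
  rw [branchCoord, level_redBranch, if_pos rfl]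

theorem isCoherent_branchCoord (ha : a ∈ D 0) (hred : IsRed 0 a) :
    IsCoherent D (branchCoord a b) := by
  refine ⟨fun m hm => ?_, fun i j hi hj => ?_, fun m ℓ a' hc hm => ?_,
    fun m n ℓ a' hc hc' hm hn => ?_⟩
  · rw [branchCoord_ne_zero hm]
    exact valid_redBranch ha hred _
  · have h1 := branchCoord_ne_zero hi
    have h2 := branchCoord_ne_zero hj
    exact Leg.root.inj (h1.trans h2.symm)
  · have h1 := branchCoord_ne_zero hm
    rw [hc.level_eq] at h1
    obtain ⟨h2, rfl⟩ := hc.unique (h1 ▸ isChild_redBranch ℓ.level)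
    rw [h2, branchCoord_redBranch]
  · rw [branchCoord_ne_zero hm, branchCoord_ne_zero hn, hc.level_eq, hc'.level_eq]

/-- The end of the branch `redBranch a b`. -/
noncomputable def branchEnd (ha : a ∈ D 0) (hred : IsRed 0 a) (b : ℕ → Fin 2) : Limit D :=
  ofCoord (branchCoord a b) (isCoherent_branchCoord ha hred)

theorem coord_branchEnd (ha : a ∈ D 0) (hred : IsRed 0 a) (k : ℕ) :
    coord (branchEnd ha hred b) (redBranch a b k) = a := by
  rw [branchEnd, coord_ofCoord, branchCoord_redBranch]

theorem branchEnd_injective (ha : a ∈ D 0) (hred : IsRed 0 a) (h0 : a ≠ 0) :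
    Function.Injective (branchEnd ha hred) := by
  intro b b' hbb
  have key : ∀ k, redBranch a b k = redBranch a b' k := by
    intro k
    have h1 := coord_branchEnd (b := b) ha hred k
    rw [hbb, branchEnd, coord_ofCoord] at h1
    have h2 := branchCoord_ne_zero (h1 ▸ h0)
    rwa [level_redBranch] at h2
  funext k
  exact (Leg.red.inj (key (k + 1))).2.2

/-- A point above has nonzero coordinates along the whole branch, and these determine its
coordinates at every level. -/
theorem isMax_branchEnd (ha : a ∈ D 0) (hred : IsRed 0 a) (h0 : a ≠ 0) :
    IsMax (branchEnd ha hred b) := by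
  rw [isMax_iff_forall_not_lt]
  intro y hy
  obtain ⟨m, hm⟩ := exists_coord_lt hy.not_ge
  have h1 : ∀ k, coord y (redBranch a b k) ≠ 0 := fun k => by
    have := le_iff_coord.1 hy.le (redBranch a b k)
    rw [coord_branchEnd] at this
    exact ((unitInterval.pos_iff_ne_zero.2 h0).trans_le this).ne'
  have h2 := (isCoherent_coord y).child _ _ _ (isChild_redBranch m.level) (h1 _)
  have h3 := coord_branchEnd (b := b) ha hred m.level
  have h4 := (isCoherent_coord y).eq_point (h1 m.level) (n := m) (level_redBranch _).ge
  have h5 := (isCoherent_coord (branchEnd ha hred b)).eq_point (h3.symm ▸ h0) (n := m)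
    (level_redBranch _).ge
  rw [h2] at h4
  rw [h3] at h5
  exact hm.ne (h5.trans h4.symm)

theorem count_redBranch (k : ℕ) : (redBranch a b k).count = k * interval a := by
  induction k with
  | zero => simp [redBranch, Leg.count]
  | succ k ih => rw [redBranch, Leg.count, ih, Nat.succ_mul]

theorem isUnboundedEnd_branchEnd (ha : a ∈ D 0) (hred : IsRed 0 a) (h0 : a ≠ 0) (h1 : a < 1)
    (hi : 0 < interval a) :
    IsColouredTree.IsUnboundedEnd (ramificationPoints D) count (branchEnd ha hred b) := by
  have hpos := unitInterval.pos_iff_ne_zero.2 h0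
  refine ⟨?_, isMax_branchEnd ha hred h0, fun N => ?_⟩
  · intro h
    have := coord_branchEnd (b := b) ha hred 0
    rw [h, coord_bot] at this
    exact h0 this.symm
  · refine ⟨_, Or.inr ⟨redBranch a b N, valid_redBranch ha hred N, a, by rwa [kind_redBranch],
      hpos, h1, rfl⟩, ?_, ?_⟩
    · refine legPoint_lt_of_child (isChild_redBranch N) ?_
      rwa [coord_branchEnd]
    · rw [count_legPoint _ hpos, count_redBranch]
      nlinarith

end branch

theorem not_countable_isUnboundedEnd (hdense : ∀ i, Dense (D i)) :
    ¬ {x : Limit D | IsColouredTree.IsUnboundedEnd (ramificationPoints D) count x}.Countable := by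
  -- The interval `(2 / 3, 3 / 4)` is red in `T_0`, giving two choices at each step, and lies beyond
  -- two barriers, so the count grows by `2` each time. Leg ends would not do: there are only
  -- countably many.
  obtain ⟨a, ha, h1, h2⟩ := (hdense 0).exists_between (barrier_lt 2)
  have h3 : ((2 : ℕ) / ((2 : ℕ) + 1) : ℝ) < a := h1
  have h4 : (a : ℝ) < ((2 : ℕ) + 1) / ((2 : ℕ) + 2) := by
    rw [← coe_barrier_succ]
    exact h2
  have hi := interval_eq h3.le h4
  have h0 : a ≠ 0 := (lt_of_le_of_lt unitInterval.nonneg' h1).ne'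
  have hred : IsRed 0 a := ⟨2, h3, h4, by simp⟩
  intro hc
  have hrange : (range (branchEnd ha hred)).Countable := hc.mono <| by
    rintro _ ⟨b, rfl⟩
    exact isUnboundedEnd_branchEnd ha hred h0 (h2.trans_le unitInterval.le_one') (by omega)
  have hcount : Countable (ℕ → Fin 2) :=
    (countable_univ_iff.1 (countable_of_injective_of_countable_image
      (branchEnd_injective ha hred h0).injOn (by rwa [image_univ])))
  obtain ⟨f, hf⟩ := exists_surjective_nat (ℕ → Fin 2)
  obtain ⟨n, hn⟩ := hf fun k => f k k + 1
  have := congrFun hn n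
  generalize f n n = i at this
  revert i
  decide

/-! ### The order of the points of a leg -/

section axioms

variable (hcountable : ∀ i, (D i).Countable)
  (havoid : ∀ i, ∀ a ∈ D i, ∀ n : ℕ, (a : ℝ) ≠ n / (n + 1))
include hcountable havoid

theorem pointOrder_legPoint {m : Leg} (hm : m.Valid D) {t : unitInterval} (h0 : 0 < t)
    (h1 : t < 1) :
    (pointOrder (legPoint D m hm t) = 4 ↔ t ∈ D m.kind ∧ IsRed m.kind t) ∧
    (pointOrder (legPoint D m hm t) = 3 ↔ t ∈ D m.kind ∧ IsGreen m.kind t) := by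
  have h := isTreeOrder hcountable
  by_cases ht : t ∈ D m.kind
  · have hexcl : ¬ (IsRed m.kind t ∧ IsGreen m.kind t) := by
      rw [isRed_iff havoid ht h1, isGreen_iff havoid ht h1, ← Nat.not_even_iff_odd]
      tauto
    rcases isRed_or_isGreen havoid ht h1 with hc | hc
    · have hg : ¬ IsGreen m.kind t := fun hg => hexcl ⟨hc, hg⟩
      rw [h.pointOrder_eq (hasDirections_of_red havoid hm ht h0 h1 hc)]
      simp [ht, hc, hg]
    · have hr : ¬ IsRed m.kind t := fun hr => hexcl ⟨hr, hc⟩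
      rw [h.pointOrder_eq (hasDirections_of_green havoid hm ht h0 h1 hc)]
      simp [ht, hc, hr]
  · rw [h.pointOrder_eq (hasDirections_of_not_mem hm ht h0 h1)]
    simp [ht]

omit havoid in
theorem isArcBetween_legPoint {m : Leg} (hm : m.Valid D) {s t : unitInterval} (hs : 0 < s)
    (hst : s < t) : ∃ A : Set (Limit D), IsArcBetween A (legPoint D m hm s) (legPoint D m hm t) ∧
      ∀ z ∈ A, ∃ u, s ≤ u ∧ u ≤ t ∧ z = legPoint D m hm u := by
  have hlt : legPoint D m hm s < legPoint D m hm t := legPoint_lt_legPoint hst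
  obtain ⟨γ, hγ, h0, h1, hr, -⟩ := (isTreeOrder hcountable).exists_arc hlt.ne
  refine ⟨_, ⟨γ, hγ, h0, h1, hr⟩, ?_⟩
  rintro z ⟨hz1, hz2⟩
  rw [inf_eq_left.2 hlt.le] at hz1
  have hz3 : z ≤ legPoint D m hm t := hz2.elim (fun h => h.trans hlt.le) id
  have hz4 := (legPoint_le_iff hm hs.ne').1 hz1
  have hz5 := le_iff_coord.1 hz3 m
  rw [coord_legPoint, Leg.point_self] at hz5
  exact ⟨_, hz4, hz5, eq_legPoint_of_le hm hz3 (hs.trans_le hz4).ne'⟩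

theorem isEmpty_homeomorph_of_isWazewski {Y : Type*} [TopologicalSpace Y]
    (hY : IsWazewski {3, 4} Y) : IsEmpty (Limit D ≃ₜ Y) := by
  refine ⟨fun e => ?_⟩
  -- Both positions lie before the first barrier `1 / 2`, where a root leg carries only red points.
  let s : unitInterval := ⟨1 / 8, by norm_num, by norm_num⟩
  let t : unitInterval := ⟨1 / 4, by norm_num, by norm_num⟩
  have hs : 0 < s := Subtype.coe_lt_coe.1 (by norm_num [s])
  have hst : s < t := Subtype.coe_lt_coe.1 (by norm_num [s, t])
  obtain ⟨A, ⟨γ, hγ, h0, h1, rfl⟩, hA⟩ :=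
    isArcBetween_legPoint hcountable (valid_root 0 : (Leg.root 0).Valid D) hs hst
  obtain ⟨-, ⟨r, rfl⟩, -, h2⟩ := hY.arcwiseDense 3 (by simp) (range (e ∘ γ)) _ _
    ⟨e ∘ γ, e.isEmbedding.comp hγ, rfl, rfl, rfl⟩
  obtain ⟨u, h3, h4, h5⟩ := hA _ (mem_range_self r)
  have h6 : (u : ℝ) ≤ 1 / 4 := h4
  have hu1 : u < 1 := Subtype.coe_lt_coe.1 (lt_of_le_of_lt h6 (by norm_num))
  rw [Function.comp_apply, e.pointOrder_eq, h5,
    (pointOrder_legPoint hcountable havoid _ (hs.trans_le h3) hu1).2] at h2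
  obtain ⟨n, h7, -, h8⟩ := h2.2
  have hn : (1 : ℝ) ≤ n := by
    rcases n with _ | n
    · simp [Leg.kind] at h8
    · push_cast
      linarith [(Nat.cast_nonneg n : (0 : ℝ) ≤ n)]
  have : (1 / 2 : ℝ) ≤ n / (n + 1) := by
    rw [div_le_div_iff₀ (by norm_num) (by positivity)]
    linarith
  linarith

end axioms

end ColouredDendrite

end

theorem mainTheorem2 (D : Fin 2 → Set unitInterval)
    (hcountable : ∀ i, (D i).Countable) (hdense : ∀ i, Dense (D i))
    (havoid : ∀ i, ∀ a ∈ D i, ∀ n : ℕ, (a : ℝ) ≠ n / (n + 1)) :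
    IsDendrite (ColouredDendrite.Limit D) ∧
    (∀ x : ColouredDendrite.Limit D, IsRamification x → pointOrder x = 3 ∨ pointOrder x = 4) ∧
    (∀ (ℓ : ColouredDendrite.Leg) (hℓ : ℓ.Valid D) (t : unitInterval), 0 < t → t < 1 →
      (pointOrder (ColouredDendrite.legPoint D ℓ hℓ t) = 4 ↔
        t ∈ D ℓ.kind ∧ ColouredDendrite.IsRed ℓ.kind t) ∧
      (pointOrder (ColouredDendrite.legPoint D ℓ hℓ t) = 3 ↔
        t ∈ D ℓ.kind ∧ ColouredDendrite.IsGreen ℓ.kind t)) ∧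
    (∀ (Y : Type) [TopologicalSpace Y], IsWazewski {3, 4} Y →
      IsEmpty (ColouredDendrite.Limit D ≃ₜ Y)) ∧
    MulAction.IsMinimal (ColouredDendrite.Limit D ≃ₜ ColouredDendrite.Limit D)
      (ColouredDendrite.Limit D) ∧
    ¬ {x : ColouredDendrite.Limit D | IsAlternatingEndpoint x}.Countable ∧
    (∀ a b : ColouredDendrite.Limit D, IsAlternatingEndpoint a → IsAlternatingEndpoint b → a ≠ b →
      collapseMap a b ∈ ellisSemigroup (ColouredDendrite.Limit D ≃ₜ ColouredDendrite.Limit D)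
        (ColouredDendrite.Limit D) ∧
      collapseMap a b ∘ collapseMap a b = collapseMap a b) ∧
    ¬ FirstCountableTopology
      (ellisSemigroup (ColouredDendrite.Limit D ≃ₜ ColouredDendrite.Limit D)
        (ColouredDendrite.Limit D)) ∧
    ¬ IsTameOne (ColouredDendrite.Limit D ≃ₜ ColouredDendrite.Limit D)
      (ColouredDendrite.Limit D) := by
  have := ColouredDendrite.metrizableSpace hcountable
  have h := ColouredDendrite.isColouredTree hdense havoid hcountable
  have hiff : ∀ x : ColouredDendrite.Limit D, IsColouredTree.IsUnboundedEnd
      (ColouredDendrite.ramificationPoints D) ColouredDendrite.count x ↔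
      IsAlternatingEndpoint x :=
    fun x => ⟨h.alternating_of_isUnboundedEnd, h.isUnboundedEnd_of_alternating⟩
  have hdns := ColouredDendrite.dense_isUnboundedEnd hdense havoid hcountable
  have hunc := ColouredDendrite.not_countable_isUnboundedEnd hdense
  simp only [hiff] at hdns hunc
  have hcol : ∀ a ∈ {x : ColouredDendrite.Limit D | IsAlternatingEndpoint x},
      ∀ b ∈ {x : ColouredDendrite.Limit D | IsAlternatingEndpoint x}, a ≠ b →
      collapseMap a b ∈ ellisSemigroup (ColouredDendrite.Limit D ≃ₜ ColouredDendrite.Limit D)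
        (ColouredDendrite.Limit D) := fun a ha b hb =>
    h.collapseMap_mem ((hiff a).2 ha) ((hiff b).2 hb)
  have hfc := not_firstCountable_of_collapseMap hunc hcol
  refine ⟨h.isDendrite, fun x hx => ?_, fun ℓ hℓ t =>
    ColouredDendrite.pointOrder_legPoint hcountable havoid hℓ,
    fun Y _ => ColouredDendrite.isEmpty_homeomorph_of_isWazewski hcountable havoid,
    isMinimal_of_collapseMap hunc hcol hdns, hunc,
    fun a b ha hb hab => ⟨hcol a ha b hb hab, collapseMap_comp_self hab⟩, hfc,
    fun ht => hfc ht.2⟩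
  rw [h.pointOrder_of_mem (h.mem_of_order hx)]
  split_ifs <;> simp
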